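/- **Setting.** Let $d,K\ge 0$, $N_0,N\ge 1$ be integers, $\sigma,\beta>0$, $\theta_0\in\mathbb R^d$, $R\subseteq\{1,\dots,K\}$ (relevant sources), $\pi_k\in(0,1)$ for $k=1,\dots,K$, and let $\phi$ be a probability law on $\mathbb R^d$ with $\bar D^2:=\int\|t-\theta_0\|^2\,\phi(dt)<\infty$. Independently over $k$, put $\theta_k=\theta_0$ if $k\in R$ and draw $\theta_k\sim\phi$ if $k\notin R$; given $\theta_k$, source $k$ has data $x^{(k)}_1,\dots,x^{(k)}_N$ i.i.d. from $N(\theta_k,\sigma^2I)$. Independently of all sources, the target has data $x^{(0)}_1,\dots,x^{(0)}_{N_0}$ i.i.d. from $N(\theta_0,\sigma^2I)$. Let $\hat\theta_0,\hat\theta_k$ be the sample means. With $p(x\mid\theta)$ the density of $N(\theta,\sigma^2I)$ and $q(x)=\int p(x\mid t)\,\phi(dt)$, put $\ell(x;\theta)=\log\frac{p(x\mid\theta)}{q(x)}$ and $\rho_k(\theta)=\mathbb E_{x\sim N(\theta_k,\sigma^2I)}\,\ell(x;\theta)$. The tempered EM iteration, from an arbitrary starting point $\theta^{(0)}$, is $$w_k^{(t)}=\operatorname{sigmoid}\Big(\beta\sum_{i=1}^N\ell(x_i^{(k)};\theta^{(t)})+\log\tfrac{\pi_k}{1-\pi_k}\Big),\qquad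 \theta^{(t+1)}=\frac{N_0\hat\theta_0+N\sum_k w_k^{(t)}\hat\theta_k}{N_0+N\sum_k w_k^{(t)}} .$$ **Assumptions.** Let $V,L,\Delta^*,r_{\rm sep}>0$ and $\alpha\in[0,1]$ with $K\alpha\le\frac12$; let $c_1>0$ be the constant below, and call $\mathcal B=\{\theta:\|\theta-\theta_0\|\le c_1\Delta^*/L\}$ the basin. 1. (Regularity) On a neighbourhood $U\supseteq\mathcal B$ of $\theta_0$, for every $k$ and almost every draw of $\theta_k$: for all $\theta\in U$, $\ell(x;\theta)-\rho_k(\theta)$ is sub-Gaussian with parameter $V^2$ under $x\sim N(\theta_k,\sigma^2I)$, and $\rho_k$ is $L$-Lipschitz on $U$. 2. (Separation) $\phi(\|\theta-\theta_0\|<r_{\rm sep})\le\alpha$. 3. (Margin) For almost every draw of $(\theta_k)_k$ in the well-separated event $\{\|\theta_k-\theta_0\|\ge r_{\rm sep}\ \forall k\notin R\}$: $\rho_k(\theta_0)\ge\Delta^*$ for all $k\in R$ and $\rho_k(\theta_0)\le-\Delta^*$ for all $k\notin R$. **Corollary (unconditional MSE).** There are absolute constants $c_1,c_2,c_3,C>0$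 such that the following holds for all data as above. Let $\mathcal G$ be an event on which the EM iterates enter and remain in the basin (that is, $\theta^{(t)}\in\mathcal B$ for all sufficiently large $t$) and converge to a limit $\theta^{(\infty)}$ (the EM fixed point). Then, with the expectation taken over the draw of the source parameters as well as over all data, $$\mathbb E\big[\|\theta^{(\infty)}-\theta_0\|^2\,\mathbf 1_{\mathcal G}\big]\;\le\;\frac{2d\sigma^2}{N_0+N|R|}+3K\alpha\,r_{\rm sep}^2+C_1e^{-c_2\beta N\Delta^*}+C_2e^{-c_3N(\Delta^*)^2/V^2},$$ where, with $B=\max_k\big|\log\frac{\pi_k}{1-\pi_k}\big|$, $$C_1=C\,K^2\Big(\frac N{N_0}\Big)^2\Big(\bar D^2+\frac{d\sigma^2}N\Big)e^{2B},\qquad C_2=C\,K^{5/2}\Big(\frac N{N_0}\Big)^2\Big(\bar D^2+\frac{d\sigma^2}N\Big).$$ In particular, if $\mathcal G$ has probability one, the left-hand side is the MSE $\mathbb E\|\theta^{(\infty)}-\theta_0\|^2$. -/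

import Mathlib

open MeasureTheory ProbabilityTheory Filter Topology
open scoped NNReal ENNReal

noncomputable section

namespace ColdStart

/-- The parameter (and observation) space `ℝ^d` with its Euclidean norm. -/
abbrev E (d : ℕ) : Type := EuclideanSpace ℝ (Fin d)

/-- The isotropic normal law `N(θ, σ² I)` on `ℝ^d`. -/
def gaussLaw {d : ℕ} (σ : ℝ) (θ : E d) : Measure (E d) :=
  multivariateGaussian θ (σ ^ 2 • (1 : Matrix (Fin d) (Fin d) ℝ))

instance {d : ℕ} (σ : ℝ) (θ : E d) : IsProbabilityMeasure (gaussLaw σ θ) := by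
  unfold gaussLaw; infer_instance

/-- The density `p(x ∣ θ)` of `N(θ, σ² I)` with respect to Lebesgue measure. -/
def gaussDensity {d : ℕ} (σ : ℝ) (θ x : E d) : ℝ :=
  (2 * Real.pi * σ ^ 2) ^ (-(d : ℝ) / 2) * Real.exp (-‖x - θ‖ ^ 2 / (2 * σ ^ 2))

/-- The null density `q(x) = ∫ p(x ∣ t) φ(dt)`. -/
def nullDensity {d : ℕ} (σ : ℝ) (φ : Measure (E d)) (x : E d) : ℝ :=
  ∫ t, gaussDensity σ t x ∂φ

/-- The per-sample log-likelihood ratio `ℓ(x; θ) = log (p(x ∣ θ) / q(x))`. -/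
def logLR {d : ℕ} (σ : ℝ) (φ : Measure (E d)) (θ x : E d) : ℝ :=
  Real.log (gaussDensity σ θ x / nullDensity σ φ x)

/-- The expected log-likelihood ratio at `θ` when `x ∼ N(ϑ, σ² I)`. For `ϑ = θ_k` this is
`ρ_k(θ)`. -/
def expLogLR {d : ℕ} (σ : ℝ) (φ : Measure (E d)) (ϑ θ : E d) : ℝ :=
  ∫ x, logLR σ φ θ x ∂(gaussLaw σ ϑ)

/-! ### The generative model -/

/-- The prior law of the parameter `θ_k` of source `k`, given the set `R` of relevant sources:
`θ_k = θ₀` for `k ∈ R`, and `θ_k ∼ φ` for `k ∉ R`. -/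
def priorLaw {d K : ℕ} (θ₀ : E d) (φ : Measure (E d)) (R : Finset (Fin K)) (k : Fin K) :
    Measure (E d) :=
  if k ∈ R then Measure.dirac θ₀ else φ

instance {d K : ℕ} (θ₀ : E d) (φ : Measure (E d)) [IsProbabilityMeasure φ]
    (R : Finset (Fin K)) (k : Fin K) : IsProbabilityMeasure (priorLaw θ₀ φ R k) := by
  unfold priorLaw; split_ifs <;> infer_instance

theorem measurable_gaussLaw {d : ℕ} (σ : ℝ) :
    Measurable (fun θ : E d => gaussLaw σ θ) := by
  refine Measure.measurable_of_measurable_coe _ fun s hs => ?_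
  have h (A : E d →L[ℝ] E d) :
      Measurable fun θ : E d => ((stdGaussian (E d)).map fun z => θ + A z) s := by
    have hm : Measurable (fun p : E d × E d => p.1 + A p.2) := by fun_prop
    have h1 := measurable_measure_prodMk_left (ν := stdGaussian (E d)) (hm hs)
    have h2 (θ : E d) : ((stdGaussian (E d)).map fun z => θ + A z) s =
        stdGaussian (E d) (Prod.mk θ ⁻¹' ((fun p : E d × E d => p.1 + A p.2) ⁻¹' s)) := by
      rw [Measure.map_apply (by fun_prop) hs]
      rfl
    simpa only [h2] using h1
  exact h _

/-- The conditional law of `n` i.i.d. observations from `N(θ, σ² I)` given `θ`. -/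
def sampleKernel (d n : ℕ) (σ : ℝ) : Kernel (E d) (Fin n → E d) where
  toFun θ := Measure.pi fun _ => gaussLaw σ θ
  measurable' := by
    refine Measurable.measure_of_isPiSystem_of_isProbabilityMeasure
      generateFrom_pi.symm isPiSystem_pi ?_
    rintro _ ⟨s, hs, rfl⟩
    simp only [Measure.pi_pi]
    exact Finset.measurable_prod _ fun i _ =>
      (Measure.measurable_coe (show MeasurableSet (s i) from hs i (Set.mem_univ i))).comp (measurable_gaussLaw σ)

instance (d n : ℕ) (σ : ℝ) : IsMarkovKernel (sampleKernel d n σ) :=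
  ⟨fun θ => by
    change IsProbabilityMeasure (Measure.pi fun _ : Fin n => gaussLaw σ θ)
    infer_instance⟩

/-- The joint law of the target data and of the pairs (source parameter, source data):
`N₀` i.i.d. target observations from `N(θ₀, σ² I)` and, independently of them and of one another,
for each source `k` a parameter `θ_k` drawn from its prior and then, given `θ_k`,
`N` i.i.d. observations from `N(θ_k, σ² I)`. -/
def jointLaw {d K : ℕ} (N₀ N : ℕ) (σ : ℝ) (θ₀ : E d) (φ : Measure (E d)) (R : Finset (Fin K)) :
    Measure ((Fin N₀ → E d) × (Fin K → E d × (Fin N → E d))) :=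
  (sampleKernel d N₀ σ θ₀).prod
    (Measure.pi fun k => priorLaw θ₀ φ R k ⊗ₘ sampleKernel d N σ)

/-! ### The tempered EM iteration -/

/-- The maximum likelihood estimate of a Gaussian mean: the sample mean. -/
def mle {d n : ℕ} (x : Fin n → E d) : E d :=
  (n : ℝ)⁻¹ • ∑ i, x i

/-- The log-odds `log (p / (1 - p))`. -/
def logOdds (p : ℝ) : ℝ := Real.log (p / (1 - p))

/-- The E-step: the tempered weight `w = sigmoid (β s(θ) + log (p / (1 - p)))` of a source with
prior relevance probability `p`, where `s(θ) = ∑ i, ℓ(x_i; θ)`. -/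
def emWeight {d N : ℕ} (σ β : ℝ) (φ : Measure (E d)) (p : ℝ) (x : Fin N → E d) (θ : E d) : ℝ :=
  Real.sigmoid (β * (∑ i, logLR σ φ θ (x i)) + logOdds p)

/-- One EM update (E-step followed by M-step) from the current iterate `θ`, where `x₀` is the target
data and `x k` the data of source `k`. -/
def emStep {d K N₀ N : ℕ} (σ β : ℝ) (φ : Measure (E d)) (prob : Fin K → ℝ)
    (x₀ : Fin N₀ → E d) (x : Fin K → Fin N → E d) (θ : E d) : E d :=
  ((N₀ : ℝ) + N * ∑ k, emWeight σ β φ (prob k) (x k) θ)⁻¹ •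
    ((N₀ : ℝ) • mle x₀ + (N : ℝ) • ∑ k, emWeight σ β φ (prob k) (x k) θ • mle (x k))

/-! ### Assumptions -/

/-- The well-separated event, as a set of parameter configurations: every irrelevant
source has its parameter at distance at least `r` from `θ₀`. -/
def wellSeparated {d K : ℕ} (θ₀ : E d) (r : ℝ) (R : Finset (Fin K)) : Set (Fin K → E d) :=
  {t | ∀ k, k ∉ R → r ≤ ‖t k - θ₀‖}

/-- Regularity on a set `U` of parameters, for almost every draw of the source parameters:
the centred per-sample log-likelihood ratio is sub-Gaussian with parameter `V²` under `N(θ_k, σ² I)`,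
and `ρ_k` is `L`-Lipschitz. -/
def Regular {d K : ℕ} (σ : ℝ) (θ₀ : E d) (φ : Measure (E d)) (R : Finset (Fin K))
    (U : Set (E d)) (V L : ℝ≥0) : Prop :=
  ∀ k, ∀ᵐ ϑ ∂(priorLaw θ₀ φ R k),
    (∀ θ ∈ U, HasSubgaussianMGF (fun x => logLR σ φ θ x - expLogLR σ φ ϑ θ) (V ^ 2)
      (gaussLaw σ ϑ)) ∧
    LipschitzOnWith L (fun θ => expLogLR σ φ ϑ θ) U

/-- Identifiability margin `Δ`: for almost every well-separated draw of the source
parameters, `|ρ_k(θ₀)| ≥ Δ` for all sources `k`, the sign of `ρ_k(θ₀)` being the correct one, i.e.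
positive for relevant and negative for irrelevant sources. -/
def HasMargin {d K : ℕ} (σ : ℝ) (θ₀ : E d) (φ : Measure (E d)) (R : Finset (Fin K))
    (r Δ : ℝ) : Prop :=
  ∀ᵐ t ∂(Measure.pi fun k => priorLaw θ₀ φ R k), t ∈ wellSeparated θ₀ r R →
    ∀ k, (k ∈ R → Δ ≤ expLogLR σ φ (t k) θ₀) ∧ (k ∉ R → expLogLR σ φ (t k) θ₀ ≤ -Δ)

end ColdStart

end

namespace ColdStart

open scoped RealInnerProductSpace

/-! Write h for the error of a limit of the iteration, O for the error of the oracle mean (target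
pooled with the sources in R), A_k for the error of the mean of source k, M = N₀ + N|R|, v = dσ²/M
for the oracle variance, and ρ for the radius of the basin. A limit is a fixed point, so h is a
weighted mean. Subtracting the two mean equations and testing with h gives the identity
`weightedMean_sub_inner`, in which a source matters only through how far its weight is from 1 (on R)
or 0 (off R), and only through the component of A_k along h.

The fixed point depends on the data, so scores must be controlled at all points of the basin
simultaneously. No covering is needed. By `logLR_add` the log-likelihood ratio is quadratic in the
parameter, so moving from θ₀ to θ₀ + h changes the score of a source by a drift, which the Lipschitz
bound controls, plus N⟨mean noise, h⟩/σ² (`sum_logLR_eq`). Concentration is thus needed only at θ₀,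
where sub-Gaussianity applies, and for the Gaussian means.

Sources whose mean noise along h is large in the wrong direction form a random set T. The event
`noiseCluster` bounds the signed sums of the noise over all small sets at once. Off it, T is small
and its total pull along h is at most Γ‖h‖ (`sum_inner_le_of_notMem_noiseCluster`), with Γ so small
that the resulting error is a small fraction of v. All other separated sources have weights within ω
= exp(B − βNΔ/4) of ideal. Irrelevant sources inside the separation radius have arbitrary weights;
each costs at most about r² + v on average, and their expected number is at most Kα ≤ 1/2. This is
`fixedPoint_norm_sq_le_of_notMem`. On the exceptional event, or if ω is not small, the deterministic
bound `weightedMean_norm_le` with its factor N/N₀ is used, and Gaussian fourth moments turn the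
probability p of the event into √p; this produces K^(5/2) from K² and √K.

Two facts tie the constants together. Regularity on a ball of radius ρ forces ρ ≤ 2σ²L and ρ ≤ 2Vσ,
because the log-likelihood ratio is exactly quadratic and its increments exactly Gaussian
(`RegularAt.radius_le_lipschitz`, `RegularAt.radius_le_subgaussian`); the second one turns the
probability of a cluster into exp(−cNΔ²/V²). And one may assume 2v ≤ ρ², since otherwise staying in
the basin already gives the claim. -/

/-! ### Isotropic Gaussian laws and their moments. -/

theorem posSemidef_sq_smul_one (d : ℕ) (σ : ℝ) :
    (σ ^ 2 • (1 : Matrix (Fin d) (Fin d) ℝ)).PosSemidef :=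
  Matrix.PosSemidef.one.smul (sq_nonneg σ)

theorem charFun_gaussLaw {d : ℕ} (σ : ℝ) (θ t : E d) :
    charFun (gaussLaw σ θ) t
      = Complex.exp (⟪t, θ⟫ * Complex.I - (σ ^ 2 * ‖t‖ ^ 2 / 2 : ℝ)) := by
  rw [gaussLaw, charFun_multivariateGaussian (posSemidef_sq_smul_one d σ)]
  congr 2
  rw [Matrix.smul_mulVec, Matrix.one_mulVec, dotProduct_smul, EuclideanSpace.real_norm_sq_eq]
  simp [dotProduct, pow_two]

theorem gaussLaw_eq_map_stdGaussian {d : ℕ} (σ : ℝ) (θ : E d) :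
    gaussLaw σ θ = (stdGaussian (E d)).map (fun z => θ + σ • z) := by
  apply Measure.ext_of_charFun
  ext t
  have h : (fun z : E d => θ + σ • z) = (fun z => z + θ) ∘ (fun z => σ • z) := by
    ext z; simp [add_comm]
  rw [h, ← Measure.map_map (by fun_prop) (by fun_prop), charFun_map_add_const,
    charFun_map_smul, charFun_stdGaussian, charFun_gaussLaw, ← Complex.exp_add]
  congr 1
  rw [norm_smul, real_inner_comm]
  push_cast
  rw [mul_pow, ← Complex.ofReal_pow ‖σ‖, Real.norm_eq_abs, sq_abs]
  push_cast
  ring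

theorem gaussLaw_eq_map_add {d : ℕ} (σ : ℝ) (θ : E d) :
    gaussLaw σ θ = (gaussLaw σ 0).map (fun z => θ + z) := by
  rw [gaussLaw_eq_map_stdGaussian, gaussLaw_eq_map_stdGaussian,
    Measure.map_map (by fun_prop) (by fun_prop)]
  congr 1
  ext z
  simp

theorem hasLaw_gaussLaw_finsetSum {d : ℕ} {Ω ι : Type*} {mΩ : MeasurableSpace Ω} {P : Measure Ω}
    [IsProbabilityMeasure P] {X : ι → Ω → E d} (hX : iIndepFun X P) {a : ι → ℝ} (s : Finset ι)
    (h : ∀ i, HasLaw (X i) (gaussLaw (a i) 0) P) (c : ι → ℝ) :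
    HasLaw (fun ω => ∑ i ∈ s, c i • X i ω)
      (gaussLaw (√(∑ i ∈ s, (c i * a i) ^ 2)) 0) P where
  aemeasurable := Finset.aemeasurable_fun_sum _ fun i _ =>
    AEMeasurable.const_smul (h i).aemeasurable (c i)
  map_eq := by
    have hm (i : ι) : AEMeasurable (fun ω => c i • X i ω) P :=
      AEMeasurable.const_smul (h i).aemeasurable (c i)
    have hi : iIndepFun (fun i ω => c i • X i ω) P :=
      hX.comp (fun i x => c i • x) (fun i => by fun_prop)
    apply Measure.ext_of_charFun
    rw [(hi.restrict s).charFun_map_fun_finsetSum_eq_prod (fun i _ => hm i)]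
    ext t
    rw [Finset.prod_apply, charFun_gaussLaw, Real.sq_sqrt (by positivity)]
    have (i : ι) : charFun (P.map (fun ω => c i • X i ω)) t
        = Complex.exp (-((c i * a i) ^ 2 * ‖t‖ ^ 2 / 2 : ℝ)) := by
      rw [charFun_map_smul_comp (h i).aemeasurable, (h i).map_eq, charFun_gaussLaw, norm_smul]
      simp [mul_pow]
      ring_nf
    simp_rw [this, ← Complex.exp_sum]
    congr 1
    simp [Finset.sum_mul, Finset.sum_div]

theorem integrable_exp_sq_gaussianReal :
    Integrable (fun x : ℝ => Real.exp (x ^ 2 / 4)) (gaussianReal 0 1) ∧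
      ∫ x, Real.exp (x ^ 2 / 4) ∂(gaussianReal 0 1) = √2 := by
  have hpt (x : ℝ) : gaussianPDFReal 0 1 x • Real.exp (x ^ 2 / 4)
      = (√(2 * Real.pi))⁻¹ * Real.exp (-(1 / 4) * x ^ 2) := by
    simp only [gaussianPDFReal, smul_eq_mul, NNReal.coe_one, mul_one, sub_zero]
    rw [mul_assoc, ← Real.exp_add]
    congr 2
    ring
  constructor
  · rw [gaussianReal_of_var_ne_zero _ one_ne_zero,
      integrable_withDensity_iff_integrable_smul' (by fun_prop) (by simp [gaussianPDF])]
    simp only [toReal_gaussianPDF, hpt]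
    exact (integrable_exp_neg_mul_sq (by norm_num)).const_mul _
  · rw [integral_gaussianReal_eq_integral_smul one_ne_zero]
    simp_rw [hpt]
    rw [integral_const_mul, integral_gaussian]
    rw [show Real.pi / (1 / 4) = 2 * (2 * Real.pi) by ring, Real.sqrt_mul (by norm_num) (2 * Real.pi),
      mul_comm √2, inv_mul_cancel_left₀ (by positivity)]

theorem integrable_exp_norm_sq_stdGaussian (d : ℕ) :
    Integrable (fun x : E d => Real.exp (‖x‖ ^ 2 / 4)) (stdGaussian (E d)) ∧
      ∫ x, Real.exp (‖x‖ ^ 2 / 4) ∂(stdGaussian (E d)) = √2 ^ d := by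
  have hpt (x : Fin d → ℝ) : Real.exp (‖(WithLp.toLp 2 x : E d)‖ ^ 2 / 4)
      = ∏ i, Real.exp (x i ^ 2 / 4) := by
    rw [EuclideanSpace.real_norm_sq_eq, Finset.sum_div, Real.exp_sum]
  rw [← map_pi_eq_stdGaussian]
  constructor
  · rw [integrable_map_measure (by fun_prop) (by fun_prop)]
    simp only [Function.comp_def, hpt]
    exact Integrable.fintype_prod (f := fun _ y => Real.exp (y ^ 2 / 4))
      (fun _ => integrable_exp_sq_gaussianReal.1)
  · rw [integral_map (by fun_prop) (by fun_prop)]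
    simp only [hpt]
    rw [integral_fintype_prod_eq_prod (f := fun _ y => Real.exp (y ^ 2 / 4))]
    simp [integrable_exp_sq_gaussianReal.2]

theorem integral_norm_sq_stdGaussian (d : ℕ) :
    Integrable (fun x : E d => ‖x‖ ^ 2) (stdGaussian (E d)) ∧
      ∫ x, ‖x‖ ^ 2 ∂(stdGaussian (E d)) = d := by
  have h1 : Integrable (fun y : ℝ => y ^ 2) (gaussianReal 0 1) :=
    (memLp_id_gaussianReal 2).integrable_sq
  have h2 : ∫ y : ℝ, y ^ 2 ∂(gaussianReal 0 1) = 1 := by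
    have := variance_fun_id_gaussianReal (μ := 0) (v := 1)
    rw [variance_eq_integral measurable_id'.aemeasurable] at this
    simpa using this
  rw [← map_pi_eq_stdGaussian]
  have h3 (i : Fin d) : Integrable (fun x : Fin d → ℝ => x i ^ 2)
      (Measure.pi fun _ => gaussianReal 0 1) :=
    integrable_comp_eval (μ := fun _ : Fin d => gaussianReal 0 1) (i := i)
      (f := fun y : ℝ => y ^ 2) h1
  constructor
  · rw [integrable_map_measure (by fun_prop) (by fun_prop)]
    simp only [Function.comp_def, EuclideanSpace.real_norm_sq_eq]
    exact integrable_finsetSum _ fun i _ => h3 i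
  · rw [integral_map (by fun_prop) (by fun_prop)]
    simp only [EuclideanSpace.real_norm_sq_eq]
    rw [integral_finsetSum _ fun i _ => h3 i]
    have (i : Fin d) : ∫ x : Fin d → ℝ, x i ^ 2 ∂(Measure.pi fun _ => gaussianReal 0 1) = 1 := by
      rw [← h2]
      exact integral_comp_eval (μ := fun _ : Fin d => gaussianReal 0 1) (i := i)
        (f := fun y : ℝ => y ^ 2) (by fun_prop)
    simp [this]

/-- The quadratic term of the exponential series suffices. This derives fourth moments from the
exponential moment already computed, at the price of the constant 49 in place of 3. -/
theorem pow_four_le_exp (y : ℝ) : y ^ 4 ≤ 32 * Real.exp (y ^ 2 / 4) := by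
  have := Real.quadratic_le_exp_of_nonneg (x := y ^ 2 / 4) (by positivity)
  nlinarith [sq_nonneg y]

theorem integral_norm_pow_four_stdGaussian (d : ℕ) :
    Integrable (fun x : E d => ‖x‖ ^ 4) (stdGaussian (E d)) ∧
      ∫ x, ‖x‖ ^ 4 ∂(stdGaussian (E d)) ≤ (7 * d) ^ 2 := by
  have h1 : Integrable (fun y : ℝ => y ^ 4) (gaussianReal 0 1) :=
    (integrable_exp_sq_gaussianReal.1.const_mul 32).mono' (by fun_prop)
      (ae_of_all _ fun y => by
        rw [Real.norm_of_nonneg (by positivity)]; exact pow_four_le_exp y)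
  have h2 : ∫ y : ℝ, y ^ 4 ∂(gaussianReal 0 1) ≤ 49 := by
    calc ∫ y : ℝ, y ^ 4 ∂(gaussianReal 0 1)
        ≤ ∫ y : ℝ, 32 * Real.exp (y ^ 2 / 4) ∂(gaussianReal 0 1) :=
          integral_mono h1 (integrable_exp_sq_gaussianReal.1.const_mul 32) pow_four_le_exp
      _ = 32 * √2 := by rw [integral_const_mul, integrable_exp_sq_gaussianReal.2]
      _ ≤ 49 := by
          have : √2 ≤ 1.5 := Real.sqrt_le_iff.2 (by norm_num)
          linarith
  have h3 (i : Fin d) : Integrable (fun x : Fin d → ℝ => x i ^ 4)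
      (Measure.pi fun _ => gaussianReal 0 1) :=
    integrable_comp_eval (μ := fun _ : Fin d => gaussianReal 0 1) (i := i)
      (f := fun y : ℝ => y ^ 4) h1
  have hle (x : Fin d → ℝ) : ‖(WithLp.toLp 2 x : E d)‖ ^ 4 ≤ d * ∑ i, x i ^ 4 := by
    have h : ‖(WithLp.toLp 2 x : E d)‖ ^ 4 = (∑ i, x i ^ 2) ^ 2 := by
      rw [← EuclideanSpace.real_norm_sq_eq (WithLp.toLp 2 x)]; ring
    have := sq_sum_le_card_mul_sum_sq (s := Finset.univ) (f := fun i => x i ^ 2)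
    rw [h]
    simpa [← pow_mul] using this
  have hi : Integrable (fun x : Fin d → ℝ => d * ∑ i, x i ^ 4)
      (Measure.pi fun _ => gaussianReal 0 1) :=
    (integrable_finsetSum _ fun i _ => h3 i).const_mul _
  have hi' : Integrable (fun x : Fin d → ℝ => ‖(WithLp.toLp 2 x : E d)‖ ^ 4)
      (Measure.pi fun _ => gaussianReal 0 1) :=
    hi.mono' (by fun_prop) (ae_of_all _ fun x => by
      rw [Real.norm_of_nonneg (by positivity)]; exact hle x)
  rw [← map_pi_eq_stdGaussian]
  constructor
  · rwa [integrable_map_measure (by fun_prop) (by fun_prop)]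
  · rw [integral_map (by fun_prop) (by fun_prop)]
    refine (integral_mono hi' hi hle).trans ?_
    rw [integral_const_mul, integral_finsetSum _ fun i _ => h3 i]
    have (i : Fin d) : ∫ x : Fin d → ℝ, x i ^ 4 ∂(Measure.pi fun _ => gaussianReal 0 1) ≤ 49 := by
      refine le_trans (le_of_eq ?_) h2
      exact integral_comp_eval (μ := fun _ : Fin d => gaussianReal 0 1) (i := i)
        (f := fun y : ℝ => y ^ 4) (by fun_prop)
    have := Finset.sum_le_sum fun i (_ : i ∈ Finset.univ) => this i
    simp only [Finset.sum_const, Finset.card_univ, Fintype.card_fin, nsmul_eq_mul] at this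
    nlinarith [(Nat.cast_nonneg d : (0 : ℝ) ≤ d)]

/-! ### Integrals against the law of a centred Gaussian vector -/

section HasLaw

variable {d : ℕ} {Ω : Type*} {mΩ : MeasurableSpace Ω} {P : Measure Ω} {s : ℝ} {X : Ω → E d}

theorem integrable_comp_of_hasLaw_gaussLaw (h : HasLaw X (gaussLaw s 0) P) {f : E d → ℝ}
    (hf : Measurable f) (hi : Integrable (fun x => f (s • x)) (stdGaussian (E d))) :
    Integrable (fun ω => f (X ω)) P := by
  have h1 : Integrable f (P.map X) := by
    rw [h.map_eq, gaussLaw_eq_map_stdGaussian]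
    rw [integrable_map_measure (by fun_prop) (by fun_prop)]
    simpa [Function.comp_def] using hi
  exact (integrable_map_measure (by fun_prop) h.aemeasurable).1 h1

theorem integral_comp_of_hasLaw_gaussLaw (h : HasLaw X (gaussLaw s 0) P) {f : E d → ℝ}
    (hf : Measurable f) : ∫ ω, f (X ω) ∂P = ∫ x, f (s • x) ∂(stdGaussian (E d)) := by
  rw [← integral_map h.aemeasurable (f := f) (by fun_prop), h.map_eq,
    gaussLaw_eq_map_stdGaussian, integral_map (by fun_prop) (by fun_prop)]
  simp

theorem integral_norm_sq_of_hasLaw (h : HasLaw X (gaussLaw s 0) P) :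
    Integrable (fun ω => ‖X ω‖ ^ 2) P ∧ ∫ ω, ‖X ω‖ ^ 2 ∂P = d * s ^ 2 := by
  have he : (fun x : E d => ‖s • x‖ ^ 2) = fun x => s ^ 2 * ‖x‖ ^ 2 := by
    ext x; rw [norm_smul, mul_pow, Real.norm_eq_abs, sq_abs]
  constructor
  · refine integrable_comp_of_hasLaw_gaussLaw h (f := fun x => ‖x‖ ^ 2) (by fun_prop) ?_
    rw [he]
    exact (integral_norm_sq_stdGaussian d).1.const_mul _
  · rw [integral_comp_of_hasLaw_gaussLaw h (f := fun x => ‖x‖ ^ 2) (by fun_prop), he,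
      integral_const_mul, (integral_norm_sq_stdGaussian d).2, mul_comm]

theorem integral_norm_pow_four_of_hasLaw (h : HasLaw X (gaussLaw s 0) P) :
    Integrable (fun ω => ‖X ω‖ ^ 4) P ∧ ∫ ω, ‖X ω‖ ^ 4 ∂P ≤ (7 * (d * s ^ 2)) ^ 2 := by
  have he : (fun x : E d => ‖s • x‖ ^ 4) = fun x => s ^ 4 * ‖x‖ ^ 4 := by
    ext x; rw [norm_smul, mul_pow, Real.norm_eq_abs, Even.pow_abs (by decide)]
  constructor
  · refine integrable_comp_of_hasLaw_gaussLaw h (f := fun x => ‖x‖ ^ 4) (by fun_prop) ?_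
    rw [he]
    exact (integral_norm_pow_four_stdGaussian d).1.const_mul _
  · rw [integral_comp_of_hasLaw_gaussLaw h (f := fun x => ‖x‖ ^ 4) (by fun_prop), he,
      integral_const_mul]
    calc s ^ 4 * ∫ x, ‖x‖ ^ 4 ∂(stdGaussian (E d)) ≤ s ^ 4 * (7 * d) ^ 2 := by
          gcongr; exact (integral_norm_pow_four_stdGaussian d).2
      _ = _ := by ring

/-- Chernoff bound for the norm of a Gaussian vector. -/
theorem measureReal_le_norm_of_hasLaw [IsProbabilityMeasure P] (hs : 0 < s)
    (h : HasLaw X (gaussLaw s 0) P) {a : ℝ} (ha : 0 ≤ a) :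
    P.real {ω | s * a ≤ ‖X ω‖} ≤ √2 ^ d * Real.exp (-(a ^ 2 / 4)) := by
  have he : (fun x : E d => Real.exp (‖s • x‖ ^ 2 / (4 * s ^ 2)))
      = fun x => Real.exp (‖x‖ ^ 2 / 4) := by
    ext x
    rw [norm_smul, mul_pow, Real.norm_eq_abs, sq_abs]
    congr 1
    field_simp
  have hi : Integrable (fun ω => Real.exp (‖X ω‖ ^ 2 / (4 * s ^ 2))) P := by
    refine integrable_comp_of_hasLaw_gaussLaw h
      (f := fun x => Real.exp (‖x‖ ^ 2 / (4 * s ^ 2))) (by fun_prop) ?_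
    rw [he]
    exact (integrable_exp_norm_sq_stdGaussian d).1
  have hv : ∫ ω, Real.exp (‖X ω‖ ^ 2 / (4 * s ^ 2)) ∂P = √2 ^ d := by
    rw [integral_comp_of_hasLaw_gaussLaw h
      (f := fun x => Real.exp (‖x‖ ^ 2 / (4 * s ^ 2))) (by fun_prop), he,
      (integrable_exp_norm_sq_stdGaussian d).2]
  have hm := mul_meas_ge_le_integral_of_nonneg (ae_of_all P fun ω => (Real.exp_pos _).le) hi
    (Real.exp (a ^ 2 / 4))
  rw [hv] at hm
  have hsub : P.real {ω | s * a ≤ ‖X ω‖}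
      ≤ P.real {ω | Real.exp (a ^ 2 / 4) ≤ Real.exp (‖X ω‖ ^ 2 / (4 * s ^ 2))} := by
    refine measureReal_mono fun ω hω => ?_
    simp only [Set.mem_ofPred_eq, Real.exp_le_exp] at hω ⊢
    rw [div_le_div_iff₀ (by norm_num) (by positivity)]
    have := pow_le_pow_left₀ (by positivity) hω 2
    nlinarith
  rw [Real.exp_neg, ← div_eq_mul_inv, le_div_iff₀ (Real.exp_pos _), mul_comm]
  exact (mul_le_mul_of_nonneg_left hsub (Real.exp_pos _).le).trans hm

end HasLaw

theorem integral_id_gaussLaw_zero {d : ℕ} (σ : ℝ) :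
    Integrable (fun x : E d => x) (gaussLaw σ 0) ∧ ∫ x, x ∂(gaussLaw σ (0 : E d)) = 0 :=
  ⟨by unfold gaussLaw; exact IsGaussian.integrable_id, by unfold gaussLaw; simp⟩

theorem integral_exp_inner_gaussLaw {d : ℕ} (σ : ℝ) (θ h : E d) :
    mgf (fun x => ⟪x - θ, h⟫) (gaussLaw σ θ) 1 = Real.exp (σ ^ 2 * ‖h‖ ^ 2 / 2) := by
  rw [mgf, gaussLaw_eq_map_stdGaussian, integral_map (by fun_prop) (by fun_prop)]
  have hL : (stdGaussian (E d)).map (innerSL ℝ h) = gaussianReal 0 (‖h‖ ^ 2).toNNReal := by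
    rw [IsGaussian.map_eq_gaussianReal, integral_strongDual_stdGaussian,
      variance_dual_stdGaussian, innerSL_apply_norm]
  have := mgf_gaussianReal hL σ
  rw [mgf] at this
  simp only [add_sub_cancel_left, one_mul, real_inner_smul_left]
  simp only [innerSL_apply_apply, zero_mul, zero_add, Real.coe_toNNReal _ (sq_nonneg ‖h‖)] at this
  simp only [real_inner_comm h]
  rw [this, mul_comm (‖h‖ ^ 2)]

/-! ### The log-likelihood ratio: quadratic form, and consequences of regularity. -/

section LogLR

variable {d : ℕ} {σ : ℝ} {φ : Measure (E d)}

/-- Regularity of the log-likelihood ratio at a source parameter `ϑ`. -/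
structure RegularAt (σ : ℝ) (φ : Measure (E d)) (U : Set (E d)) (V L : ℝ≥0) (ϑ : E d) : Prop where
  subgaussian : ∀ θ ∈ U,
    HasSubgaussianMGF (fun x => logLR σ φ θ x - expLogLR σ φ ϑ θ) (V ^ 2) (gaussLaw σ ϑ)
  lipschitz : LipschitzOnWith L (fun θ => expLogLR σ φ ϑ θ) U

variable {U : Set (E d)} {V L : ℝ≥0} {ϑ θ₀ : E d}

theorem RegularAt.integrable (hreg : RegularAt σ φ U V L ϑ) {θ : E d} (hθ : θ ∈ U) :
    Integrable (logLR σ φ θ) (gaussLaw σ ϑ) := by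
  have := (hreg.subgaussian θ hθ).integrable.add (integrable_const (expLogLR σ φ ϑ θ))
  simpa [Pi.add_def] using this

theorem gaussDensity_pos (hσ : 0 < σ) (θ x : E d) : 0 < gaussDensity σ θ x :=
  mul_pos (Real.rpow_pos_of_pos (by positivity) _) (Real.exp_pos _)

theorem continuous_gaussDensity (σ : ℝ) :
    Continuous fun p : E d × E d => gaussDensity σ p.1 p.2 := by
  unfold gaussDensity
  fun_prop

theorem integrable_gaussDensity (hσ : 0 < σ) (φ : Measure (E d)) [IsProbabilityMeasure φ]
    (x : E d) : Integrable (fun t => gaussDensity σ t x) φ := by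
  refine Integrable.of_bound (C := (2 * Real.pi * σ ^ 2) ^ (-(d : ℝ) / 2))
    ((continuous_gaussDensity σ).comp (by fun_prop : Continuous fun t => (t, x))).aestronglyMeasurable
    (ae_of_all _ fun t => ?_)
  rw [Real.norm_of_nonneg (gaussDensity_pos hσ t x).le]
  refine mul_le_of_le_one_right (Real.rpow_nonneg (by positivity) _) ?_
  rw [Real.exp_le_one_iff, neg_div]
  exact neg_nonpos.2 (by positivity)

theorem nullDensity_pos (hσ : 0 < σ) (φ : Measure (E d)) [IsProbabilityMeasure φ] (x : E d) :
    0 < nullDensity σ φ x := by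
  refine (integral_pos_iff_support_of_nonneg (fun t => (gaussDensity_pos hσ t x).le)
    (integrable_gaussDensity hσ φ x)).2 ?_
  have : Function.support (fun t => gaussDensity σ t x) = Set.univ :=
    Set.eq_univ_of_forall fun t => (gaussDensity_pos hσ t x).ne'
  rw [this, measure_univ]
  exact one_pos

theorem measurable_nullDensity (σ : ℝ) (φ : Measure (E d)) [IsProbabilityMeasure φ] :
    Measurable (nullDensity σ φ) := by
  have h : StronglyMeasurable fun p : E d × E d => gaussDensity σ p.2 p.1 :=
    ((continuous_gaussDensity σ).comp continuous_swap).stronglyMeasurable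
  exact (h.integral_prod_right (ν := φ)).measurable

theorem measurable_logLR (σ : ℝ) (φ : Measure (E d)) [IsProbabilityMeasure φ] (θ : E d) :
    Measurable (logLR σ φ θ) := by
  have h : Measurable fun x => gaussDensity σ θ x :=
    ((continuous_gaussDensity σ).comp (by fun_prop : Continuous fun x => (θ, x))).measurable
  exact Real.measurable_log.comp (h.div (measurable_nullDensity σ φ))

variable [IsProbabilityMeasure φ]

/-- The log-likelihood ratio is quadratic in the parameter. -/
theorem logLR_add (hσ : 0 < σ) (θ h x : E d) :
    logLR σ φ (θ + h) x = logLR σ φ θ x + (⟪x - θ, h⟫ - ‖h‖ ^ 2 / 2) / σ ^ 2 := by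
  have hq := (nullDensity_pos hσ φ x).ne'
  have hr : (2 * Real.pi * σ ^ 2) ^ (-(d : ℝ) / 2) ≠ 0 :=
    (Real.rpow_pos_of_pos (by positivity) _).ne'
  simp only [logLR]
  rw [Real.log_div (gaussDensity_pos hσ _ x).ne' hq, Real.log_div (gaussDensity_pos hσ _ x).ne' hq,
    gaussDensity, gaussDensity, Real.log_mul hr (Real.exp_ne_zero _),
    Real.log_mul hr (Real.exp_ne_zero _), Real.log_exp, Real.log_exp, ← sub_sub,
    norm_sub_sq_real (x - θ) h]
  field_simp
  ring

theorem continuous_logLR (hσ : 0 < σ) (x : E d) : Continuous fun θ => logLR σ φ θ x := by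
  have h : (fun θ => logLR σ φ θ x)
      = fun θ => logLR σ φ 0 x + (⟪x - 0, θ⟫ - ‖θ‖ ^ 2 / 2) / σ ^ 2 := by
    ext θ
    rw [← logLR_add hσ, zero_add]
  rw [h]
  fun_prop

theorem integrable_inner_sub_gaussLaw (θ h : E d) :
    Integrable (fun x => ⟪x, h⟫) (gaussLaw σ θ) ∧ ∫ x, ⟪x, h⟫ ∂(gaussLaw σ θ) = ⟪θ, h⟫ := by
  have hi : Integrable (fun x : E d => x) (gaussLaw σ θ) := by
    unfold gaussLaw; exact IsGaussian.integrable_id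
  have hc : ∫ x, x ∂(gaussLaw σ θ) = θ := by unfold gaussLaw; simp
  refine ⟨hi.inner_const h, ?_⟩
  simp only [real_inner_comm h]
  rw [integral_inner hi, hc]

theorem expLogLR_add (hσ : 0 < σ) {ϑ θ : E d} (hi : Integrable (logLR σ φ θ) (gaussLaw σ ϑ))
    (h : E d) :
    expLogLR σ φ ϑ (θ + h) = expLogLR σ φ ϑ θ + (⟪ϑ - θ, h⟫ - ‖h‖ ^ 2 / 2) / σ ^ 2 := by
  obtain ⟨h1, h2⟩ := integrable_inner_sub_gaussLaw (σ := σ) ϑ h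
  simp only [expLogLR, logLR_add hσ, inner_sub_left]
  have h3 : Integrable (fun x => ⟪x, h⟫ - ⟪θ, h⟫) (gaussLaw σ ϑ) := h1.sub (integrable_const _)
  have h4 : Integrable (fun x => (⟪x, h⟫ - ⟪θ, h⟫ - ‖h‖ ^ 2 / 2) / σ ^ 2) (gaussLaw σ ϑ) :=
    (h3.sub (integrable_const _)).div_const _
  rw [integral_add hi h4, integral_div,
    integral_sub h3 (integrable_const _), integral_sub h1 (integrable_const _), h2]
  simp

/-- Since the expected log-likelihood ratio is an explicit quadratic, its Lipschitz bound is a bound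
on the component of ϑ − θ₀ along h. Hence even a distant source, if regular, has little
deterministic pull inside the basin. -/
theorem RegularAt.abs_inner_sub_le (hσ : 0 < σ) (hreg : RegularAt σ φ U V L ϑ) (h0 : θ₀ ∈ U)
    {h : E d} (hh : θ₀ + h ∈ U) : |⟪ϑ - θ₀, h⟫ - ‖h‖ ^ 2 / 2| ≤ σ ^ 2 * (L * ‖h‖) := by
  have h1 := hreg.lipschitz.dist_le_mul _ hh _ h0
  simp only [expLogLR_add hσ (hreg.integrable h0)] at h1
  rw [Real.dist_eq, add_sub_cancel_left, dist_eq_norm, add_sub_cancel_left, abs_div,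
    abs_of_pos (by positivity : 0 < σ ^ 2), div_le_iff₀ (by positivity)] at h1
  linarith

/-- The difference of the centred ratios at two points of U is a Gaussian linear form of variance
‖h‖²/σ². As a difference of two sub-Gaussian variables it has parameter (2V)², without any
independence. Comparing the moment generating functions at 1 bounds ‖h‖. -/
theorem RegularAt.norm_le_two_mul (hσ : 0 < σ) (hreg : RegularAt σ φ U V L ϑ) (h0 : θ₀ ∈ U)
    {h : E d} (hh : θ₀ + h ∈ U) : ‖h‖ ≤ 2 * V * σ := by
  have h1 := hreg.subgaussian _ hh
  have h2 := (hreg.subgaussian _ h0).neg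
  have h3 := (h1.add h2).mgf_le 1
  have he : (fun x => logLR σ φ (θ₀ + h) x - expLogLR σ φ ϑ (θ₀ + h) +
      (-fun x => logLR σ φ θ₀ x - expLogLR σ φ ϑ θ₀) x) = fun x => ⟪x - ϑ, (σ ^ 2)⁻¹ • h⟫ := by
    ext x
    simp only [Pi.neg_apply, expLogLR_add hσ (hreg.integrable h0), logLR_add hσ,
      real_inner_smul_right, inner_sub_left]
    field_simp
    ring
  rw [he, integral_exp_inner_gaussLaw, Real.exp_le_exp, norm_smul] at h3
  have h4 : (NNReal.sqrt (V ^ 2) : ℝ≥0) = V := NNReal.sqrt_sq V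
  rw [h4] at h3
  push_cast at h3
  rw [norm_inv, norm_pow, Real.norm_of_nonneg hσ.le] at h3
  have h5 : σ ^ 2 * ((σ ^ 2)⁻¹ * ‖h‖) ^ 2 / 2 = ‖h‖ ^ 2 / σ ^ 2 / 2 := by field_simp
  rw [h5] at h3
  have h6 : ‖h‖ ^ 2 / σ ^ 2 ≤ 4 * V ^ 2 := by linarith
  rw [div_le_iff₀ (by positivity)] at h6
  refine le_of_sq_le_sq ?_ (by positivity)
  nlinarith

theorem exists_norm_eq_of_pos (hd : 0 < d) {ρ : ℝ} (hρ : 0 ≤ ρ) (b : E d) :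
    ∃ h : E d, ‖h‖ = ρ ∧ ⟪b, h⟫ ≤ 0 := by
  have : Nonempty (Fin d) := ⟨⟨0, hd⟩⟩
  obtain ⟨h, hh⟩ := exists_norm_eq (E d) hρ
  rcases le_total ⟪b, h⟫ 0 with hb | hb
  · exact ⟨h, hh, hb⟩
  · exact ⟨-h, by simpa using hh, by simpa [inner_neg_right] using hb⟩

theorem RegularAt.radius_le_lipschitz (hσ : 0 < σ) (hreg : RegularAt σ φ U V L ϑ) (hd : 0 < d)
    {ρ : ℝ} (hρ : 0 < ρ) (hU : Metric.closedBall θ₀ ρ ⊆ U) : ρ ≤ 2 * σ ^ 2 * L := by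
  -- The direction is chosen so that the linear term cannot cancel the quadratic one.
  obtain ⟨h, hh, hb⟩ := exists_norm_eq_of_pos hd hρ.le (ϑ - θ₀)
  have h1 := hreg.abs_inner_sub_le hσ (hU (Metric.mem_closedBall_self hρ.le))
    (hU (show θ₀ + h ∈ Metric.closedBall θ₀ ρ by simp [hh]))
  rw [hh] at h1
  have h2 := (neg_abs_le _).trans (le_refl (⟪ϑ - θ₀, h⟫ - ρ ^ 2 / 2))
  have h3 : ρ ^ 2 ≤ 2 * (σ ^ 2 * (L * ρ)) := by linarith
  nlinarith

theorem RegularAt.radius_le_subgaussian (hσ : 0 < σ) (hreg : RegularAt σ φ U V L ϑ) (hd : 0 < d)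
    {ρ : ℝ} (hρ : 0 < ρ) (hU : Metric.closedBall θ₀ ρ ⊆ U) : ρ ≤ 2 * V * σ := by
  obtain ⟨h, hh, -⟩ := exists_norm_eq_of_pos hd hρ.le (0 : E d)
  rw [← hh]
  exact hreg.norm_le_two_mul hσ (hU (Metric.mem_closedBall_self hρ.le))
    (hU (show θ₀ + h ∈ Metric.closedBall θ₀ ρ by simp [hh]))

/-- Translating moves the dependence on ϑ from the measure to the integrand, where measurability of
parametric integrals applies. -/
theorem measurable_expLogLR (σ : ℝ) (φ : Measure (E d)) [IsProbabilityMeasure φ] (θ : E d) :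
    Measurable fun ϑ => expLogLR σ φ ϑ θ := by
  have h : (fun ϑ => expLogLR σ φ ϑ θ)
      = fun ϑ => ∫ z, logLR σ φ θ (ϑ + z) ∂(gaussLaw σ 0) := by
    ext ϑ
    rw [expLogLR, gaussLaw_eq_map_add, integral_map (by fun_prop)
      (measurable_logLR σ φ θ).aestronglyMeasurable]
  rw [h]
  have hm : StronglyMeasurable fun p : E d × E d => logLR σ φ θ (p.1 + p.2) :=
    ((measurable_logLR σ φ θ).comp (measurable_fst.add measurable_snd)).stronglyMeasurable
  exact (hm.integral_prod_right (ν := gaussLaw σ (0 : E d))).measurable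

theorem RegularAt.measureReal_abs_sum_ge_le (hreg : RegularAt σ φ U V L ϑ) (h0 : θ₀ ∈ U)
    (N : ℕ) {ε : ℝ} (hε : 0 ≤ ε) :
    (Measure.pi fun _ : Fin N => gaussLaw σ (0 : E d)).real
      {z | N * ε ≤ |∑ i, (logLR σ φ θ₀ (ϑ + z i) - expLogLR σ φ ϑ θ₀)|}
      ≤ 2 * Real.exp (-(N * ε ^ 2 / (2 * V ^ 2))) := by
  set X : E d → ℝ := fun z => logLR σ φ θ₀ (ϑ + z) - expLogLR σ φ ϑ θ₀ with hX
  have hXm : Measurable X :=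
    ((measurable_logLR σ φ θ₀).comp (measurable_const_add ϑ)).sub_const _
  have h1 : HasSubgaussianMGF X (V ^ 2) (gaussLaw σ (0 : E d)) := by
    have := hreg.subgaussian _ h0
    rw [gaussLaw_eq_map_add] at this
    exact this.of_map (by fun_prop)
  have h2 (i : Fin N) : HasSubgaussianMGF (fun z : Fin N → E d => X (z i)) (V ^ 2)
      (Measure.pi fun _ : Fin N => gaussLaw σ (0 : E d)) := by
    refine HasSubgaussianMGF.of_map (Y := fun z : Fin N → E d => z i) (X := X)
      (measurable_pi_apply i).aemeasurable ?_
    rwa [(measurePreserving_eval (fun _ : Fin N => gaussLaw σ (0 : E d)) i).map_eq]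
  have hind : iIndepFun (fun (i : Fin N) (z : Fin N → E d) => X (z i))
      (Measure.pi fun _ : Fin N => gaussLaw σ (0 : E d)) :=
    iIndepFun_pi (fun _ => hXm.aemeasurable)
  have hneg : iIndepFun (fun (i : Fin N) (z : Fin N → E d) => -X (z i))
      (Measure.pi fun _ : Fin N => gaussLaw σ (0 : E d)) :=
    iIndepFun_pi (fun _ => hXm.neg.aemeasurable)
  have hN : (0 : ℝ) ≤ N * ε := by positivity
  have h3 := HasSubgaussianMGF.measure_sum_ge_le_of_iIndepFun hind (c := fun _ => V ^ 2)
    (s := Finset.univ) (fun i _ => h2 i) hN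
  have h4 := HasSubgaussianMGF.measure_sum_ge_le_of_iIndepFun hneg (c := fun _ => V ^ 2)
    (s := Finset.univ) (fun i _ => (h2 i).neg) hN
  have hle : (fun z : Fin N → E d => ∑ i, X (z i)) = fun z => ∑ i, X (z i) := rfl
  have hexp : -(N * ε) ^ 2 / (2 * ((∑ _i : Fin N, V ^ 2 : ℝ≥0) : ℝ))
      = -(N * ε ^ 2 / (2 * V ^ 2)) := by
    rcases Nat.eq_zero_or_pos N with rfl | hN'
    · simp
    · simp
      field_simp
  rw [hexp] at h3 h4
  rw [two_mul]
  refine le_trans ?_ (add_le_add h3 h4)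
  refine le_trans (measureReal_mono ?_) (measureReal_union_le _ _)
  intro z hz
  simp only [Set.mem_ofPred_eq, Set.mem_union, Finset.sum_neg_distrib] at hz ⊢
  exact le_abs.1 hz

end LogLR

/-! ### Deterministic comparison of a weighted mean with the oracle mean. -/

section WeightedMean

variable {F ι : Type*} [NormedAddCommGroup F] [InnerProductSpace ℝ F]
  [DecidableEq ι] {R : Finset ι} {n₀ n : ℝ} {A₀ h O : F} {A : ι → F} {w : ι → ℝ}

/-- Comparison of a weighted mean `h` with the mean `O` that uses only the indices in `R`. -/
theorem weightedMean_sub_inner [Fintype ι]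
    (hh : (n₀ + n * ∑ k, w k) • h = n₀ • A₀ + n • ∑ k, w k • A k)
    (hO : (n₀ + n * R.card) • O = n₀ • A₀ + n • ∑ k ∈ R, A k) :
    (n₀ + n * R.card) * (‖h‖ ^ 2 - ⟪O, h⟫)
      = n * ∑ k, if k ∈ R then (1 - w k) * (‖h‖ ^ 2 - ⟪A k, h⟫)
          else w k * (⟪A k, h⟫ - ‖h‖ ^ 2) := by
  have h1 := congrArg (fun u => ⟪u, h⟫) hh
  have h2 := congrArg (fun u => ⟪u, h⟫) hO
  simp only [inner_add_left, real_inner_smul_left, sum_inner, real_inner_self_eq_norm_sq] at h1 h2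
  have h3 (k : ι) : (if k ∈ R then (1 - w k) * (‖h‖ ^ 2 - ⟪A k, h⟫)
      else w k * (⟪A k, h⟫ - ‖h‖ ^ 2))
      = (if k ∈ R then ‖h‖ ^ 2 - ⟪A k, h⟫ else 0) + (w k * ⟪A k, h⟫ - w k * ‖h‖ ^ 2) := by
    split_ifs <;> ring
  simp_rw [h3]
  rw [Finset.sum_add_distrib, Finset.sum_ite_mem, Finset.univ_inter, Finset.sum_sub_distrib,
    Finset.sum_sub_distrib, ← Finset.sum_mul, Finset.sum_const, nsmul_eq_mul]
  linear_combination h1 - h2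

/-- This holds for any weights in [0, 1], since the target keeps its full weight n₀. It serves where
nothing is known about the classification of the sources. -/
theorem weightedMean_norm_le [Fintype ι] (hn₀ : 0 < n₀) (hn : 0 < n)
    (hw : ∀ k, w k ∈ Set.Icc (0 : ℝ) 1)
    (hh : (n₀ + n * ∑ k, w k) • h = n₀ • A₀ + n • ∑ k, w k • A k)
    (hO : (n₀ + n * R.card) • O = n₀ • A₀ + n • ∑ k ∈ R, A k) :
    ‖h‖ ≤ ‖O‖ + n / n₀ * (R.card * ‖O‖ + ∑ k, ‖A k‖) := by
  have key := weightedMean_sub_inner hh hO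
  set s := ∑ k ∈ R, (1 - w k) with hs
  have hs1 : s ≤ R.card := by
    rw [hs, Finset.sum_sub_distrib]
    simpa using Finset.sum_nonneg fun k (_ : k ∈ R) => (hw k).1
  have hterm (k : ι) : (if k ∈ R then (1 - w k) * (‖h‖ ^ 2 - ⟪A k, h⟫)
      else w k * (⟪A k, h⟫ - ‖h‖ ^ 2)) ≤
      (if k ∈ R then (1 - w k) * (‖h‖ ^ 2 - ⟪O, h⟫) + ‖O‖ * ‖h‖ else 0) + ‖A k‖ * ‖h‖ := by
    obtain ⟨h0, h1⟩ := hw k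
    have ha := abs_le.1 (abs_real_inner_le_norm (A k) h)
    have ho := abs_le.1 (abs_real_inner_le_norm O h)
    have ha' : 0 ≤ ‖A k‖ * ‖h‖ := by positivity
    have ho' : 0 ≤ ‖O‖ * ‖h‖ := by positivity
    split_ifs
    · nlinarith
    · nlinarith [sq_nonneg ‖h‖]
  have hsum := Finset.sum_le_sum fun k (_ : k ∈ Finset.univ) => hterm k
  rw [Finset.sum_add_distrib, Finset.sum_ite_mem, Finset.univ_inter, Finset.sum_add_distrib,
    ← Finset.sum_mul, ← hs, Finset.sum_const, nsmul_eq_mul, ← Finset.sum_mul] at hsum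
  have h4 := mul_le_mul_of_nonneg_left hsum hn.le
  rw [← key] at h4
  have ho := (abs_le.1 (abs_real_inner_le_norm O h)).2
  set Y := R.card * ‖O‖ + ∑ k, ‖A k‖ with hY
  have hY0 : 0 ≤ Y := by positivity
  -- Underweighting the indices in R can remove at most n|R| from the total mass, leaving that of
  -- the target.
  have hD : n₀ ≤ n₀ + n * R.card - n * s := by nlinarith
  have h5 : (n₀ + n * R.card - n * s) * (‖h‖ ^ 2 - ⟪O, h⟫) ≤ n * Y * ‖h‖ := by
    rw [hY]; linarith
  rcases (norm_nonneg h).eq_or_lt with hz | hpos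
  · rw [← hz]; positivity
  by_contra! hlt
  have h6 : n * Y < n₀ * (‖h‖ - ‖O‖) := by
    have : n / n₀ * Y < ‖h‖ - ‖O‖ := by linarith
    rw [div_mul_eq_mul_div, div_lt_iff₀ hn₀] at this
    linarith
  have h7 : 0 < ‖h‖ - ‖O‖ := by
    have : 0 ≤ n / n₀ * Y := by positivity
    linarith
  have h8 : n₀ * (‖h‖ - ‖O‖) ≤ (n₀ + n * R.card - n * s) * (‖h‖ - ‖O‖) := by gcongr
  have h9 : (n₀ + n * R.card - n * s) * ((‖h‖ - ‖O‖) * ‖h‖)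
      ≤ (n₀ + n * R.card - n * s) * (‖h‖ ^ 2 - ⟪O, h⟫) := by
    apply mul_le_mul_of_nonneg_left _ (hn₀.le.trans hD)
    nlinarith
  have h10 : n * Y * ‖h‖ < (n₀ + n * R.card - n * s) * (‖h‖ - ‖O‖) * ‖h‖ :=
    mul_lt_mul_of_pos_right (h6.trans_le h8) hpos
  linarith

/-- Each index is charged to one of three costs: ω times norms when its weight is nearly ideal, 2y
on T, and a quadratic term on S. On R outside T the summand is recentred at O, so that it can be
moved to the left side of `weightedMean_sub_inner`. -/
theorem weightedMean_term_le {S T : Finset ι} {ω : ℝ} {y : ι → ℝ} (hω0 : 0 ≤ ω)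
    (hw : ∀ k, w k ∈ Set.Icc (0 : ℝ) 1) (hSR : ∀ k ∈ S, k ∉ R)
    (hwR : ∀ k ∈ R, k ∉ T → 1 - w k ≤ ω)
    (hwS : ∀ k, k ∉ R → k ∉ S → k ∉ T → w k ≤ ω)
    (hy : ∀ k ∈ T, 0 ≤ y k)
    (hTR : ∀ k ∈ T, k ∈ R → ‖h‖ ^ 2 - ⟪A k, h⟫ ≤ 2 * y k)
    (hTS : ∀ k ∈ T, k ∉ R → k ∉ S → ⟪A k, h⟫ - ‖h‖ ^ 2 ≤ 2 * y k) (k : ι) :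
    (if k ∈ R then (1 - w k) * (‖h‖ ^ 2 - ⟪A k, h⟫)
      else w k * (⟪A k, h⟫ - ‖h‖ ^ 2)) ≤
      (if k ∈ R then (if k ∈ T then 0 else 1 - w k) * (‖h‖ ^ 2 - ⟪O, h⟫)
        + ω * (‖O‖ * ‖h‖) else 0)
      + ω * (‖A k‖ * ‖h‖) + (if k ∈ T then 2 * y k else 0)
      + (if k ∈ S then w k / 2 * (‖A k‖ ^ 2 - ‖h‖ ^ 2) else 0) := by
  obtain ⟨h0, h1⟩ := hw k
  have ha := abs_le.1 (abs_real_inner_le_norm (A k) h)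
  have ho := abs_le.1 (abs_real_inner_le_norm O h)
  have ha' : 0 ≤ ω * (‖A k‖ * ‖h‖) := by positivity
  have ho' : 0 ≤ ω * (‖O‖ * ‖h‖) := by positivity
  by_cases hR : k ∈ R
  · have hS : k ∉ S := fun hS => hSR k hS hR
    by_cases hT : k ∈ T
    · simp only [hR, hT, hS, if_true, if_false]
      have := hTR k hT hR
      have := hy k hT
      nlinarith
    · simp only [hR, hT, hS, if_true, if_false]
      have h3 := hwR k hR hT
      have h4 : (1 - w k) * (⟪O, h⟫ - ⟪A k, h⟫) ≤ (1 - w k) * (‖O‖ * ‖h‖ + ‖A k‖ * ‖h‖) :=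
        mul_le_mul_of_nonneg_left (by linarith) (by linarith)
      have h5 : (1 - w k) * (‖O‖ * ‖h‖ + ‖A k‖ * ‖h‖) ≤ ω * (‖O‖ * ‖h‖ + ‖A k‖ * ‖h‖) :=
        mul_le_mul_of_nonneg_right h3 (by positivity)
      linarith
  · by_cases hS : k ∈ S
    · simp only [hR, hS, if_true, if_false]
      have hT' : 0 ≤ (if k ∈ T then 2 * y k else 0) := by
        split_ifs with hT
        · linarith [hy k hT]
        · exact le_rfl
      -- The negative ‖h‖² is kept on purpose: it later enlarges the total mass by the weights of S.
      have h3 : ⟪A k, h⟫ - ‖h‖ ^ 2 ≤ (‖A k‖ ^ 2 - ‖h‖ ^ 2) / 2 := by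
        nlinarith [sq_nonneg (‖A k‖ - ‖h‖)]
      have h4 := mul_le_mul_of_nonneg_left h3 h0
      linarith
    · by_cases hT : k ∈ T
      · simp only [hR, hT, hS, if_true, if_false]
        have := hTS k hT hR hS
        have := hy k hT
        nlinarith
      · simp only [hR, hT, hS, if_false]
        have h3 := hwS k hR hS hT
        have h4 : w k * (⟪A k, h⟫ - ‖h‖ ^ 2) ≤ w k * (‖A k‖ * ‖h‖) :=
          mul_le_mul_of_nonneg_left (by nlinarith [sq_nonneg ‖h‖]) h0
        have h5 : w k * (‖A k‖ * ‖h‖) ≤ ω * (‖A k‖ * ‖h‖) :=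
          mul_le_mul_of_nonneg_right h3 (by positivity)
        linarith

/-- Comparison of a weighted mean `h` with the mean `O` over `R`, when up to an error `ω` the
weights are `1` on `R` and `0` off `R`, except on `S` (where they are arbitrary) and on `T` (where
the deviation of the summand in the direction of `h` is controlled). -/
theorem weightedMean_norm_sq_le [Fintype ι] (hn₀ : 0 < n₀) (hn : 0 < n)
    (hw : ∀ k, w k ∈ Set.Icc (0 : ℝ) 1)
    (hh : (n₀ + n * ∑ k, w k) • h = n₀ • A₀ + n • ∑ k, w k • A k)
    (hO : (n₀ + n * R.card) • O = n₀ • A₀ + n • ∑ k ∈ R, A k)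
    {S T : Finset ι} {ω Γ : ℝ} {y : ι → ℝ} (hω : ω ≤ 1 / 16) (hω0 : 0 ≤ ω)
    (hSR : ∀ k ∈ S, k ∉ R)
    (hwR : ∀ k ∈ R, k ∉ T → 1 - w k ≤ ω)
    (hwS : ∀ k, k ∉ R → k ∉ S → k ∉ T → w k ≤ ω)
    (hy : ∀ k ∈ T, 0 ≤ y k)
    (hTR : ∀ k ∈ T, k ∈ R → ‖h‖ ^ 2 - ⟪A k, h⟫ ≤ 2 * y k)
    (hTS : ∀ k ∈ T, k ∉ R → k ∉ S → ⟪A k, h⟫ - ‖h‖ ^ 2 ≤ 2 * y k)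
    (hΓ : ∑ k ∈ T, y k ≤ Γ * ‖h‖) :
    ‖h‖ ^ 2 ≤ 8 / 7 * ‖O‖ ^ 2 + 128 / 105 * ∑ k ∈ S, n / (n₀ + n * R.card + n) * ‖A k‖ ^ 2
      + 64 / 7 * (16 / 15 * (n / (n₀ + n * R.card))
        * (2 * Γ + ω * (R.card * ‖O‖ + ∑ k, ‖A k‖))) ^ 2 := by
  have key := weightedMean_sub_inner hh hO
  set M := n₀ + n * R.card with hM
  have hM0 : 0 < M := by positivity
  set s := ∑ k ∈ R, (if k ∈ T then 0 else 1 - w k) with hs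
  have hs0 : 0 ≤ s := Finset.sum_nonneg fun k _ => by
    split_ifs
    · exact le_rfl
    · linarith [(hw k).2]
  have hs1 : s ≤ ω * R.card := by
    rw [hs, mul_comm, ← nsmul_eq_mul, ← Finset.sum_const]
    refine Finset.sum_le_sum fun k hk => ?_
    split_ifs with hT
    · exact hω0
    · exact hwR k hk hT
  have hterm := weightedMean_term_le (h := h) (O := O) (A := A) hω0 hw hSR hwR hwS hy hTR hTS
  have hsum := Finset.sum_le_sum fun k (_ : k ∈ Finset.univ) => hterm k
  simp only [Finset.sum_add_distrib, Finset.sum_ite_mem, Finset.univ_inter] at hsum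
  rw [← Finset.sum_mul, ← hs, Finset.sum_const, nsmul_eq_mul, ← Finset.mul_sum, ← Finset.sum_mul,
    ← Finset.mul_sum] at hsum
  set Y := R.card * ‖O‖ + ∑ k, ‖A k‖ with hY
  set B := ∑ k ∈ S, w k * (‖A k‖ ^ 2 - ‖h‖ ^ 2) with hB
  have hB' : ∑ k ∈ S, w k / 2 * (‖A k‖ ^ 2 - ‖h‖ ^ 2) = B / 2 := by
    rw [hB, Finset.sum_div]
    exact Finset.sum_congr rfl fun k _ => by ring
  rw [hB'] at hsum
  have h4 := mul_le_mul_of_nonneg_left hsum hn.le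
  rw [← key] at h4
  have h5 : (M - n * s) * (‖h‖ ^ 2 - ⟪O, h⟫) ≤ n * (2 * Γ + ω * Y) * ‖h‖ + n * (B / 2) := by
    have := mul_le_mul_of_nonneg_left hΓ hn.le
    rw [hY]
    linarith
  have hns : n * s ≤ M / 16 := by
    have h6 : n * s ≤ n * (1 / 16 * R.card) := by gcongr; exact hs1.trans (by gcongr)
    have : n * (1 / 16 * R.card) ≤ M / 16 := by rw [hM]; linarith
    linarith
  set D := M - n * s with hD
  have hDM : 15 / 16 * M ≤ D := by linarith
  have hD0 : 0 < D := by linarith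
  have ho : (‖h‖ ^ 2 - ‖O‖ ^ 2) / 2 ≤ ‖h‖ ^ 2 - ⟪O, h⟫ := by
    nlinarith [(abs_le.1 (abs_real_inner_le_norm O h)).2, sq_nonneg (‖O‖ - ‖h‖)]
  have h6 := (mul_le_mul_of_nonneg_left ho hD0.le).trans h5
  set u := ∑ k ∈ S, w k with hu
  have hu0 : 0 ≤ u := Finset.sum_nonneg fun k _ => (hw k).1
  have hB2 : B = ∑ k ∈ S, w k * ‖A k‖ ^ 2 - u * ‖h‖ ^ 2 := by
    rw [hB, hu, Finset.sum_mul, ← Finset.sum_sub_distrib]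
    exact Finset.sum_congr rfl fun k _ => by ring
  -- The mass on the left now includes the actual weights of S. Each index of S therefore has
  -- relative influence about n / (M + n) instead of n / M, and n / (M + n) times a source variance
  -- dσ²/n stays below the oracle variance.
  set W := D + n * u with hW
  have hnu : 0 ≤ n * u := by positivity
  have hW0 : 0 < W := by linarith
  set q := 16 / 15 * (n / M) * (2 * Γ + ω * Y) with hq
  have hSW : n * ∑ k ∈ S, w k * ‖A k‖ ^ 2
      ≤ W * (16 / 15 * ∑ k ∈ S, n / (M + n) * ‖A k‖ ^ 2) := by
    rw [Finset.mul_sum, Finset.mul_sum, Finset.mul_sum]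
    refine Finset.sum_le_sum fun k hk => ?_
    have h7 : w k ≤ u := Finset.single_le_sum (f := w) (fun i _ => (hw i).1) hk
    have h8 : 15 / 16 * (M + n) * w k ≤ W := by
      have : n * w k ≤ n * u := by gcongr
      have : M * w k ≤ M := mul_le_of_le_one_right hM0.le (hw k).2
      have : 0 ≤ n * w k := mul_nonneg hn.le (hw k).1
      calc 15 / 16 * (M + n) * w k = 15 / 16 * (M * w k) + 15 / 16 * (n * w k) := by ring
        _ ≤ D + n * u := by linarith
    have h9 : n * w k ≤ W * (16 / 15 * (n / (M + n))) := by
      rw [mul_div_assoc', mul_div_assoc', le_div_iff₀ (by positivity)]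
      have := mul_le_mul_of_nonneg_left h8 hn.le
      linarith
    calc n * (w k * ‖A k‖ ^ 2) = n * w k * ‖A k‖ ^ 2 := by ring
      _ ≤ W * (16 / 15 * (n / (M + n))) * ‖A k‖ ^ 2 := by gcongr
      _ = _ := by ring
  have hO2 : D * ‖O‖ ^ 2 ≤ W * ‖O‖ ^ 2 := by gcongr; linarith
  have hΓ0 : 0 ≤ n * (2 * Γ + ω * Y) * ‖h‖ := by
    have h7 : 0 ≤ Γ * ‖h‖ := (Finset.sum_nonneg hy).trans hΓ
    have h8 : 0 ≤ Y := by positivity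
    have h9 : 0 ≤ ω * Y * ‖h‖ := by positivity
    calc (0 : ℝ) ≤ n * (2 * (Γ * ‖h‖) + ω * Y * ‖h‖) := by positivity
      _ = _ := by ring
  have hqW : n * (2 * Γ + ω * Y) * ‖h‖ ≤ W * (q * ‖h‖) := by
    have h7 : W * (q * ‖h‖) = W * (16 / 15) / M * (n * (2 * Γ + ω * Y) * ‖h‖) := by
      rw [hq]; ring
    rw [h7]
    refine le_mul_of_one_le_left hΓ0 ?_
    rw [le_div_iff₀ hM0]
    linarith
  have h10 : W * ‖h‖ ^ 2 ≤ W * (‖O‖ ^ 2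
      + 16 / 15 * ∑ k ∈ S, n / (M + n) * ‖A k‖ ^ 2 + 2 * (q * ‖h‖)) := by
    rw [hB2] at h6
    have : W * ‖h‖ ^ 2 = D * ‖h‖ ^ 2 + n * (u * ‖h‖ ^ 2) := by rw [hW]; ring
    linarith
  have h11 := le_of_mul_le_mul_left h10 hW0
  -- Absorbing ‖h‖²/8 on the left leaves 7/8 there, which yields the factors 8/7, 128/105 =
  -- (8/7)(16/15) and 64/7.
  have h12 : 2 * (q * ‖h‖) ≤ ‖h‖ ^ 2 / 8 + 8 * q ^ 2 := by
    linarith [sq_nonneg (‖h‖ - 8 * q), sub_sq ‖h‖ (8 * q)]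
  linarith

end WeightedMean

/-! ### Separating parameters from noise, and the margin source by source. -/

section Model

variable {d K : ℕ}

/-- The law of the noise: i.i.d. `N(0, σ² I)` for every target and every source observation. -/
noncomputable def noiseLaw (d K N₀ N : ℕ) (σ : ℝ) :
    Measure ((Fin N₀ → E d) × (Fin K → Fin N → E d)) :=
  (Measure.pi fun _ => gaussLaw σ 0).prod (Measure.pi fun _ => Measure.pi fun _ => gaussLaw σ 0)

instance (N₀ N : ℕ) (σ : ℝ) : IsProbabilityMeasure (noiseLaw d K N₀ N σ) := by
  unfold noiseLaw; infer_instance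

theorem sampleKernel_apply_eq_map (n : ℕ) (σ : ℝ) (θ : E d) :
    sampleKernel d n σ θ
      = (Measure.pi fun _ : Fin n => gaussLaw σ (0 : E d)).map fun z i => θ + z i := by
  have h := Measure.pi_map_pi (μ := fun _ : Fin n => gaussLaw σ (0 : E d))
    (f := fun _ z => θ + z) (hμ := fun _ => by rw [← gaussLaw_eq_map_add]; infer_instance)
    (fun _ => by fun_prop)
  rw [h]
  simp only [← gaussLaw_eq_map_add]
  rfl

theorem compProd_sampleKernel_eq_map (N : ℕ) (σ : ℝ) (μ : Measure (E d)) [IsProbabilityMeasure μ] :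
    μ ⊗ₘ sampleKernel d N σ = (μ.prod (Measure.pi fun _ : Fin N => gaussLaw σ (0 : E d))).map
      fun p => (p.1, fun i => p.1 + p.2 i) := by
  have hm : Measurable fun p : E d × (Fin N → E d) => (p.1, fun i => p.1 + p.2 i) := by fun_prop
  ext s hs
  rw [Measure.compProd_apply hs, Measure.map_apply hm hs, Measure.prod_apply (hm hs)]
  refine lintegral_congr fun θ => ?_
  rw [sampleKernel_apply_eq_map, Measure.map_apply (by fun_prop) (measurable_prodMk_left hs)]
  rfl

theorem hasLaw_params_noise {N₀ N : ℕ} {σ : ℝ} {θ₀ : E d} {φ : Measure (E d)}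
    [IsProbabilityMeasure φ] {R : Finset (Fin K)} {Ω : Type*} {mΩ : MeasurableSpace Ω}
    {P : Measure Ω} {ϑ : Fin K → Ω → E d} {x₀ : Fin N₀ → Ω → E d} {x : Fin K → Fin N → Ω → E d}
    (h : HasLaw (fun ω => (fun i => x₀ i ω, fun k => (ϑ k ω, fun i => x k i ω)))
      (jointLaw N₀ N σ θ₀ φ R) P) :
    HasLaw (fun ω => (fun k => ϑ k ω, (fun i => x₀ i ω - θ₀, fun k i => x k i ω - ϑ k ω)))
      ((Measure.pi fun k => priorLaw θ₀ φ R k).prod (noiseLaw d K N₀ N σ)) P := by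
  set γ := fun n => Measure.pi fun _ : Fin n => gaussLaw σ (0 : E d) with hγ
  have hγp (n : ℕ) : IsProbabilityMeasure (γ n) := by rw [hγ]; infer_instance
  -- the parameters and the noise of the sources
  have h1 : MeasurePreserving
      (fun y : Fin K → E d × (Fin N → E d) => (fun k => (y k).1, fun k i => (y k).2 i - (y k).1))
      (Measure.pi fun k => priorLaw θ₀ φ R k ⊗ₘ sampleKernel d N σ)
      ((Measure.pi fun k => priorLaw θ₀ φ R k).prod (Measure.pi fun _ => γ N)) := by
    have hk (k : Fin K) : MeasurePreserving
        (fun p : E d × (Fin N → E d) => (p.1, fun i => p.2 i - p.1))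
        (priorLaw θ₀ φ R k ⊗ₘ sampleKernel d N σ) ((priorLaw θ₀ φ R k).prod (γ N)) := by
      refine ⟨by fun_prop, ?_⟩
      rw [compProd_sampleKernel_eq_map, Measure.map_map (by fun_prop) (by fun_prop)]
      convert Measure.map_id
      ext p : 1
      simp
    exact (measurePreserving_arrowProdEquivProdArrow (E d) (Fin N → E d) (Fin K) _ _).comp
      (measurePreserving_pi _ _ hk)
  have h2 : MeasurePreserving (fun z : Fin N₀ → E d => fun i => z i - θ₀)
      (sampleKernel d N₀ σ θ₀) (γ N₀) := by
    refine ⟨by fun_prop, ?_⟩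
    rw [sampleKernel_apply_eq_map, Measure.map_map (by fun_prop) (by fun_prop)]
    convert Measure.map_id
    ext p : 1
    simp
  have h3 : MeasurePreserving
      (fun p : (Fin K → E d) × (Fin K → Fin N → E d) × (Fin N₀ → E d) => (p.1, (p.2.2, p.2.1)))
      ((Measure.pi fun k => priorLaw θ₀ φ R k).prod ((Measure.pi fun _ => γ N).prod (γ N₀)))
      ((Measure.pi fun k => priorLaw θ₀ φ R k).prod (noiseLaw d K N₀ N σ)) :=
    (MeasurePreserving.id _).prod Measure.measurePreserving_swap
  have h4 := (h3.comp (measurePreserving_prodAssoc _ _ _)).comp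
    (Measure.measurePreserving_swap.comp (h2.prod h1))
  exact h4.comp_hasLaw h

/-- By independence, the margin on the well-separated event holds for every source separately. -/
theorem HasMargin.source {σ : ℝ} {θ₀ : E d} {φ : Measure (E d)} [IsProbabilityMeasure φ]
    {R : Finset (Fin K)} {r Δ α : ℝ} (hmargin : HasMargin σ θ₀ φ R r Δ)
    (hsep : φ.real {t | ‖t - θ₀‖ < r} ≤ α) (hα : K * α ≤ 1 / 2) (k : Fin K) :
    ∀ᵐ t ∂(priorLaw θ₀ φ R k), (k ∈ R → Δ ≤ expLogLR σ φ t θ₀) ∧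
      (k ∉ R → r ≤ ‖t - θ₀‖ → expLogLR σ φ t θ₀ ≤ -Δ) := by
  set S : Fin K → Set (E d) := fun j => {t | j ∉ R → r ≤ ‖t - θ₀‖} with hS
  -- With at least one source, Kα ≤ 1/2 forces α < 1, so separation of each single source has
  -- positive probability.
  have hSpos (j : Fin K) : priorLaw θ₀ φ R j (S j) ≠ 0 := by
    by_cases hj : j ∈ R
    · have : S j = Set.univ := by ext t; simp [hS, hj]
      rw [this, measure_univ]
      exact one_ne_zero
    · have hSj : S j = {t | ‖t - θ₀‖ < r}ᶜ := by ext t; simp [hS, hj]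
      have hK : (1 : ℝ) ≤ K := by exact_mod_cast Fin.pos_iff_nonempty.2 ⟨j⟩
      have hm : MeasurableSet {t : E d | ‖t - θ₀‖ < r} :=
        measurableSet_lt (by fun_prop) measurable_const
      intro h0
      have h1 : φ.real {t | ‖t - θ₀‖ < r}ᶜ = 0 := by
        rw [measureReal_def, ← hSj]
        rw [priorLaw, if_neg hj] at h0
        simp [h0]
      rw [probReal_compl_eq_one_sub hm] at h1
      nlinarith [measureReal_nonneg (μ := φ) (s := {t | ‖t - θ₀‖ < r})]
  set B : Set (E d) := {t | ¬ ((k ∈ R → Δ ≤ expLogLR σ φ t θ₀) ∧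
      (k ∉ R → r ≤ ‖t - θ₀‖ → expLogLR σ φ t θ₀ ≤ -Δ))} with hB
  have hBS : B ∩ S k ⊆ B := Set.inter_subset_left
  -- The rectangle in which source k violates its margin while all sources are separated is null.
  -- Its measure is a product whose factors j ≠ k are positive, so factor k must vanish.
  have hnull : (Measure.pi fun j => priorLaw θ₀ φ R j)
      (Set.univ.pi (Function.update S k (B ∩ S k))) = 0 := by
    refine measure_mono_null (fun t ht => ?_) hmargin
    rw [Set.mem_univ_pi] at ht
    have htk : t k ∈ B ∩ S k := by simpa using ht k
    have htS (j : Fin K) : t j ∈ S j := by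
      rcases eq_or_ne j k with rfl | hjk
      · exact htk.2
      · simpa [hjk] using ht j
    intro hgood
    have h1 := hgood (fun j hj => htS j hj) k
    exact htk.1 ⟨h1.1, fun hk _ => h1.2 hk⟩
  rw [Measure.pi_pi, Finset.prod_eq_zero_iff] at hnull
  obtain ⟨j, -, hj⟩ := hnull
  rcases eq_or_ne j k with rfl | hjk
  · rw [Function.update_self] at hj
    -- A violation already presupposes separation of the source itself, so intersecting with its
    -- separation event loses nothing.
    have hBj : B ⊆ B ∩ S j := fun t ht => ⟨ht, fun hjR => by
      by_contra hr
      exact ht ⟨fun h => absurd h hjR, fun _ h => absurd h hr⟩⟩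
    exact measure_mono_null hBj hj
  · rw [Function.update_of_ne hjk] at hj
    exact absurd hj (hSpos j)

end Model

/-! ### Second moments of Gaussian vectors on events of small probability. -/

section GaussianSums

variable {d : ℕ} {Ω : Type*} {mΩ : MeasurableSpace Ω} {P : Measure Ω} [IsProbabilityMeasure P]

theorem hasLaw_gaussLaw_smul_add_smul {X Y : Ω → E d} (hXY : IndepFun X Y P) {a b : ℝ}
    (hX : HasLaw X (gaussLaw a 0) P) (hY : HasLaw Y (gaussLaw b 0) P) (c e : ℝ) :
    HasLaw (fun ω => c • X ω + e • Y ω) (gaussLaw (√((c * a) ^ 2 + (e * b) ^ 2)) 0) P where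
  aemeasurable := (AEMeasurable.const_smul hX.aemeasurable c).add
    (AEMeasurable.const_smul hY.aemeasurable e)
  map_eq := by
    have hm {Z : Ω → E d} {s : ℝ} (hZ : HasLaw Z (gaussLaw s 0) P) (u : ℝ) :
        AEMeasurable (fun ω => u • Z ω) P := AEMeasurable.const_smul hZ.aemeasurable u
    have hi : IndepFun (fun ω => c • X ω) (fun ω => e • Y ω) P :=
      hXY.comp (φ := fun x => c • x) (ψ := fun x => e • x) (by fun_prop) (by fun_prop)
    apply Measure.ext_of_charFun
    rw [hi.charFun_map_fun_add_eq_mul (hm hX c) (hm hY e)]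
    ext t
    have hcf {Z : Ω → E d} {s : ℝ} (hZ : HasLaw Z (gaussLaw s 0) P) (u : ℝ) :
        charFun (P.map (fun ω => u • Z ω)) t
          = Complex.exp (-((u * s) ^ 2 * ‖t‖ ^ 2 / 2 : ℝ)) := by
      rw [charFun_map_smul_comp hZ.aemeasurable, hZ.map_eq, charFun_gaussLaw, norm_smul]
      simp [mul_pow]
      ring_nf
    rw [Pi.mul_apply, hcf hX, hcf hY, charFun_gaussLaw, Real.sq_sqrt (by positivity),
      ← Complex.exp_add]
    congr 1
    simp
    ring

/-- The Cauchy–Schwarz inequality between the fourth moment and the indicator of B, carried out as a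
pointwise AM–GM inequality with an optimised scale. -/
theorem setIntegral_norm_sq_le_of_hasLaw {s : ℝ} {X : Ω → E d} (h : HasLaw X (gaussLaw s 0) P)
    (B : Set Ω) {p : ℝ} (hp : 0 < p) (hB : P.real B ≤ p) :
    ∫ ω in B, ‖X ω‖ ^ 2 ∂P ≤ 7 * (d * s ^ 2) * √p := by
  obtain ⟨h2, h2'⟩ := integral_norm_sq_of_hasLaw h
  obtain ⟨h4, h4'⟩ := integral_norm_pow_four_of_hasLaw h
  have hle2 : ∫ ω in B, ‖X ω‖ ^ 2 ∂P ≤ ∫ ω, ‖X ω‖ ^ 2 ∂P :=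
    setIntegral_le_integral h2 (ae_of_all _ fun ω => by positivity)
  have hle4 : ∫ ω in B, ‖X ω‖ ^ 4 ∂P ≤ ∫ ω, ‖X ω‖ ^ 4 ∂P :=
    setIntegral_le_integral h4 (ae_of_all _ fun ω => by positivity)
  have hc0 : (0 : ℝ) ≤ d * s ^ 2 := by positivity
  rcases hc0.eq_or_lt with hz | hc
  · rw [h2', ← hz] at hle2
    rw [← hz]
    simpa using hle2
  set c := 7 * (d * s ^ 2) with hcdef
  have hc' : 0 < c := by positivity
  set q := √p with hq
  have hq0 : 0 < q := Real.sqrt_pos.2 hp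
  have hqp : q ^ 2 = p := Real.sq_sqrt hp.le
  have hpt (ω : Ω) : ‖X ω‖ ^ 2 ≤ q / (2 * c) * ‖X ω‖ ^ 4 + c / (2 * q) := by
    have h1 : q / (2 * c) * ‖X ω‖ ^ 4 + c / (2 * q) - ‖X ω‖ ^ 2
        = (q * ‖X ω‖ ^ 2 - c) ^ 2 / (2 * c * q) := by
      field_simp
      ring
    have h2 : 0 ≤ (q * ‖X ω‖ ^ 2 - c) ^ 2 / (2 * c * q) := by positivity
    linarith
  calc ∫ ω in B, ‖X ω‖ ^ 2 ∂P ≤ ∫ ω in B, (q / (2 * c) * ‖X ω‖ ^ 4 + c / (2 * q)) ∂P :=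
        integral_mono h2.integrableOn
          ((h4.integrableOn.const_mul _).add (integrable_const _)) hpt
    _ = q / (2 * c) * ∫ ω in B, ‖X ω‖ ^ 4 ∂P + P.real B * (c / (2 * q)) := by
        rw [integral_add (h4.integrableOn.const_mul _) (integrable_const _), integral_const_mul,
          setIntegral_const, smul_eq_mul]
    _ ≤ q / (2 * c) * c ^ 2 + q ^ 2 * (c / (2 * q)) := by
        rw [hqp]
        gcongr
        exact hle4.trans h4'
    _ = c * q := by field_simp; ring

theorem setIntegral_norm_const_add_sq_le_of_hasLaw {s : ℝ} {X : Ω → E d}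
    (h : HasLaw X (gaussLaw s 0) P) (b : E d) (B : Set Ω) {p : ℝ} (hp : 0 < p)
    (hB : P.real B ≤ p) :
    ∫ ω in B, ‖b + X ω‖ ^ 2 ∂P ≤ 14 * (‖b‖ ^ 2 + d * s ^ 2) * √p := by
  have h1 := setIntegral_norm_sq_le_of_hasLaw h B hp hB
  obtain ⟨h2, -⟩ := integral_norm_sq_of_hasLaw h
  have hB' : P.real B ≤ √p := by
    refine le_trans ?_ (Real.sqrt_le_sqrt hB)
    rw [Real.le_sqrt measureReal_nonneg measureReal_nonneg]
    nlinarith [measureReal_nonneg (μ := P) (s := B), measureReal_le_one (μ := P) (s := B)]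
  have hpt (ω : Ω) : ‖b + X ω‖ ^ 2 ≤ 2 * ‖b‖ ^ 2 + 2 * ‖X ω‖ ^ 2 := by
    have := pow_le_pow_left₀ (norm_nonneg _) (norm_add_le b (X ω)) 2
    nlinarith [sq_nonneg (‖b‖ - ‖X ω‖)]
  have hb : 0 ≤ ‖b‖ ^ 2 := by positivity
  calc ∫ ω in B, ‖b + X ω‖ ^ 2 ∂P ≤ ∫ ω in B, (2 * ‖b‖ ^ 2 + 2 * ‖X ω‖ ^ 2) ∂P := by
        refine integral_mono_of_nonneg (ae_of_all _ fun ω => by positivity)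
          ((integrable_const _).add (h2.integrableOn.const_mul _)) (ae_of_all _ hpt)
    _ = P.real B * (2 * ‖b‖ ^ 2) + 2 * ∫ ω in B, ‖X ω‖ ^ 2 ∂P := by
        rw [integral_add (integrable_const _) (h2.integrableOn.const_mul _), setIntegral_const,
          smul_eq_mul, integral_const_mul]
    _ ≤ √p * (2 * ‖b‖ ^ 2) + 2 * (7 * (d * s ^ 2) * √p) := by gcongr
    _ ≤ 14 * (‖b‖ ^ 2 + d * s ^ 2) * √p := by nlinarith [Real.sqrt_nonneg p]

theorem integral_norm_const_add_sq_of_hasLaw {s : ℝ} {X : Ω → E d}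
    (h : HasLaw X (gaussLaw s 0) P) (b : E d) :
    Integrable (fun ω => ‖b + X ω‖ ^ 2) P ∧ ∫ ω, ‖b + X ω‖ ^ 2 ∂P = ‖b‖ ^ 2 + d * s ^ 2 := by
  obtain ⟨h2, h2'⟩ := integral_norm_sq_of_hasLaw h
  obtain ⟨hi, hi'⟩ := integral_id_gaussLaw_zero (d := d) s
  rw [← h.map_eq] at hi hi'
  have hX : Integrable X P := (integrable_map_measure hi.aestronglyMeasurable h.aemeasurable).1 hi
  have hX0 : ∫ ω, X ω ∂P = 0 := by
    rwa [integral_map h.aemeasurable hi.aestronglyMeasurable] at hi'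
  have hexp : (fun ω => ‖b + X ω‖ ^ 2) = fun ω => ‖b‖ ^ 2 + 2 * ⟪b, X ω⟫ + ‖X ω‖ ^ 2 := by
    ext ω
    exact norm_add_sq_real b (X ω)
  have h3 : Integrable (fun ω => 2 * ⟪b, X ω⟫) P := (hX.const_inner b).const_mul 2
  have h4 : Integrable (fun ω => ‖b‖ ^ 2 + 2 * ⟪b, X ω⟫) P := (integrable_const _).add h3
  rw [hexp]
  refine ⟨h4.add h2, ?_⟩
  rw [integral_add h4 h2, integral_add (integrable_const _) h3, integral_const_mul,
    integral_inner hX, hX0, h2']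
  simp

end GaussianSums

/-! ### Laws of the noise means and probabilities of the exceptional events. -/

section Noise

variable {d K N₀ N : ℕ} {σ : ℝ}

theorem measurable_mle {n : ℕ} : Measurable (mle : (Fin n → E d) → E d) := by
  unfold mle; fun_prop

theorem hasLaw_mle {n : ℕ} (hn : 0 < n) (hσ : 0 < σ) :
    HasLaw (mle : (Fin n → E d) → E d) (gaussLaw (σ / √n) 0)
      (Measure.pi fun _ => gaussLaw σ 0) := by
  have hind : iIndepFun (fun (i : Fin n) (z : Fin n → E d) => z i)
      (Measure.pi fun _ : Fin n => gaussLaw σ (0 : E d)) :=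
    iIndepFun_pi (X := fun _ => id) (fun _ => aemeasurable_id)
  have h := hasLaw_gaussLaw_finsetSum hind (a := fun _ => σ) Finset.univ
    (fun i => (measurePreserving_eval (fun _ : Fin n => gaussLaw σ (0 : E d)) i).hasLaw)
    (fun _ => (n : ℝ)⁻¹)
  have hs : √(∑ _i : Fin n, ((n : ℝ)⁻¹ * σ) ^ 2) = σ / √n := by
    have h1 : ∑ _i : Fin n, ((n : ℝ)⁻¹ * σ) ^ 2 = σ ^ 2 / n := by
      simp
      field_simp
    rw [h1, Real.sqrt_div (sq_nonneg σ), Real.sqrt_sq hσ.le]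
  rw [hs] at h
  convert h using 1
  ext z : 1
  rw [mle, Finset.smul_sum]

theorem hasLaw_sum_mle (hN : 0 < N) (hσ : 0 < σ) (T : Finset (Fin K)) (c : Fin K → ℝ)
    (hc : ∀ k, c k ^ 2 = 1) :
    HasLaw (fun z : Fin K → Fin N → E d => ∑ k ∈ T, c k • mle (z k))
      (gaussLaw (√T.card * (σ / √N)) 0)
      (Measure.pi fun _ => Measure.pi fun _ => gaussLaw σ 0) := by
  have hind : iIndepFun (fun (k : Fin K) (z : Fin K → Fin N → E d) => mle (z k))
      (Measure.pi fun _ => Measure.pi fun _ => gaussLaw σ (0 : E d)) :=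
    iIndepFun_pi (X := fun _ => mle) (fun _ => measurable_mle.aemeasurable)
  have h := hasLaw_gaussLaw_finsetSum hind (a := fun _ => σ / √N) T
    (fun k => (hasLaw_mle hN hσ).comp (measurePreserving_eval
      (fun _ : Fin K => Measure.pi fun _ : Fin N => gaussLaw σ (0 : E d)) k).hasLaw) c
  have hs : √(∑ k ∈ T, (c k * (σ / √N)) ^ 2) = √T.card * (σ / √N) := by
    have h1 : ∑ k ∈ T, (c k * (σ / √N)) ^ 2 = T.card * (σ / √N) ^ 2 := by
      simp_rw [mul_pow, hc]
      simp
    rw [h1, Real.sqrt_mul (Nat.cast_nonneg _), Real.sqrt_sq (by positivity)]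
  rwa [hs] at h

/-- The estimation error of the pooled mean over the target and the sources in `R`, when these
sources have the target parameter. -/
noncomputable def oracleError (R : Finset (Fin K)) (z : (Fin N₀ → E d) × (Fin K → Fin N → E d)) :
    E d :=
  ((N₀ : ℝ) / (N₀ + N * R.card)) • mle z.1
    + ((N : ℝ) / (N₀ + N * R.card)) • ∑ k ∈ R, (1 : ℝ) • mle (z.2 k)

theorem hasLaw_oracleError (hN₀ : 0 < N₀) (hN : 0 < N) (hσ : 0 < σ) (R : Finset (Fin K)) :
    HasLaw (oracleError R) (gaussLaw (σ / √(N₀ + N * R.card)) (0 : E d))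
      (noiseLaw d K N₀ N σ) := by
  have hm : Measurable fun z : Fin K → Fin N → E d => ∑ k ∈ R, (1 : ℝ) • mle (z k) :=
    Finset.measurable_fun_sum _ fun k _ =>
      Measurable.const_smul (measurable_mle.comp (measurable_pi_apply k)) (1 : ℝ)
  have h1 := (hasLaw_mle (d := d) hN₀ hσ).comp
    (measurePreserving_fst (μ := Measure.pi fun _ : Fin N₀ => gaussLaw σ (0 : E d))
      (ν := Measure.pi fun _ : Fin K => Measure.pi fun _ : Fin N => gaussLaw σ (0 : E d))).hasLaw
  have h2 := (hasLaw_sum_mle (d := d) hN hσ R (fun _ => 1) (fun _ => one_pow 2)).comp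
    (measurePreserving_snd (μ := Measure.pi fun _ : Fin N₀ => gaussLaw σ (0 : E d))
      (ν := Measure.pi fun _ : Fin K => Measure.pi fun _ : Fin N => gaussLaw σ (0 : E d))).hasLaw
  have hind := indepFun_prod (μ := Measure.pi fun _ : Fin N₀ => gaussLaw σ (0 : E d))
    (ν := Measure.pi fun _ : Fin K => Measure.pi fun _ : Fin N => gaussLaw σ (0 : E d))
    measurable_mle hm
  have h3 := hasLaw_gaussLaw_smul_add_smul hind h1 h2 ((N₀ : ℝ) / (N₀ + N * R.card))
    ((N : ℝ) / (N₀ + N * R.card))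
  have hs : √(((N₀ : ℝ) / (N₀ + N * R.card) * (σ / √N₀)) ^ 2
      + ((N : ℝ) / (N₀ + N * R.card) * (√R.card * (σ / √N))) ^ 2) = σ / √(N₀ + N * R.card) := by
    have h4 : ((N₀ : ℝ) / (N₀ + N * R.card) * (σ / √N₀)) ^ 2
        + ((N : ℝ) / (N₀ + N * R.card) * (√R.card * (σ / √N))) ^ 2
        = σ ^ 2 / (N₀ + N * R.card) := by
      simp only [mul_pow, div_pow]
      rw [Real.sq_sqrt (Nat.cast_nonneg N₀), Real.sq_sqrt (Nat.cast_nonneg N),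
        Real.sq_sqrt (Nat.cast_nonneg R.card)]
      field_simp
    rw [h4, Real.sqrt_div (sq_nonneg σ), Real.sqrt_sq hσ.le]
  rw [hs] at h3
  exact h3

theorem hasLaw_mle_source (hN : 0 < N) (hσ : 0 < σ) (k : Fin K) :
    HasLaw (fun z => mle (z.2 k)) (gaussLaw (σ / √N) (0 : E d)) (noiseLaw d K N₀ N σ) :=
  ((hasLaw_mle hN hσ).comp (measurePreserving_eval
    (fun _ : Fin K => Measure.pi fun _ : Fin N => gaussLaw σ (0 : E d)) k).hasLaw).comp
    (measurePreserving_snd (μ := Measure.pi fun _ : Fin N₀ => gaussLaw σ (0 : E d))).hasLaw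

/-- The event that, for some set `T` of at most `m` sources, the noise of the means of the sources
in `T`, each signed against its correct classification, adds up to a vector of length at least
`m τ`. -/
def noiseCluster (R : Finset (Fin K)) (m : ℕ) (τ : ℝ) :
    Set ((Fin N₀ → E d) × (Fin K → Fin N → E d)) :=
  {z | ∃ T : Finset (Fin K), T.card ≤ m ∧
    m * τ ≤ ‖∑ k ∈ T, (if k ∈ R then (-1 : ℝ) else 1) • mle (z.2 k)‖}

/-- Weight each set T by K^(m − |T|) ≥ 1 and sum over all subsets: the binomial theorem gives K^m (1
+ 1/K)^K, and the last factor is at most e. -/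
theorem card_filter_card_le (hK : 0 < K) (m : ℕ) :
    ((Finset.univ.filter fun T : Finset (Fin K) => T.card ≤ m).card : ℝ) ≤ 3 * (K : ℝ) ^ m := by
  have hK1 : (1 : ℝ) ≤ K := by exact_mod_cast hK
  have hK0 : (0 : ℝ) < K := by positivity
  calc ((Finset.univ.filter fun T : Finset (Fin K) => T.card ≤ m).card : ℝ)
      = ∑ T : Finset (Fin K) with T.card ≤ m, (1 : ℝ) := by simp
    _ ≤ ∑ T : Finset (Fin K) with T.card ≤ m, (K : ℝ) ^ m * (K : ℝ)⁻¹ ^ T.card := by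
        refine Finset.sum_le_sum fun T hT => ?_
        rw [inv_pow, ← div_eq_mul_inv, le_div_iff₀ (by positivity), one_mul]
        exact pow_le_pow_right₀ hK1 (Finset.mem_filter.1 hT).2
    _ ≤ ∑ T : Finset (Fin K), (K : ℝ) ^ m * (K : ℝ)⁻¹ ^ T.card :=
        Finset.sum_le_sum_of_subset_of_nonneg (Finset.filter_subset _ _)
          fun _ _ _ => by positivity
    _ = (K : ℝ) ^ m * ((K : ℝ)⁻¹ + 1) ^ K := by
        rw [← Finset.mul_sum, ← Fin.sum_pow_mul_eq_add_pow (K : ℝ)⁻¹ 1]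
        simp
    _ ≤ (K : ℝ) ^ m * 3 := by
        gcongr
        calc ((K : ℝ)⁻¹ + 1) ^ K ≤ Real.exp (K : ℝ)⁻¹ ^ K := by
              gcongr; exact Real.add_one_le_exp _
          _ = Real.exp 1 := by
              rw [← Real.exp_nat_mul, mul_inv_cancel₀ hK0.ne']
          _ ≤ 3 := Real.exp_one_lt_three.le
    _ = _ := mul_comm _ _

/-- For fixed T the signed sum is Gaussian of scale √|T| σ/√N, and a Chernoff bound gives √2^d
exp(−mx/4) with x = Nτ²/σ². The lower bound `hd` on m lets half of this exponent absorb the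
dimension, so the final estimate is dimension free. -/
theorem measureReal_noiseCluster_le (hK : 0 < K) (hN : 0 < N) (hσ : 0 < σ) (R : Finset (Fin K))
    {m : ℕ} (hm : 0 < m) {τ : ℝ} (hτ : 0 < τ) (hd : 8 * d ≤ m * (N * τ ^ 2 / σ ^ 2)) :
    (noiseLaw d K N₀ N σ).real (noiseCluster R m τ)
      ≤ 3 * K * Real.exp (-(N * τ ^ 2 / (8 * σ ^ 2))) := by
  set μ := noiseLaw d K N₀ N σ with hμ
  set x := N * τ ^ 2 / σ ^ 2 with hx
  have hx0 : 0 ≤ x := by positivity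
  have hm0 : (0 : ℝ) < m := by exact_mod_cast hm
  set c : Fin K → ℝ := fun k => if k ∈ R then (-1 : ℝ) else 1 with hc
  have hT (T : Finset (Fin K)) (hTm : T.card ≤ m) :
      μ.real {z | m * τ ≤ ‖∑ k ∈ T, c k • mle (z.2 k)‖} ≤ Real.exp (-(m * x / 8)) := by
    rcases T.eq_empty_or_nonempty with rfl | hTne
    · have : {z : (Fin N₀ → E d) × (Fin K → Fin N → E d) |
          m * τ ≤ ‖∑ k ∈ (∅ : Finset (Fin K)), c k • mle (z.2 k)‖} = ∅ := by
        ext z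
        simp only [Finset.sum_empty, norm_zero, Set.mem_ofPred_eq, Set.mem_empty_iff_false,
          iff_false, not_le]
        positivity
      rw [this, measureReal_empty]
      positivity
    · have hT0 : (0 : ℝ) < T.card := by exact_mod_cast hTne.card_pos
      have hTm' : (T.card : ℝ) ≤ m := by exact_mod_cast hTm
      have hlaw := (hasLaw_sum_mle (d := d) hN hσ T c
        (fun k => by simp only [hc]; split_ifs <;> norm_num)).comp
        (measurePreserving_snd (μ := Measure.pi fun _ : Fin N₀ => gaussLaw σ (0 : E d))
          (ν := Measure.pi fun _ : Fin K => Measure.pi fun _ : Fin N => gaussLaw σ (0 : E d))).hasLaw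
      have h1 := measureReal_le_norm_of_hasLaw (by positivity) hlaw
        (a := √m * (√N * τ / σ)) (by positivity)
      have h2 : (√m * (√N * τ / σ)) ^ 2 = m * x := by
        rw [mul_pow, div_pow, mul_pow, Real.sq_sqrt (Nat.cast_nonneg m),
          Real.sq_sqrt (Nat.cast_nonneg N)]
      rw [h2] at h1
      have h3 : √T.card * (σ / √N) * (√m * (√N * τ / σ)) ≤ m * τ := by
        have hN' : √(N : ℝ) ≠ 0 := by positivity
        have h4 : √T.card * (σ / √N) * (√m * (√N * τ / σ)) = √T.card * √m * τ := by
          field_simp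
        rw [h4]
        gcongr
        calc √(T.card : ℝ) * √m ≤ √m * √m := by gcongr
          _ = m := Real.mul_self_sqrt hm0.le
      refine (measureReal_mono fun z hz => h3.trans hz).trans (h1.trans ?_)
      have h5 : √2 ^ d ≤ Real.exp (d : ℝ) := by
        rw [← mul_one (d : ℝ), Real.exp_nat_mul]
        gcongr
        calc √2 ≤ 2 := Real.sqrt_le_iff.2 (by norm_num)
          _ ≤ Real.exp 1 := by linarith [Real.add_one_le_exp (1 : ℝ)]
      calc √2 ^ d * Real.exp (-(m * x / 4)) ≤ Real.exp d * Real.exp (-(m * x / 4)) := by gcongr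
        _ = Real.exp (d - m * x / 4) := by rw [← Real.exp_add]; ring_nf
        _ ≤ Real.exp (-(m * x / 8)) := by
            rw [Real.exp_le_exp]; linarith
  have hsub : noiseCluster R m τ ⊆
      ⋃ T ∈ Finset.univ.filter fun T : Finset (Fin K) => T.card ≤ m,
        {z : (Fin N₀ → E d) × (Fin K → Fin N → E d) | m * τ ≤ ‖∑ k ∈ T, c k • mle (z.2 k)‖} := by
    rintro z ⟨T, hTm, hz⟩
    exact Set.mem_biUnion (Finset.mem_coe.2 (Finset.mem_filter.2 ⟨Finset.mem_univ T, hTm⟩)) hz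
  have hbound : μ.real (noiseCluster R m τ) ≤ 3 * ((K : ℝ) * Real.exp (-(x / 8))) ^ m := by
    refine (measureReal_mono hsub (measure_ne_top _ _)).trans
      ((measureReal_biUnion_finset_le _ _).trans ?_)
    refine (Finset.sum_le_sum fun T hTm => hT T (Finset.mem_filter.1 hTm).2).trans ?_
    rw [Finset.sum_const, nsmul_eq_mul]
    refine (mul_le_mul_of_nonneg_right (card_filter_card_le hK m) (Real.exp_pos _).le).trans ?_
    rw [mul_pow, ← Real.exp_nat_mul, mul_assoc]
    apply le_of_eq
    ring_nf
  have hx8 : N * τ ^ 2 / (8 * σ ^ 2) = x / 8 := by rw [hx]; field_simp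
  rw [hx8, mul_assoc]
  set e := (K : ℝ) * Real.exp (-(x / 8)) with he
  have he0 : 0 ≤ e := by positivity
  -- The union bound has the form 3 e^m. If e ≤ 1 then e^m ≤ e; otherwise 3e exceeds every
  -- probability.
  rcases le_total e 1 with h1 | h1
  · refine hbound.trans ?_
    gcongr
    exact pow_le_of_le_one he0 h1 hm.ne'
  · linarith [measureReal_le_one (μ := μ) (s := noiseCluster R m τ)]

/-- The event that the average log-likelihood ratio at `θ₀` of some source deviates by at least `ε`
from its mean, when the sources have parameters `t`. -/
def logLRDeviation (σ : ℝ) (φ : Measure (E d)) (θ₀ : E d) (ε : ℝ) (t : Fin K → E d) :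
    Set ((Fin N₀ → E d) × (Fin K → Fin N → E d)) :=
  {z | ∃ k, N * ε ≤ |∑ i, (logLR σ φ θ₀ (t k + z.2 k i) - expLogLR σ φ (t k) θ₀)|}

theorem measureReal_logLRDeviation_le {φ : Measure (E d)} [IsProbabilityMeasure φ] {θ₀ : E d}
    {U : Set (E d)} {V L : ℝ≥0} (h0 : θ₀ ∈ U) {t : Fin K → E d}
    (hreg : ∀ k, RegularAt σ φ U V L (t k)) {ε : ℝ} (hε : 0 ≤ ε) :
    (noiseLaw d K N₀ N σ).real (logLRDeviation σ φ θ₀ ε t)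
      ≤ 2 * K * Real.exp (-(N * ε ^ 2 / (2 * V ^ 2))) := by
  set D : Fin K → Set (Fin N → E d) := fun k =>
    {z | N * ε ≤ |∑ i, (logLR σ φ θ₀ (t k + z i) - expLogLR σ φ (t k) θ₀)|} with hD
  have hDm (k : Fin K) : MeasurableSet (D k) := by
    refine measurableSet_le measurable_const (Measurable.abs ?_)
    exact Finset.measurable_fun_sum _ fun i _ =>
      ((measurable_logLR σ φ θ₀).comp ((measurable_pi_apply i).const_add _)).sub_const _
  have hsub : logLRDeviation σ φ θ₀ ε t ⊆
      ⋃ k, {z : (Fin N₀ → E d) × (Fin K → Fin N → E d) | z.2 k ∈ D k} := by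
    rintro z ⟨k, hk⟩
    exact Set.mem_iUnion.2 ⟨k, hk⟩
  refine (measureReal_mono hsub).trans ((measureReal_iUnion_fintype_le _).trans ?_)
  have hk (k : Fin K) : (noiseLaw d K N₀ N σ).real
      {z : (Fin N₀ → E d) × (Fin K → Fin N → E d) | z.2 k ∈ D k}
      ≤ 2 * Real.exp (-(N * ε ^ 2 / (2 * V ^ 2))) := by
    have hmp := (measurePreserving_eval
      (fun _ : Fin K => Measure.pi fun _ : Fin N => gaussLaw σ (0 : E d)) k).comp
      (measurePreserving_snd (μ := Measure.pi fun _ : Fin N₀ => gaussLaw σ (0 : E d))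
        (ν := Measure.pi fun _ : Fin K => Measure.pi fun _ : Fin N => gaussLaw σ (0 : E d)))
    have := hmp.measureReal_preimage (hDm k).nullMeasurableSet
    exact this.le.trans ((hreg k).measureReal_abs_sum_ge_le h0 N hε)
  refine (Finset.sum_le_sum fun k _ => hk k).trans ?_
  simp only [Finset.sum_const, Finset.card_univ, Fintype.card_fin, nsmul_eq_mul]
  linarith

end Noise

/-! ### The EM map, its fixed points, and the scores along the basin. -/

section EM

variable {d K N₀ N : ℕ} {σ β : ℝ} {φ : Measure (E d)} {prob : Fin K → ℝ}

theorem emWeight_mem_Icc (p : ℝ) (x : Fin N → E d) (θ : E d) :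
    emWeight σ β φ p x θ ∈ Set.Icc (0 : ℝ) 1 :=
  ⟨Real.sigmoid_nonneg _, Real.sigmoid_le_one _⟩

theorem sigmoid_le_exp (u : ℝ) : Real.sigmoid u ≤ Real.exp u := by
  rw [Real.sigmoid_def, inv_le_comm₀ (by positivity) (Real.exp_pos u), ← Real.exp_neg]
  linarith

theorem continuous_emStep [IsProbabilityMeasure φ] (hσ : 0 < σ) (hN₀ : 0 < N₀) (x₀ : Fin N₀ → E d)
    (x : Fin K → Fin N → E d) : Continuous (emStep σ β φ prob x₀ x) := by
  have hw (k : Fin K) : Continuous fun θ => emWeight σ β φ (prob k) (x k) θ := by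
    unfold emWeight
    have h (i : Fin N) := continuous_logLR (φ := φ) hσ (x k i)
    exact continuous_sigmoid.comp (by fun_prop)
  have hW (θ : E d) : (N₀ : ℝ) + N * ∑ k, emWeight σ β φ (prob k) (x k) θ ≠ 0 := by
    have h1 : 0 ≤ ∑ k, emWeight σ β φ (prob k) (x k) θ :=
      Finset.sum_nonneg fun k _ => (emWeight_mem_Icc _ _ _).1
    have h2 : (0 : ℝ) < N₀ := by exact_mod_cast hN₀
    positivity
  unfold emStep
  refine Continuous.smul (Continuous.inv₀ (by fun_prop) hW) (by fun_prop)

/-- The EM map is continuous: the scores are quadratic in the parameter and the denominator is at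
least N₀. -/
theorem emStep_eq_self_of_tendsto [IsProbabilityMeasure φ] (hσ : 0 < σ) (hN₀ : 0 < N₀)
    {x₀ : Fin N₀ → E d} {x : Fin K → Fin N → E d} {θ : ℕ → E d} {θinf : E d}
    (hθ : ∀ t, θ (t + 1) = emStep σ β φ prob x₀ x (θ t)) (hlim : Tendsto θ atTop (𝓝 θinf)) :
    emStep σ β φ prob x₀ x θinf = θinf := by
  have h1 := ((continuous_emStep (φ := φ) (β := β) (prob := prob) hσ hN₀ x₀ x).tendsto θinf).comp hlim
  have h2 := hlim.comp (tendsto_add_atTop_nat 1)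
  refine tendsto_nhds_unique (h1.congr fun t => ?_) h2
  exact (hθ t).symm

theorem mle_add_const {n : ℕ} (hn : 0 < n) (c : E d) (z : Fin n → E d) :
    mle (fun i => c + z i) = c + mle z := by
  have : (n : ℝ) ≠ 0 := by positivity
  simp only [mle, Finset.sum_add_distrib, Finset.sum_const, Finset.card_univ, Fintype.card_fin,
    smul_add, ← Nat.cast_smul_eq_nsmul ℝ, smul_smul, inv_mul_cancel₀ this, one_smul]

theorem sum_eq_smul_mle {n : ℕ} (hn : 0 < n) (z : Fin n → E d) : ∑ i, z i = (n : ℝ) • mle z := by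
  have : (n : ℝ) ≠ 0 := by positivity
  rw [mle, smul_smul, mul_inv_cancel₀ this, one_smul]

/-- The fixed point equation in terms of the parameters `t` and the noise `z`. -/
theorem fixedPoint_error_eq (hN₀ : 0 < N₀) (hN : 0 < N) {θ₀ θ : E d} {t : Fin K → E d}
    {z : (Fin N₀ → E d) × (Fin K → Fin N → E d)}
    (hfix : emStep σ β φ prob (fun i => θ₀ + z.1 i) (fun k i => t k + z.2 k i) θ = θ) :
    ((N₀ : ℝ) + N * ∑ k, emWeight σ β φ (prob k) (fun i => t k + z.2 k i) θ) • (θ - θ₀)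
      = (N₀ : ℝ) • mle z.1 + (N : ℝ) • ∑ k,
        emWeight σ β φ (prob k) (fun i => t k + z.2 k i) θ • (t k - θ₀ + mle (z.2 k)) := by
  set w : Fin K → ℝ := fun k => emWeight σ β φ (prob k) (fun i => t k + z.2 k i) θ with hw
  have hW : (N₀ : ℝ) + N * ∑ k, w k ≠ 0 := by
    have h1 : 0 ≤ ∑ k, w k := Finset.sum_nonneg fun k _ => (emWeight_mem_Icc _ _ _).1
    have h2 : (0 : ℝ) < N₀ := by exact_mod_cast hN₀
    positivity
  have h1 : ((N₀ : ℝ) + N * ∑ k, w k) • θ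
      = (N₀ : ℝ) • (θ₀ + mle z.1) + (N : ℝ) • ∑ k, w k • (t k + mle (z.2 k)) := by
    conv_lhs => rw [← hfix, emStep]
    rw [smul_smul, mul_inv_cancel₀ hW, one_smul, mle_add_const hN₀]
    simp only [mle_add_const hN, hw]
  have h2 (k : Fin K) : w k • (t k - θ₀ + mle (z.2 k))
      = w k • (t k + mle (z.2 k)) - w k • θ₀ := by
    rw [← smul_sub]; congr 1; abel
  change ((N₀ : ℝ) + N * ∑ k, w k) • (θ - θ₀)
    = (N₀ : ℝ) • mle z.1 + (N : ℝ) • ∑ k, w k • (t k - θ₀ + mle (z.2 k))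
  simp_rw [h2]
  rw [Finset.sum_sub_distrib, ← Finset.sum_smul, smul_sub, h1, smul_sub, smul_add, add_smul,
    mul_smul]
  abel

theorem oracleError_eq (hN₀ : 0 < N₀) {R : Finset (Fin K)} {θ₀ : E d} {t : Fin K → E d}
    (ht : ∀ k ∈ R, t k = θ₀) (z : (Fin N₀ → E d) × (Fin K → Fin N → E d)) :
    ((N₀ : ℝ) + N * R.card) • oracleError R z
      = (N₀ : ℝ) • mle z.1 + (N : ℝ) • ∑ k ∈ R, (t k - θ₀ + mle (z.2 k)) := by
  have hM : (N₀ : ℝ) + N * R.card ≠ 0 := by positivity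
  rw [oracleError, smul_add, smul_smul, smul_smul, mul_div_cancel₀ _ hM, mul_div_cancel₀ _ hM]
  congr 2
  refine Finset.sum_congr rfl fun k hk => ?_
  rw [ht k hk, one_smul, sub_self, zero_add]

/-- The four terms are the margin, the fluctuation at θ₀, the drift, and the mean noise along h.
Only the last one is both random and dependent on h, and it is linear in h. -/
theorem sum_logLR_eq [IsProbabilityMeasure φ] (hσ : 0 < σ) (hN : 0 < N) (θ₀ h t : E d)
    (z : Fin N → E d) :
    ∑ i, logLR σ φ (θ₀ + h) (t + z i) = N * expLogLR σ φ t θ₀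
      + ∑ i, (logLR σ φ θ₀ (t + z i) - expLogLR σ φ t θ₀)
      + N * ((⟪t - θ₀, h⟫ - ‖h‖ ^ 2 / 2) / σ ^ 2) + N * (⟪mle z, h⟫ / σ ^ 2) := by
  have h1 : (N : ℝ) * ⟪mle z, h⟫ = ∑ i, ⟪z i, h⟫ := by
    rw [← real_inner_smul_left, ← sum_eq_smul_mle hN, sum_inner]
  have h2 (i : Fin N) : logLR σ φ (θ₀ + h) (t + z i)
      = logLR σ φ θ₀ (t + z i) + (⟪t - θ₀, h⟫ - ‖h‖ ^ 2 / 2) / σ ^ 2 + ⟪z i, h⟫ / σ ^ 2 := by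
    rw [logLR_add hσ, show t + z i - θ₀ = (t - θ₀) + z i by abel, inner_add_left]
    ring
  simp_rw [h2]
  rw [Finset.sum_add_distrib, Finset.sum_add_distrib, Finset.sum_sub_distrib,
    ← Finset.sum_div Finset.univ (fun i => ⟪z i, h⟫), ← h1]
  simp only [Finset.sum_const, Finset.card_univ, Fintype.card_fin, nsmul_eq_mul]
  ring

/-- The weight of a source whose cumulative score has the correct sign is close to its ideal
value. -/
theorem emWeight_le_of_sum_le (hβ : 0 < β) {p B s : ℝ} (hp : |logOdds p| ≤ B) {x : Fin N → E d}
    {θ : E d} (hs : ∑ i, logLR σ φ θ (x i) ≤ -s) :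
    emWeight σ β φ p x θ ≤ Real.exp (B - β * s) := by
  refine (sigmoid_le_exp _).trans (Real.exp_le_exp.2 ?_)
  have := mul_le_mul_of_nonneg_left hs hβ.le
  linarith [(abs_le.1 hp).2]

theorem one_sub_emWeight_le_of_le_sum (hβ : 0 < β) {p B s : ℝ} (hp : |logOdds p| ≤ B)
    {x : Fin N → E d} {θ : E d} (hs : s ≤ ∑ i, logLR σ φ θ (x i)) :
    1 - emWeight σ β φ p x θ ≤ Real.exp (B - β * s) := by
  rw [emWeight, ← Real.sigmoid_neg]
  refine (sigmoid_le_exp _).trans (Real.exp_le_exp.2 ?_)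
  have := mul_le_mul_of_nonneg_left hs hβ.le
  linarith [(abs_le.1 hp).1]

/-- Off the cluster event, only few sources have noise aligned with a short vector `h`. -/
theorem sum_inner_le_of_notMem_noiseCluster {R : Finset (Fin K)} {m : ℕ} {τ ρ Γ : ℝ}
    {z : (Fin N₀ → E d) × (Fin K → Fin N → E d)} (hz : z ∉ noiseCluster R m τ) (hm : 0 < m)
    (hτ : 0 < τ) (hρ : 0 < ρ) {h : E d} (hh : ‖h‖ ≤ ρ) (hΓ : 0 ≤ Γ) (hmΓ : 2 ≤ m → m * τ ≤ Γ)
    {T : Finset (Fin K)}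
    (hT : ∀ k ∈ T, τ * ρ ≤ ⟪(if k ∈ R then (-1 : ℝ) else 1) • mle (z.2 k), h⟫) :
    ∑ k ∈ T, ⟪(if k ∈ R then (-1 : ℝ) else 1) • mle (z.2 k), h⟫ ≤ Γ * ‖h‖ := by
  set u : Fin K → E d := fun k => (if k ∈ R then (-1 : ℝ) else 1) • mle (z.2 k) with hu
  have hcl (T' : Finset (Fin K)) (hT' : T'.card ≤ m) : ‖∑ k ∈ T', u k‖ < m * τ := by
    by_contra! hlt
    exact hz ⟨T', hT', hlt⟩
  have hin (T' : Finset (Fin K)) (hT' : T'.card ≤ m) : ∑ k ∈ T', ⟪u k, h⟫ ≤ m * τ * ‖h‖ := by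
    rw [← sum_inner]
    exact (real_inner_le_norm _ _).trans
      (mul_le_mul_of_nonneg_right (hcl T' hT').le (norm_nonneg h))
  have hm0 : (0 : ℝ) < m := by exact_mod_cast hm
  -- Otherwise m members of T would have a noise sum of norm at least mτ, because ‖h‖ ≤ ρ,
  -- contradicting the absence of a cluster.
  have hcard : T.card < m := by
    by_contra! hle
    obtain ⟨T', hT'T, hT'⟩ := Finset.exists_subset_card_eq hle
    have h1 : (m : ℝ) * (τ * ρ) ≤ ∑ k ∈ T', ⟪u k, h⟫ := by
      rw [← hT', ← nsmul_eq_mul, ← Finset.sum_const]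
      exact Finset.sum_le_sum fun k hk => hT k (hT'T hk)
    rw [← sum_inner] at h1
    have h2 := real_inner_le_norm (∑ k ∈ T', u k) h
    have h3 := hcl T' hT'.le
    have h4 : (m : ℝ) * τ * ‖h‖ ≤ m * τ * ρ := by gcongr
    have hpos : 0 < ‖h‖ := by
      rcases (norm_nonneg h).eq_or_lt with hz | hpos
      · rw [← hz, mul_zero] at h2
        have : 0 < (m : ℝ) * (τ * ρ) := by positivity
        linarith
      · exact hpos
    have h5 : ‖∑ k ∈ T', u k‖ * ‖h‖ < m * τ * ‖h‖ := mul_lt_mul_of_pos_right h3 hpos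
    linarith
  rcases T.eq_empty_or_nonempty with rfl | hne
  · simpa using by positivity
  · have h2 : 2 ≤ m := by
      have := hne.card_pos
      omega
    exact (hin T hcard.le).trans (mul_le_mul_of_nonneg_right (hmΓ h2) (norm_nonneg h))

end EM

/-! ### Numerical estimates for the error terms. -/

theorem add_sq_le_mul_sq (a b : ℝ) : (a + b) ^ 2 ≤ 8 / 7 * a ^ 2 + 8 * b ^ 2 := by
  nlinarith [sq_nonneg (a - 7 * b)]

theorem add_sq_le_two_mul_sq (a b : ℝ) : (a + b) ^ 2 ≤ 2 * a ^ 2 + 2 * b ^ 2 := by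
  nlinarith [sq_nonneg (a - b)]

/-- With v = dσ²/M the left side is v times 4096 vρ²/(σ²Δ)². Replacing v by ρ²/2 and ρ² by σ²Δ/5000
makes the second factor an absolute constant below 1/1000; this is where the smallness of the basin
constant is spent. -/
theorem cluster_error_sq_le {d M N σ Δ ρ : ℝ} (hM : 0 < M) (hN : 0 < N) (hσ : 0 < σ) (hd : 0 < d)
    (hΔ : 0 < Δ) (hρ : 0 < ρ) (hρ2 : ρ ^ 2 ≤ σ ^ 2 * Δ / 5000) (hv : 2 * (d * σ ^ 2 / M) ≤ ρ ^ 2) :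
    (N / M * (2 * (8 * d / (N * (σ ^ 2 * Δ / (4 * ρ)) ^ 2 / σ ^ 2)) * (σ ^ 2 * Δ / (4 * ρ)))) ^ 2
      ≤ d * σ ^ 2 / M / 1000 := by
  set v := d * σ ^ 2 / M with hvdef
  have hv0 : 0 < v := by positivity
  have h1 : (N / M * (2 * (8 * d / (N * (σ ^ 2 * Δ / (4 * ρ)) ^ 2 / σ ^ 2))
      * (σ ^ 2 * Δ / (4 * ρ)))) ^ 2 = v * (4096 * v * ρ ^ 2 / (σ ^ 2 * Δ) ^ 2) := by
    rw [hvdef]; field_simp; ring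
  rw [h1, div_eq_mul_inv v]
  gcongr
  rw [div_le_iff₀ (by positivity)]
  calc 4096 * v * ρ ^ 2 ≤ 2048 * ρ ^ 2 * ρ ^ 2 := by nlinarith
    _ ≤ 2048 * (σ ^ 2 * Δ / 5000) * (σ ^ 2 * Δ / 5000) := by gcongr
    _ ≤ 1000⁻¹ * (σ ^ 2 * Δ) ^ 2 := by nlinarith [sq_nonneg (σ ^ 2 * Δ)]

theorem combined_error_sq_le {c Γ ω Y v P : ℝ} (h1 : (c * Γ) ^ 2 ≤ v / 1000)
    (h2 : (c * Y) ^ 2 ≤ P) (hv : 0 ≤ v) :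
    64 / 7 * (16 / 15 * c * (2 * Γ + ω * Y)) ^ 2 ≤ v / 10 + 2048 * ω ^ 2 * P := by
  have h3 := add_sq_le_two_mul_sq (2 * (c * Γ)) (ω * (c * Y))
  have h4 : 64 / 7 * (16 / 15 * c * (2 * Γ + ω * Y)) ^ 2
      = 64 / 7 * (256 / 225) * (2 * (c * Γ) + ω * (c * Y)) ^ 2 := by ring
  have h5 : ω ^ 2 * (c * Y) ^ 2 ≤ ω ^ 2 * P := by gcongr
  have h6 : 0 ≤ ω ^ 2 * (c * Y) ^ 2 := by positivity
  rw [h4]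
  rw [mul_pow, mul_pow] at h3
  linarith

/-! ### Pointwise bound of the fixed point error. -/

section Pointwise

variable {d K N₀ N : ℕ} {σ β : ℝ} {φ : Measure (E d)} [IsProbabilityMeasure φ] {prob : Fin K → ℝ}
  {θ₀ θ : E d} {t : Fin K → E d} {z : (Fin N₀ → E d) × (Fin K → Fin N → E d)} {R : Finset (Fin K)}
  {U : Set (E d)} {V L : ℝ≥0} {Δ r B ρ Γ : ℝ} {m : ℕ}

/-- Off the exceptional events, a fixed point of the EM iteration in the basin is close to the
oracle, up to the influence of the irrelevant sources that are not separated. -/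
theorem fixedPoint_norm_sq_le_of_notMem (hN₀ : 0 < N₀) (hN : 0 < N) (hσ : 0 < σ) (hβ : 0 < β)
    (hΔ : 0 < Δ) (hρ : 0 < ρ) (hLρ : L * ρ = Δ / 10000) (hρL : ρ ≤ 2 * σ ^ 2 * L)
    (hU : Metric.closedBall θ₀ ρ ⊆ U) (hreg : ∀ k, RegularAt σ φ U V L (t k))
    (ht : ∀ k ∈ R, t k = θ₀)
    (hmargin : ∀ k, (k ∈ R → Δ ≤ expLogLR σ φ (t k) θ₀) ∧
      (k ∉ R → r ≤ ‖t k - θ₀‖ → expLogLR σ φ (t k) θ₀ ≤ -Δ))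
    (hB : ∀ k, |logOdds (prob k)| ≤ B)
    (hfix : emStep σ β φ prob (fun i => θ₀ + z.1 i) (fun k i => t k + z.2 k i) θ = θ)
    (hball : ‖θ - θ₀‖ ≤ ρ) (hm : 0 < m) (hΓ : 0 ≤ Γ)
    (hmΓ : 2 ≤ m → m * (σ ^ 2 * Δ / (4 * ρ)) ≤ Γ)
    (hω : Real.exp (B - β * (N * Δ / 4)) ≤ 1 / 16)
    (hz₁ : z ∉ logLRDeviation σ φ θ₀ (Δ / 4) t)
    (hz₂ : z ∉ noiseCluster R m (σ ^ 2 * Δ / (4 * ρ))) :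
    ‖θ - θ₀‖ ^ 2 ≤ 8 / 7 * ‖oracleError R z‖ ^ 2
      + 128 / 105 * ∑ k with k ∉ R ∧ ‖t k - θ₀‖ < r,
          N / (N₀ + N * R.card + N) * ‖t k - θ₀ + mle (z.2 k)‖ ^ 2
      + 64 / 7 * (16 / 15 * (N / (N₀ + N * R.card)) * (2 * Γ
        + Real.exp (B - β * (N * Δ / 4)) * (R.card * ‖oracleError R z‖
          + ∑ k, ‖t k - θ₀ + mle (z.2 k)‖))) ^ 2 := by
  set h := θ - θ₀ with hh
  have hθ : θ = θ₀ + h := by rw [hh]; abel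
  have hN₀' : (0 : ℝ) < N₀ := by exact_mod_cast hN₀
  have hN' : (0 : ℝ) < N := by exact_mod_cast hN
  have h0U : θ₀ ∈ U := hU (Metric.mem_closedBall_self hρ.le)
  have hhU : θ₀ + h ∈ U := hU (by simpa using hball)
  have hLh : L * ‖h‖ ≤ Δ / 10000 := by
    rw [← hLρ]; gcongr
  have hdrift (k : Fin K) : |⟪t k - θ₀, h⟫ - ‖h‖ ^ 2 / 2| ≤ σ ^ 2 * (Δ / 10000) :=
    ((hreg k).abs_inner_sub_le hσ h0U hhU).trans (by gcongr)
  have hhsq : ‖h‖ ^ 2 ≤ σ ^ 2 * Δ / 5000 := by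
    calc ‖h‖ ^ 2 ≤ ρ ^ 2 := by gcongr
      _ ≤ 2 * σ ^ 2 * L * ρ := by rw [sq]; gcongr
      _ = 2 * σ ^ 2 * (L * ρ) := by ring
      _ = σ ^ 2 * Δ / 5000 := by rw [hLρ]; ring
  have hσ2 : 0 < σ ^ 2 := by positivity
  have hσΔ : 0 < σ ^ 2 * Δ := by positivity
  set κ := σ ^ 2 * Δ / 4 with hκ
  have hτρ : σ ^ 2 * Δ / (4 * ρ) * ρ = κ := by rw [hκ]; field_simp
  set y : Fin K → ℝ := fun k => ⟪(if k ∈ R then (-1 : ℝ) else 1) • mle (z.2 k), h⟫ with hy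
  -- The threshold κ = σ²Δ/4 is the amount of signed mean noise along h that spends a quarter of the
  -- margin.
  set T : Finset (Fin K) := Finset.univ.filter fun k => κ ≤ y k with hT
  have hyR (k : Fin K) (hk : k ∈ R) : y k = -⟪mle (z.2 k), h⟫ := by
    simp [hy, hk]
  have hyR' (k : Fin K) (hk : k ∉ R) : y k = ⟪mle (z.2 k), h⟫ := by
    simp [hy, hk]
  have hmemT (k : Fin K) : k ∈ T ↔ κ ≤ y k := by simp [hT]
  have hsum (k : Fin K) := sum_logLR_eq (φ := φ) hσ hN θ₀ h (t k) (z.2 k)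
  have hdev (k : Fin K) :
      |∑ i, (logLR σ φ θ₀ (t k + z.2 k i) - expLogLR σ φ (t k) θ₀)| < N * (Δ / 4) := by
    by_contra! hlt
    exact hz₁ ⟨k, hlt⟩
  have hdrift' (k : Fin K) : |(N : ℝ) * ((⟪t k - θ₀, h⟫ - ‖h‖ ^ 2 / 2) / σ ^ 2)|
      ≤ N * (Δ / 10000) := by
    rw [abs_mul, abs_of_pos hN', abs_div, abs_of_pos hσ2]
    refine mul_le_mul_of_nonneg_left ?_ hN'.le
    rw [div_le_iff₀ hσ2, mul_comm]
    exact hdrift k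
  have hκN : N * (κ / σ ^ 2) = N * Δ / 4 := by rw [hκ]; field_simp
  have hNΔ : 0 < N * Δ := by positivity
  refine weightedMean_norm_sq_le (w := fun k => emWeight σ β φ (prob k) (fun i => t k + z.2 k i) θ)
    (T := T) (y := y) hN₀' hN' (fun k => emWeight_mem_Icc _ _ _)
    (fixedPoint_error_eq hN₀ hN hfix) (oracleError_eq hN₀ ht z) hω (Real.exp_pos _).le
    (fun k hk => (Finset.mem_filter.1 hk).2.1) ?_ ?_ ?_ ?_ ?_ ?_
  · intro k hk hkT
    refine one_sub_emWeight_le_of_le_sum hβ (hB k) ?_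
    rw [hθ, hsum k]
    have h1 := (hmargin k).1 hk
    have h2 : -(N * Δ / 4) ≤ N * (⟪mle (z.2 k), h⟫ / σ ^ 2) := by
      rw [hmemT, not_le, hyR k hk] at hkT
      rw [← hκN, ← mul_neg, ← neg_div]
      gcongr
      linarith
    have h3 := mul_le_mul_of_nonneg_left h1 hN'.le
    -- Per observation, Δ loses Δ/4 to the fluctuation at θ₀, Δ/10000 to the drift and Δ/4 to the
    -- noise along h; more than Δ/4 remains.
    linarith [(abs_le.1 (hdev k).le).1, (abs_le.1 (hdrift' k)).1]
  · intro k hk hkS hkT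
    refine emWeight_le_of_sum_le hβ (hB k) ?_
    rw [hθ, hsum k]
    have hr : r ≤ ‖t k - θ₀‖ := by
      by_contra! hlt
      exact hkS (Finset.mem_filter.2 ⟨Finset.mem_univ k, hk, hlt⟩)
    have h1 := (hmargin k).2 hk hr
    have h2 : N * (⟪mle (z.2 k), h⟫ / σ ^ 2) ≤ N * Δ / 4 := by
      rw [hmemT, not_le, hyR' k hk] at hkT
      rw [← hκN]
      gcongr
    have h3 := mul_le_mul_of_nonneg_left h1 hN'.le
    linarith [(abs_le.1 (hdev k).le).2, (abs_le.1 (hdrift' k)).2]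
  · intro k hk
    rw [hmemT] at hk
    linarith
  · intro k hkT hk
    rw [hmemT] at hkT
    rw [ht k hk, sub_self, zero_add]
    linarith [hyR k hk]
  · intro k hkT hk _
    rw [hmemT] at hkT
    rw [inner_add_left, ← hyR' k hk]
    -- A misclassified irrelevant source may be far from θ₀, yet its drift along h is below κ, hence
    -- below y k.
    linarith [(abs_le.1 (hdrift k)).2, sq_nonneg ‖h‖]
  · refine sum_inner_le_of_notMem_noiseCluster hz₂ hm (by positivity) hρ hball hΓ hmΓ ?_
    intro k hk
    rw [hτρ]
    exact (hmemT k).1 hk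

/-- The exceptional event, when the sources have parameters `t`. -/
def exceptional (σ : ℝ) (φ : Measure (E d)) (θ₀ : E d) (R : Finset (Fin K)) (Δ ρ : ℝ)
    (t : Fin K → E d) : Set ((Fin N₀ → E d) × (Fin K → Fin N → E d)) :=
  logLRDeviation σ φ θ₀ (Δ / 4) t ∪
    noiseCluster R ⌈8 * d / (N * (σ ^ 2 * Δ / (4 * ρ)) ^ 2 / σ ^ 2)⌉₊ (σ ^ 2 * Δ / (4 * ρ))

/-- One inequality valid for every noise: the fine bound and the crude bound are merged by letting
the crude error carry a coefficient that is of order one on the exceptional event or when ω is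
large. -/
theorem fixedPoint_norm_sq_le (hd : 0 < d) (hN₀ : 0 < N₀) (hN : 0 < N) (hσ : 0 < σ) (hβ : 0 < β)
    (hΔ : 0 < Δ) (hρ : 0 < ρ) (hLρ : L * ρ = Δ / 10000) (hρL : ρ ≤ 2 * σ ^ 2 * L)
    (hv : 2 * (d * σ ^ 2 / (N₀ + N * R.card)) ≤ ρ ^ 2)
    (hU : Metric.closedBall θ₀ ρ ⊆ U) (hreg : ∀ k, RegularAt σ φ U V L (t k))
    (ht : ∀ k ∈ R, t k = θ₀)
    (hmargin : ∀ k, (k ∈ R → Δ ≤ expLogLR σ φ (t k) θ₀) ∧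
      (k ∉ R → r ≤ ‖t k - θ₀‖ → expLogLR σ φ (t k) θ₀ ≤ -Δ))
    (hB : ∀ k, |logOdds (prob k)| ≤ B)
    (hfix : emStep σ β φ prob (fun i => θ₀ + z.1 i) (fun k i => t k + z.2 k i) θ = θ)
    (hball : ‖θ - θ₀‖ ≤ ρ) :
    ‖θ - θ₀‖ ^ 2 ≤ 8 / 7 * ‖oracleError R z‖ ^ 2
      + 128 / 105 * ∑ k with k ∉ R ∧ ‖t k - θ₀‖ < r,
          N / (N₀ + N * R.card + N) * ‖t k - θ₀ + mle (z.2 k)‖ ^ 2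
      + d * σ ^ 2 / (N₀ + N * R.card) / 10
      + (N / N₀) ^ 2 * (2048 * Real.exp (B - β * (N * Δ / 4)) ^ 2
          + 8 * (exceptional σ φ θ₀ R Δ ρ t).indicator 1 z)
        * (2 * R.card ^ 2 * ‖oracleError R z‖ ^ 2
          + 2 * K * ∑ k, ‖t k - θ₀ + mle (z.2 k)‖ ^ 2) := by
  set ω := Real.exp (B - β * (N * Δ / 4)) with hω
  have hω0 : 0 < ω := Real.exp_pos _
  have hN₀' : (0 : ℝ) < N₀ := by exact_mod_cast hN₀
  have hN' : (0 : ℝ) < N := by exact_mod_cast hN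
  have hd' : (0 : ℝ) < d := by exact_mod_cast hd
  set M : ℝ := N₀ + N * R.card with hM
  have hM0 : 0 < M := by positivity
  have hM₀ : (N₀ : ℝ) ≤ M := by rw [hM]; linarith [show (0 : ℝ) ≤ N * R.card by positivity]
  set a := ‖oracleError R z‖ with ha
  set A : Fin K → ℝ := fun k => ‖t k - θ₀ + mle (z.2 k)‖ with hA
  set S := ∑ k with k ∉ R ∧ ‖t k - θ₀‖ < r, N / (M + N) * A k ^ 2 with hS
  have hS0 : 0 ≤ S := Finset.sum_nonneg fun k _ =>
    mul_nonneg (div_nonneg hN'.le (add_nonneg hM0.le hN'.le)) (sq_nonneg _)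
  set v := d * σ ^ 2 / M with hvdef
  have hv0 : 0 < v := by positivity
  set Y := R.card * a + ∑ k, A k with hY
  have hY0 : 0 ≤ Y := add_nonneg (mul_nonneg (Nat.cast_nonneg _) (norm_nonneg _))
    (Finset.sum_nonneg fun k _ => norm_nonneg _)
  have hY2 : Y ^ 2 ≤ 2 * R.card ^ 2 * a ^ 2 + 2 * K * ∑ k, A k ^ 2 := by
    have h1 := sq_sum_le_card_mul_sum_sq (s := Finset.univ) (f := A)
    rw [Finset.card_univ, Fintype.card_fin] at h1
    have h2 := add_sq_le_two_mul_sq (R.card * a) (∑ k, A k)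
    rw [mul_pow] at h2
    linarith
  set Q := 2 * (R.card : ℝ) ^ 2 * a ^ 2 + 2 * K * ∑ k, A k ^ 2 with hQ
  have hQ0 : 0 ≤ Q := (sq_nonneg Y).trans hY2
  have hN2 : (N / N₀ * Y) ^ 2 ≤ (N / N₀ : ℝ) ^ 2 * Q := by
    rw [mul_pow]
    exact mul_le_mul_of_nonneg_left hY2 (sq_nonneg _)
  have hNM : (N / M * Y) ^ 2 ≤ (N / N₀ : ℝ) ^ 2 * Q :=
    (pow_le_pow_left₀ (mul_nonneg (div_nonneg hN'.le hM0.le) hY0)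
      (mul_le_mul_of_nonneg_right (div_le_div_of_nonneg_left hN'.le hN₀' hM₀) hY0) 2).trans hN2
  set e : ℝ := (exceptional σ φ θ₀ R Δ ρ t).indicator 1 z with he
  have he0 : 0 ≤ e := Set.indicator_nonneg (fun _ _ => zero_le_one) _
  have hNQ : 0 ≤ (N / N₀ : ℝ) ^ 2 * Q := mul_nonneg (sq_nonneg _) hQ0
  -- The premise holds when ω > 1/16, since 256 = 16², and on the exceptional event, where e = 1.
  have hcrude : 1 ≤ 256 * ω ^ 2 + e → ‖θ - θ₀‖ ^ 2 ≤ 8 / 7 * a ^ 2 + 128 / 105 * S + v / 10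
      + (N / N₀) ^ 2 * (2048 * ω ^ 2 + 8 * e) * Q := by
    intro h1
    have h2 := weightedMean_norm_le hN₀' hN' (fun k => emWeight_mem_Icc _ _ _)
      (fixedPoint_error_eq hN₀ hN hfix) (oracleError_eq hN₀ ht z)
    have h3 : ‖θ - θ₀‖ ^ 2 ≤ (a + N / N₀ * Y) ^ 2 := pow_le_pow_left₀ (norm_nonneg _) h2 2
    have h4 := add_sq_le_mul_sq a (N / N₀ * Y)
    have h5 := mul_le_mul_of_nonneg_right h1 hNQ
    have h6 : (N / N₀ : ℝ) ^ 2 * (2048 * ω ^ 2 + 8 * e) * Q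
        = 8 * ((256 * ω ^ 2 + e) * ((N / N₀ : ℝ) ^ 2 * Q)) := by ring
    linarith
  rcases lt_or_ge (1 / 16) ω with hbig | hsmall
  · refine hcrude ?_
    have : (1 / 16) ^ 2 ≤ ω ^ 2 := pow_le_pow_left₀ (by norm_num) hbig.le 2
    linarith
  by_cases hz : z ∈ exceptional σ φ θ₀ R Δ ρ t
  · refine hcrude ?_
    have : e = 1 := by rw [he, Set.indicator_of_mem hz]; rfl
    rw [this]
    linarith [sq_nonneg ω]
  have hz' : z ∉ logLRDeviation σ φ θ₀ (Δ / 4) t ∧ z ∉ noiseCluster R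
      ⌈8 * d / (N * (σ ^ 2 * Δ / (4 * ρ)) ^ 2 / σ ^ 2)⌉₊ (σ ^ 2 * Δ / (4 * ρ)) := by
    simpa only [exceptional, Set.mem_union, not_or] using hz
  have hρ2 : ρ ^ 2 ≤ σ ^ 2 * Δ / 5000 := by
    calc ρ ^ 2 ≤ 2 * σ ^ 2 * L * ρ := by rw [sq]; gcongr
      _ = 2 * σ ^ 2 * (L * ρ) := by ring
      _ = σ ^ 2 * Δ / 5000 := by rw [hLρ]; ring
  have hcl := cluster_error_sq_le (N := N) hM0 hN' hσ hd' hΔ hρ hρ2 hv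
  have hτ0 : 0 < σ ^ 2 * Δ / (4 * ρ) := by positivity
  set τ := σ ^ 2 * Δ / (4 * ρ) with hτ
  have hx0 : 0 < 8 * d / (N * τ ^ 2 / σ ^ 2) := by positivity
  set x := 8 * d / (N * τ ^ 2 / σ ^ 2) with hx
  -- If the ceiling is at least 2 then x > 1, so rounding up at most doubles x.
  have hmΓ : 2 ≤ ⌈x⌉₊ → ⌈x⌉₊ * τ ≤ 2 * x * τ := by
    intro h2
    have h3 := Nat.ceil_lt_add_one hx0.le
    have h4 : (2 : ℝ) ≤ ⌈x⌉₊ := by exact_mod_cast h2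
    refine mul_le_mul_of_nonneg_right ?_ hτ0.le
    linarith
  have hfine := fixedPoint_norm_sq_le_of_notMem (Γ := 2 * x * τ) hN₀ hN hσ hβ hΔ hρ hLρ hρL hU
    hreg ht hmargin hB hfix hball (Nat.ceil_pos.2 hx0) (by positivity) hmΓ hsmall hz'.1 hz'.2
  have hcomb := combined_error_sq_le (ω := ω) hcl hNM hv0.le
  refine hfine.trans ?_
  have h7 : 0 ≤ 8 * e * ((N / N₀ : ℝ) ^ 2 * Q) :=
    mul_nonneg (mul_nonneg (by norm_num) he0) hNQ
  have h8 : (N / N₀ : ℝ) ^ 2 * (2048 * ω ^ 2 + 8 * e) * Q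
      = 2048 * ω ^ 2 * ((N / N₀ : ℝ) ^ 2 * Q) + 8 * e * ((N / N₀ : ℝ) ^ 2 * Q) := by ring
  linarith

end Pointwise

/-! ### Expectation over the noise, with the parameters fixed. -/

section Expectation

variable {d K N₀ N : ℕ} {σ β : ℝ} {φ : Measure (E d)} {θ₀ : E d} {R : Finset (Fin K)}
  {V L : ℝ≥0} {Δ r ρ ω p : ℝ}

/-- The quadratic form of the errors that multiplies the small probabilities. -/
noncomputable def crudeError (θ₀ : E d) (R : Finset (Fin K)) (t : Fin K → E d)
    (z : (Fin N₀ → E d) × (Fin K → Fin N → E d)) : ℝ :=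
  2 * R.card ^ 2 * ‖oracleError R z‖ ^ 2 + 2 * K * ∑ k, ‖t k - θ₀ + mle (z.2 k)‖ ^ 2

/-- An upper bound of the squared error of a fixed point of the EM iteration in the basin. -/
noncomputable def errorBound (σ : ℝ) (φ : Measure (E d)) (θ₀ : E d) (R : Finset (Fin K))
    (Δ ρ r ω : ℝ) (t : Fin K → E d) (z : (Fin N₀ → E d) × (Fin K → Fin N → E d)) : ℝ :=
  8 / 7 * ‖oracleError R z‖ ^ 2
    + 128 / 105 * ∑ k with k ∉ R ∧ ‖t k - θ₀‖ < r,
        N / (N₀ + N * R.card + N) * ‖t k - θ₀ + mle (z.2 k)‖ ^ 2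
    + d * σ ^ 2 / (N₀ + N * R.card) / 10
    + (N / N₀) ^ 2 * (2048 * ω ^ 2 + 8 * (exceptional σ φ θ₀ R Δ ρ t).indicator 1 z)
      * crudeError θ₀ R t z

/-- An upper bound of the expectation of `errorBound` over the noise. -/
noncomputable def meanErrorBound (σ : ℝ) (θ₀ : E d) (R : Finset (Fin K)) (N₀ N : ℕ)
    (r ω p : ℝ) (t : Fin K → E d) : ℝ :=
  8 / 7 * (d * σ ^ 2 / (N₀ + N * R.card))
    + 128 / 105 * ∑ k with k ∉ R ∧ ‖t k - θ₀‖ < r,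
        N / (N₀ + N * R.card + N) * (‖t k - θ₀‖ ^ 2 + d * σ ^ 2 / N)
    + d * σ ^ 2 / (N₀ + N * R.card) / 10
    + (N / N₀) ^ 2 * (8192 * ω ^ 2 + 336 * √p) * (K * ∑ k, (‖t k - θ₀‖ ^ 2 + d * σ ^ 2 / N))

theorem crudeError_nonneg (t : Fin K → E d) (z : (Fin N₀ → E d) × (Fin K → Fin N → E d)) :
    0 ≤ crudeError θ₀ R t z := by
  unfold crudeError
  exact add_nonneg (by positivity)
    (mul_nonneg (by positivity) (Finset.sum_nonneg fun k _ => sq_nonneg _))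

theorem measurable_oracleError : Measurable
    (oracleError R : (Fin N₀ → E d) × (Fin K → Fin N → E d) → E d) := by
  have h (k : Fin K) : Measurable fun z : (Fin N₀ → E d) × (Fin K → Fin N → E d) => mle (z.2 k) :=
    measurable_mle.comp ((measurable_pi_apply k).comp measurable_snd)
  have h0 : Measurable fun z : (Fin N₀ → E d) × (Fin K → Fin N → E d) => mle z.1 :=
    measurable_mle.comp measurable_fst
  unfold oracleError
  fun_prop

theorem measurable_mle_source (k : Fin K) :
    Measurable fun z : (Fin N₀ → E d) × (Fin K → Fin N → E d) => mle (z.2 k) :=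
  measurable_mle.comp ((measurable_pi_apply k).comp measurable_snd)

theorem measurableSet_noiseCluster (m : ℕ) (τ : ℝ) : MeasurableSet
    (noiseCluster R m τ : Set ((Fin N₀ → E d) × (Fin K → Fin N → E d))) := by
  have h : (noiseCluster R m τ : Set ((Fin N₀ → E d) × (Fin K → Fin N → E d)))
      = ⋃ T : Finset (Fin K), {z | T.card ≤ m ∧
        m * τ ≤ ‖∑ k ∈ T, (if k ∈ R then (-1 : ℝ) else 1) • mle (z.2 k)‖} := by
    ext z
    simp only [Set.mem_iUnion]
    rfl
  rw [h]
  refine MeasurableSet.iUnion fun T => (MeasurableSet.const _).inter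
    (measurableSet_le measurable_const (Measurable.norm ?_))
  exact Finset.measurable_fun_sum _ fun k _ =>
    Measurable.const_smul (measurable_mle_source k) (if k ∈ R then (-1 : ℝ) else 1)

theorem measurableSet_exceptional [IsProbabilityMeasure φ] : MeasurableSet
    {q : (Fin K → E d) × ((Fin N₀ → E d) × (Fin K → Fin N → E d)) |
      q.2 ∈ exceptional σ φ θ₀ R Δ ρ q.1} := by
  refine MeasurableSet.union ?_ (measurable_snd (measurableSet_noiseCluster _ _))
  have h : {q : (Fin K → E d) × ((Fin N₀ → E d) × (Fin K → Fin N → E d)) |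
      q.2 ∈ logLRDeviation σ φ θ₀ (Δ / 4) q.1}
      = ⋃ k, {q | N * (Δ / 4)
        ≤ |∑ i, (logLR σ φ θ₀ (q.1 k + q.2.2 k i) - expLogLR σ φ (q.1 k) θ₀)|} := by
    ext q
    simp only [Set.mem_iUnion]
    rfl
  change MeasurableSet {q : (Fin K → E d) × ((Fin N₀ → E d) × (Fin K → Fin N → E d)) |
      q.2 ∈ logLRDeviation σ φ θ₀ (Δ / 4) q.1}
  rw [h]
  refine MeasurableSet.iUnion fun k => measurableSet_le measurable_const (Measurable.abs ?_)
  refine Finset.measurable_fun_sum _ fun i _ => Measurable.sub ?_ ?_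
  · exact (measurable_logLR σ φ θ₀).comp (by fun_prop)
  · exact (measurable_expLogLR σ φ θ₀).comp (by fun_prop)

theorem measurable_norm_sq_source (k : Fin K) : Measurable
    fun q : (Fin K → E d) × ((Fin N₀ → E d) × (Fin K → Fin N → E d)) =>
      ‖q.1 k - θ₀ + mle (q.2.2 k)‖ ^ 2 := by
  have h : Measurable fun q : (Fin K → E d) × ((Fin N₀ → E d) × (Fin K → Fin N → E d)) =>
      mle (q.2.2 k) := measurable_mle.comp (by fun_prop)
  have h' : Measurable fun q : (Fin K → E d) × ((Fin N₀ → E d) × (Fin K → Fin N → E d)) =>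
      q.1 k - θ₀ := by fun_prop
  exact (h'.add h).norm.pow_const 2

theorem measurable_errorBound [IsProbabilityMeasure φ] : Measurable
    fun q : (Fin K → E d) × ((Fin N₀ → E d) × (Fin K → Fin N → E d)) =>
      errorBound σ φ θ₀ R Δ ρ r ω q.1 q.2 := by
  have h1 : Measurable fun q : (Fin K → E d) × ((Fin N₀ → E d) × (Fin K → Fin N → E d)) =>
      ‖oracleError R q.2‖ ^ 2 :=
    (measurable_oracleError.comp measurable_snd).norm.pow_const 2
  have h2 (k : Fin K) := measurable_norm_sq_source (d := d) (N₀ := N₀) (N := N) (θ₀ := θ₀) k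
  have h3 : Measurable fun q : (Fin K → E d) × ((Fin N₀ → E d) × (Fin K → Fin N → E d)) =>
      (exceptional σ φ θ₀ R Δ ρ q.1).indicator (1 : (Fin N₀ → E d) × (Fin K → Fin N → E d) → ℝ) q.2 :=
    (measurable_const (a := (1 : ℝ))).indicator measurableSet_exceptional
  have h4 (k : Fin K) : MeasurableSet
      {q : (Fin K → E d) × ((Fin N₀ → E d) × (Fin K → Fin N → E d)) |
        k ∉ R ∧ ‖q.1 k - θ₀‖ < r} :=
    (MeasurableSet.const _).inter (measurableSet_lt
      (f := fun q : (Fin K → E d) × ((Fin N₀ → E d) × (Fin K → Fin N → E d)) => ‖q.1 k - θ₀‖)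
      (by fun_prop) measurable_const)
  have h5 : Measurable fun q : (Fin K → E d) × ((Fin N₀ → E d) × (Fin K → Fin N → E d)) =>
      ∑ k with k ∉ R ∧ ‖q.1 k - θ₀‖ < r,
        (N : ℝ) / (N₀ + N * R.card + N) * ‖q.1 k - θ₀ + mle (q.2.2 k)‖ ^ 2 := by
    simp only [Finset.sum_filter]
    exact Finset.measurable_fun_sum _ fun k _ =>
      Measurable.ite (h4 k) ((h2 k).const_mul _) measurable_const
  have h6 : Measurable fun q : (Fin K → E d) × ((Fin N₀ → E d) × (Fin K → Fin N → E d)) =>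
      crudeError θ₀ R q.1 q.2 :=
    (h1.const_mul _).add ((Finset.measurable_fun_sum _ fun k _ => h2 k).const_mul _)
  exact (((h1.const_mul _).add (h5.const_mul _)).add measurable_const).add
    (((measurable_const.add (h3.const_mul _)).const_mul _).mul h6)

theorem errorBound_nonneg (t : Fin K → E d) (z : (Fin N₀ → E d) × (Fin K → Fin N → E d)) :
    0 ≤ errorBound σ φ θ₀ R Δ ρ r ω t z := by
  have h1 : 0 ≤ (exceptional σ φ θ₀ R Δ ρ t).indicator (1 : (Fin N₀ → E d) × (Fin K → Fin N → E d) → ℝ) z :=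
    Set.indicator_nonneg (fun _ _ => zero_le_one) _
  have h2 : 0 ≤ ∑ k with k ∉ R ∧ ‖t k - θ₀‖ < r,
      (N : ℝ) / (N₀ + N * R.card + N) * ‖t k - θ₀ + mle (z.2 k)‖ ^ 2 :=
    Finset.sum_nonneg fun k _ => mul_nonneg (by positivity) (sq_nonneg _)
  have h3 := crudeError_nonneg (θ₀ := θ₀) (R := R) t z
  unfold errorBound
  exact add_nonneg (add_nonneg (add_nonneg (by positivity) (mul_nonneg (by norm_num) h2))
    (by positivity)) (mul_nonneg (mul_nonneg (by positivity)
      (add_nonneg (by positivity) (mul_nonneg (by norm_num) h1))) h3)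

/-- The expectation over the noise of the crude error, without and with restriction to an event of
small probability. -/
theorem integral_crudeError_le (hN₀ : 0 < N₀) (hN : 0 < N) (hσ : 0 < σ) (hK : 0 < K)
    (t : Fin K → E d) (B : Set ((Fin N₀ → E d) × (Fin K → Fin N → E d))) (hp : 0 < p)
    (hB : (noiseLaw d K N₀ N σ).real B ≤ p) :
    Integrable (crudeError θ₀ R t) (noiseLaw d K N₀ N σ) ∧
    ∫ z, crudeError θ₀ R t z ∂(noiseLaw d K N₀ N σ)
      ≤ 4 * (K * ∑ k, (‖t k - θ₀‖ ^ 2 + d * σ ^ 2 / N)) ∧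
    ∫ z in B, crudeError θ₀ R t z ∂(noiseLaw d K N₀ N σ)
      ≤ 42 * √p * (K * ∑ k, (‖t k - θ₀‖ ^ 2 + d * σ ^ 2 / N)) := by
  set μ := noiseLaw d K N₀ N σ with hμ
  have hN' : (0 : ℝ) < N := by exact_mod_cast hN
  have hK1 : (1 : ℝ) ≤ K := by exact_mod_cast hK
  have hO := hasLaw_oracleError (d := d) hN₀ hN hσ R
  have hZ (k : Fin K) := hasLaw_mle_source (d := d) (N₀ := N₀) hN hσ k
  obtain ⟨hO1, hO2⟩ := integral_norm_sq_of_hasLaw hO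
  have hO3 := setIntegral_norm_sq_le_of_hasLaw hO B hp hB
  have hA1 (k : Fin K) := (integral_norm_const_add_sq_of_hasLaw (hZ k) (t k - θ₀)).1
  have hA2 (k : Fin K) := (integral_norm_const_add_sq_of_hasLaw (hZ k) (t k - θ₀)).2
  have hA3 (k : Fin K) := setIntegral_norm_const_add_sq_le_of_hasLaw (hZ k) (t k - θ₀) B hp hB
  have hs : (σ / √N) ^ 2 = σ ^ 2 / N := by rw [div_pow, Real.sq_sqrt hN'.le]
  have hsM : (σ / √(N₀ + N * R.card)) ^ 2 = σ ^ 2 / (N₀ + N * R.card) := by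
    rw [div_pow, Real.sq_sqrt (by positivity)]
  rw [hsM] at hO2 hO3
  simp only [hs] at hA2 hA3
  set D := ∑ k, (‖t k - θ₀‖ ^ 2 + d * σ ^ 2 / N) with hD
  -- Averaging over R gains a factor |R|, since |R|σ²/M ≤ σ²/N. The oracle part of the crude error
  -- is therefore no larger than the source part.
  have hv : (R.card : ℝ) ^ 2 * (d * (σ ^ 2 / (N₀ + N * R.card))) ≤ K * D := by
    have h1 : (R.card : ℝ) ≤ K := by
      have := Finset.card_le_univ R
      rw [Fintype.card_fin] at this
      exact_mod_cast this
    have h2 : (K : ℝ) * (d * σ ^ 2 / N) ≤ D := by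
      rw [hD, Finset.sum_add_distrib, Finset.sum_const, Finset.card_univ, Fintype.card_fin,
        nsmul_eq_mul]
      exact le_add_of_nonneg_left (Finset.sum_nonneg fun k _ => sq_nonneg _)
    have h3 : (R.card : ℝ) * (σ ^ 2 / (N₀ + N * R.card)) ≤ σ ^ 2 / N := by
      rw [mul_div_assoc', div_le_div_iff₀ (by positivity) hN']
      have : 0 ≤ σ ^ 2 * (N₀ : ℝ) := by positivity
      linarith
    calc (R.card : ℝ) ^ 2 * (d * (σ ^ 2 / (N₀ + N * R.card)))
        = R.card * d * (R.card * (σ ^ 2 / (N₀ + N * R.card))) := by ring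
      _ ≤ K * d * (σ ^ 2 / N) := by gcongr
      _ = K * (d * σ ^ 2 / N) := by ring
      _ ≤ D := h2
      _ ≤ K * D := le_mul_of_one_le_left (le_trans (by positivity) h2) hK1
  have hi1 : Integrable (fun z => 2 * (R.card : ℝ) ^ 2 * ‖oracleError R z‖ ^ 2) μ :=
    hO1.const_mul _
  have hi2 : Integrable (fun z : (Fin N₀ → E d) × (Fin K → Fin N → E d) =>
      2 * (K : ℝ) * ∑ k, ‖t k - θ₀ + mle (z.2 k)‖ ^ 2) μ :=
    (integrable_finsetSum _ fun k _ => hA1 k).const_mul _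
  refine ⟨hi1.add hi2, ?_, ?_⟩
  · unfold crudeError
    rw [integral_add hi1 hi2, integral_const_mul, integral_const_mul, hO2,
      integral_finsetSum _ fun k _ => hA1 k]
    have h1 : ∑ k, ∫ z, ‖t k - θ₀ + mle (z.2 k)‖ ^ 2 ∂μ = D := by
      rw [hD]
      refine Finset.sum_congr rfl fun k _ => ?_
      rw [hA2, mul_div_assoc]
    rw [h1]
    linarith
  · unfold crudeError
    rw [integral_add hi1.integrableOn hi2.integrableOn, integral_const_mul, integral_const_mul,
      integral_finsetSum _ fun k _ => (hA1 k).integrableOn]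
    have h1 : ∑ k, ∫ z in B, ‖t k - θ₀ + mle (z.2 k)‖ ^ 2 ∂μ ≤ 14 * √p * D := by
      refine (Finset.sum_le_sum fun k _ => hA3 k).trans (le_of_eq ?_)
      rw [hD, Finset.mul_sum]
      refine Finset.sum_congr rfl fun k _ => ?_
      ring
    have h2 := mul_le_mul_of_nonneg_left hO3 (show 0 ≤ 2 * (R.card : ℝ) ^ 2 by positivity)
    have h3 := mul_le_mul_of_nonneg_left h1 (show 0 ≤ 2 * (K : ℝ) by positivity)
    have h4 := mul_le_mul_of_nonneg_left hv (show 0 ≤ 14 * √p by positivity)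
    linarith

theorem integral_errorBound_le [IsProbabilityMeasure φ] (hN₀ : 0 < N₀) (hN : 0 < N) (hσ : 0 < σ)
    (hK : 0 < K) {t : Fin K → E d} (hp : 0 < p)
    (hB : (noiseLaw d K N₀ N σ).real (exceptional σ φ θ₀ R Δ ρ t) ≤ p) :
    ∫⁻ z, ENNReal.ofReal (errorBound σ φ θ₀ R Δ ρ r ω t z) ∂(noiseLaw d K N₀ N σ)
      ≤ ENNReal.ofReal (meanErrorBound σ θ₀ R N₀ N r ω p t) := by
  set μ := noiseLaw d K N₀ N σ with hμ
  have hN' : (0 : ℝ) < N := by exact_mod_cast hN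
  obtain ⟨hO1, hO2⟩ := integral_norm_sq_of_hasLaw (hasLaw_oracleError (d := d) hN₀ hN hσ R)
  have hA (k : Fin K) := integral_norm_const_add_sq_of_hasLaw
    (hasLaw_mle_source (d := d) (N₀ := N₀) hN hσ k) (t k - θ₀)
  have hs : (σ / √N) ^ 2 = σ ^ 2 / N := by rw [div_pow, Real.sq_sqrt hN'.le]
  have hsM : (σ / √(N₀ + N * R.card)) ^ 2 = σ ^ 2 / (N₀ + N * R.card) := by
    rw [div_pow, Real.sq_sqrt (by positivity)]
  simp only [hs] at hA
  rw [hsM] at hO2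
  obtain ⟨hc1, hc2, hc3⟩ := integral_crudeError_le (θ₀ := θ₀) (R := R) hN₀ hN hσ hK t _ hp hB
  have hEm : MeasurableSet (exceptional σ φ θ₀ R Δ ρ t :
      Set ((Fin N₀ → E d) × (Fin K → Fin N → E d))) :=
    measurable_prodMk_left measurableSet_exceptional
  have hsplit : (errorBound σ φ θ₀ R Δ ρ r ω t : (Fin N₀ → E d) × (Fin K → Fin N → E d) → ℝ)
      = fun z => 8 / 7 * ‖oracleError R z‖ ^ 2
        + 128 / 105 * ∑ k with k ∉ R ∧ ‖t k - θ₀‖ < r,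
            N / (N₀ + N * R.card + N) * ‖t k - θ₀ + mle (z.2 k)‖ ^ 2
        + d * σ ^ 2 / (N₀ + N * R.card) / 10
        + (N / N₀ : ℝ) ^ 2 * (2048 * ω ^ 2) * crudeError θ₀ R t z
        + (N / N₀ : ℝ) ^ 2 * 8
          * (exceptional σ φ θ₀ R Δ ρ t).indicator (crudeError θ₀ R t) z := by
    ext z
    have : (exceptional σ φ θ₀ R Δ ρ t).indicator (crudeError θ₀ R t) z
        = (exceptional σ φ θ₀ R Δ ρ t).indicator 1 z * crudeError θ₀ R t z := by
      by_cases hz : z ∈ exceptional σ φ θ₀ R Δ ρ t <;> simp [hz]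
    rw [errorBound, this]
    ring
  have i1 : Integrable (fun z => 8 / 7 * ‖oracleError R z‖ ^ 2) μ := hO1.const_mul _
  have i2 : Integrable (fun z : (Fin N₀ → E d) × (Fin K → Fin N → E d) =>
      128 / 105 * ∑ k with k ∉ R ∧ ‖t k - θ₀‖ < r,
        (N : ℝ) / (N₀ + N * R.card + N) * ‖t k - θ₀ + mle (z.2 k)‖ ^ 2) μ :=
    (integrable_finsetSum _ fun k _ => (hA k).1.const_mul _).const_mul _
  have i4 : Integrable (fun z => (N / N₀ : ℝ) ^ 2 * (2048 * ω ^ 2) * crudeError θ₀ R t z) μ :=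
    hc1.const_mul _
  have i5 : Integrable (fun z => (N / N₀ : ℝ) ^ 2 * 8
      * (exceptional σ φ θ₀ R Δ ρ t).indicator (crudeError θ₀ R t) z) μ :=
    (hc1.indicator hEm).const_mul _
  have i12 := i1.add i2
  have i123 := i12.add (integrable_const (μ := μ) (d * σ ^ 2 / (N₀ + N * R.card) / 10))
  have i1234 := i123.add i4
  have hint : Integrable (errorBound σ φ θ₀ R Δ ρ r ω t) μ := by
    rw [hsplit]
    exact i1234.add i5
  rw [← ofReal_integral_eq_lintegral_ofReal hint (ae_of_all _ fun z => errorBound_nonneg t z)]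
  refine ENNReal.ofReal_le_ofReal ?_
  have heq : ∫ z, errorBound σ φ θ₀ R Δ ρ r ω t z ∂μ
      = 8 / 7 * (d * (σ ^ 2 / (N₀ + N * R.card)))
        + 128 / 105 * ∑ k with k ∉ R ∧ ‖t k - θ₀‖ < r,
            N / (N₀ + N * R.card + N) * (‖t k - θ₀‖ ^ 2 + d * (σ ^ 2 / N))
        + d * σ ^ 2 / (N₀ + N * R.card) / 10
        + (N / N₀ : ℝ) ^ 2 * (2048 * ω ^ 2) * ∫ z, crudeError θ₀ R t z ∂μ
        + (N / N₀ : ℝ) ^ 2 * 8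
          * ∫ z in exceptional σ φ θ₀ R Δ ρ t, crudeError θ₀ R t z ∂μ := by
    rw [hsplit, integral_add (by exact i1234) i5, integral_add (by exact i123) i4,
      integral_add (by exact i12) (integrable_const _), integral_add i1 i2, integral_const_mul,
      integral_const_mul, integral_const_mul, integral_const_mul, integral_indicator hEm, hO2,
      integral_finsetSum _ fun k _ => (hA k).1.const_mul _]
    simp only [integral_const_mul, (hA _).2]
    simp
  rw [heq, meanErrorBound]
  have h1 := mul_le_mul_of_nonneg_left hc2
    (show 0 ≤ (N / N₀ : ℝ) ^ 2 * (2048 * ω ^ 2) by positivity)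
  have h2 := mul_le_mul_of_nonneg_left hc3 (show 0 ≤ (N / N₀ : ℝ) ^ 2 * 8 by positivity)
  simp only [mul_div_assoc] at h1 h2 ⊢
  linarith

end Expectation

/-! ### Expectation over the parameters, and the final constants. -/

section Average

variable {d K N₀ N : ℕ} {σ β : ℝ} {φ : Measure (E d)} {θ₀ : E d}
  {R : Finset (Fin K)} {U : Set (E d)} {V L : ℝ≥0} {Δ r ρ ω p α : ℝ}

/-- The deviation exponent is NΔ²/(32V²). The cluster exponent is NΔ²σ²/(128ρ²), which ρ ≤ 2Vσ turns
into at least NΔ²/(512V²), the smaller of the two. -/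
theorem measureReal_exceptional_le [IsProbabilityMeasure φ] (hd : 0 < d) (hK : 0 < K)
    (hN : 0 < N) (hσ : 0 < σ)
    (hΔ : 0 < Δ) (hρ : 0 < ρ) (hV : 0 < V) (hρV : ρ ≤ 2 * V * σ) (h0 : θ₀ ∈ U) {t : Fin K → E d}
    (hreg : ∀ k, RegularAt σ φ U V L (t k)) :
    (noiseLaw d K N₀ N σ).real (exceptional σ φ θ₀ R Δ ρ t)
      ≤ 5 * K * Real.exp (-(N * Δ ^ 2 / (512 * V ^ 2))) := by
  have hN' : (0 : ℝ) < N := by exact_mod_cast hN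
  have hd' : (0 : ℝ) < d := by exact_mod_cast hd
  have hV' : (0 : ℝ) < V := by exact_mod_cast hV
  have hτ : 0 < σ ^ 2 * Δ / (4 * ρ) := by positivity
  have hx : 0 < N * (σ ^ 2 * Δ / (4 * ρ)) ^ 2 / σ ^ 2 := by positivity
  have h1 := measureReal_logLRDeviation_le (N₀ := N₀) (N := N) h0 hreg
    (show 0 ≤ Δ / 4 by positivity)
  have h2 := measureReal_noiseCluster_le (d := d) (N₀ := N₀) hK hN hσ R
    (m := ⌈8 * d / (N * (σ ^ 2 * Δ / (4 * ρ)) ^ 2 / σ ^ 2)⌉₊) (Nat.ceil_pos.2 (by positivity)) hτ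
    ((div_le_iff₀ hx).1 (Nat.le_ceil _))
  have h3 : N * Δ ^ 2 / (512 * (V : ℝ) ^ 2) ≤ N * (Δ / 4) ^ 2 / (2 * V ^ 2) := by
    rw [div_le_div_iff₀ (by positivity) (by positivity)]
    have : 0 ≤ N * Δ ^ 2 * (V : ℝ) ^ 2 := by positivity
    linarith
  have h4 : N * Δ ^ 2 / (512 * (V : ℝ) ^ 2)
      ≤ N * (σ ^ 2 * Δ / (4 * ρ)) ^ 2 / (8 * σ ^ 2) := by
    have h5 : N * (σ ^ 2 * Δ / (4 * ρ)) ^ 2 / (8 * σ ^ 2) = N * Δ ^ 2 * σ ^ 2 / (128 * ρ ^ 2) := by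
      field_simp
      ring
    have h6 : ρ ^ 2 ≤ (2 * V * σ) ^ 2 := by gcongr
    rw [h5, div_le_div_iff₀ (by positivity) (by positivity)]
    have h7 := mul_le_mul_of_nonneg_left h6 (show 0 ≤ 128 * (N * Δ ^ 2) by positivity)
    linarith
  have h8 := Real.exp_le_exp.2 (neg_le_neg h3)
  have h9 := Real.exp_le_exp.2 (neg_le_neg h4)
  have h10 := mul_le_mul_of_nonneg_left h8 (show 0 ≤ 2 * (K : ℝ) by positivity)
  have h11 := mul_le_mul_of_nonneg_left h9 (show 0 ≤ 3 * (K : ℝ) by positivity)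
  have h12 := measureReal_union_le (μ := noiseLaw d K N₀ N σ) (logLRDeviation σ φ θ₀ (Δ / 4) t)
    (noiseCluster R ⌈8 * d / (N * (σ ^ 2 * Δ / (4 * ρ)) ^ 2 / σ ^ 2)⌉₊ (σ ^ 2 * Δ / (4 * ρ)))
  refine h12.trans ?_
  linarith

theorem integral_norm_sq_priorLaw_le (hD : Integrable (fun t => ‖t - θ₀‖ ^ 2) φ) (k : Fin K) :
    Integrable (fun t => ‖t - θ₀‖ ^ 2) (priorLaw θ₀ φ R k) ∧
      ∫ t, ‖t - θ₀‖ ^ 2 ∂(priorLaw θ₀ φ R k) ≤ ∫ t, ‖t - θ₀‖ ^ 2 ∂φ := by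
  by_cases hk : k ∈ R
  · rw [priorLaw, if_pos hk]
    refine ⟨(integrable_dirac (by simp)), ?_⟩
    rw [integral_dirac]
    simpa using integral_nonneg fun t => sq_nonneg ‖t - θ₀‖
  · rw [priorLaw, if_neg hk]
    exact ⟨hD, le_rfl⟩

theorem integral_indicator_priorLaw_le [IsProbabilityMeasure φ] (hα : 0 ≤ α)
    (hsep : φ.real {t | ‖t - θ₀‖ < r} ≤ α) (k : Fin K) :
    Integrable ({t : E d | k ∉ R ∧ ‖t - θ₀‖ < r}.indicator (1 : E d → ℝ)) (priorLaw θ₀ φ R k) ∧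
      ∫ t, {t : E d | k ∉ R ∧ ‖t - θ₀‖ < r}.indicator (1 : E d → ℝ) t ∂(priorLaw θ₀ φ R k)
        ≤ α := by
  have hm : MeasurableSet {t : E d | k ∉ R ∧ ‖t - θ₀‖ < r} :=
    (MeasurableSet.const _).inter
      (measurableSet_lt (f := fun t : E d => ‖t - θ₀‖) (by fun_prop) measurable_const)
  refine ⟨(integrable_const (1 : ℝ)).indicator hm, ?_⟩
  rw [integral_indicator_one hm]
  by_cases hk : k ∈ R
  · simpa [hk] using hα
  · simpa [hk, priorLaw] using hsep

/-- Pointwise bound of the average of `errorBound` over the noise. -/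
theorem meanErrorBound_le (hN₀ : 0 < N₀) (hN : 0 < N) (t : Fin K → E d) :
    meanErrorBound σ θ₀ R N₀ N r ω p t
      ≤ 8 / 7 * (d * σ ^ 2 / (N₀ + N * R.card))
        + 128 / 105 * ((r ^ 2 + d * σ ^ 2 / (N₀ + N * R.card))
          * ∑ k, {x : E d | k ∉ R ∧ ‖x - θ₀‖ < r}.indicator (1 : E d → ℝ) (t k))
        + d * σ ^ 2 / (N₀ + N * R.card) / 10
        + (N / N₀) ^ 2 * (8192 * ω ^ 2 + 336 * √p)
          * (K * ∑ k, (‖t k - θ₀‖ ^ 2 + d * σ ^ 2 / N)) := by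
  have hN₀' : (0 : ℝ) < N₀ := by exact_mod_cast hN₀
  have hN' : (0 : ℝ) < N := by exact_mod_cast hN
  have hM : (0 : ℝ) < N₀ + N * R.card := by positivity
  have h : ∑ k with k ∉ R ∧ ‖t k - θ₀‖ < r,
        (N : ℝ) / (N₀ + N * R.card + N) * (‖t k - θ₀‖ ^ 2 + d * σ ^ 2 / N)
      ≤ (r ^ 2 + d * σ ^ 2 / (N₀ + N * R.card))
          * ∑ k, {x : E d | k ∉ R ∧ ‖x - θ₀‖ < r}.indicator (1 : E d → ℝ) (t k) := by
    rw [Finset.sum_filter, Finset.mul_sum]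
    refine Finset.sum_le_sum fun k _ => ?_
    by_cases hk : k ∉ R ∧ ‖t k - θ₀‖ < r
    · rw [if_pos hk, Set.indicator_of_mem (by exact hk), Pi.one_apply, mul_one, mul_add]
      refine add_le_add ?_ ?_
      · have h1 : (N : ℝ) / (N₀ + N * R.card + N) ≤ 1 := by
          rw [div_le_one (by positivity)]
          linarith
        have h2 : ‖t k - θ₀‖ ^ 2 ≤ r ^ 2 := pow_le_pow_left₀ (norm_nonneg _) hk.2.le 2
        calc (N : ℝ) / (N₀ + N * R.card + N) * ‖t k - θ₀‖ ^ 2 ≤ 1 * ‖t k - θ₀‖ ^ 2 := by gcongr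
          _ ≤ r ^ 2 := by rwa [one_mul]
      · have h3 : (N : ℝ) / (N₀ + N * R.card + N) * (d * σ ^ 2 / N)
            = d * σ ^ 2 / (N₀ + N * R.card + N) := by
          field_simp
        rw [h3]
        exact div_le_div_of_nonneg_left (by positivity) hM (by linarith)
    · rw [if_neg hk, Set.indicator_of_notMem (by exact hk), mul_zero]
  have := mul_le_mul_of_nonneg_left h (show (0 : ℝ) ≤ 128 / 105 by norm_num)
  unfold meanErrorBound
  linarith

theorem lintegral_meanErrorBound_le [IsProbabilityMeasure φ] (hN₀ : 0 < N₀) (hN : 0 < N)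
    (hα : 0 ≤ α) (hD : Integrable (fun t => ‖t - θ₀‖ ^ 2) φ)
    (hsep : φ.real {t | ‖t - θ₀‖ < r} ≤ α) (hKα : K * α ≤ 1 / 2) :
    ∫⁻ t, ENNReal.ofReal (meanErrorBound σ θ₀ R N₀ N r ω p t)
        ∂(Measure.pi fun k => priorLaw θ₀ φ R k)
      ≤ ENNReal.ofReal (2 * (d * σ ^ 2 / (N₀ + N * R.card)) + 3 * K * α * r ^ 2
        + (N / N₀) ^ 2 * (8192 * ω ^ 2 + 336 * √p)
          * (K ^ 2 * ((∫ t, ‖t - θ₀‖ ^ 2 ∂φ) + d * σ ^ 2 / N))) := by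
  have hN₀' : (0 : ℝ) < N₀ := by exact_mod_cast hN₀
  have hM : (0 : ℝ) < N₀ + N * R.card := by positivity
  set μ := Measure.pi fun k => priorLaw θ₀ φ R k with hμ
  have hI (k : Fin K) := integral_indicator_priorLaw_le (R := R) hα hsep k
  have hQ (k : Fin K) := integral_norm_sq_priorLaw_le (R := R) hD k
  have hI1 (k : Fin K) : Integrable (fun t : Fin K → E d =>
      {x : E d | k ∉ R ∧ ‖x - θ₀‖ < r}.indicator (1 : E d → ℝ) (t k)) μ :=
    integrable_comp_eval (μ := fun k => priorLaw θ₀ φ R k)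
      (f := {x : E d | k ∉ R ∧ ‖x - θ₀‖ < r}.indicator (1 : E d → ℝ)) (hI k).1
  have hQ1 (k : Fin K) : Integrable (fun t : Fin K → E d => ‖t k - θ₀‖ ^ 2) μ :=
    integrable_comp_eval (μ := fun k => priorLaw θ₀ φ R k) (f := fun x : E d => ‖x - θ₀‖ ^ 2)
      (hQ k).1
  have hI2 (k : Fin K) : ∫ t : Fin K → E d,
      {x : E d | k ∉ R ∧ ‖x - θ₀‖ < r}.indicator (1 : E d → ℝ) (t k) ∂μ ≤ α := by
    rw [hμ, integral_comp_eval (μ := fun k => priorLaw θ₀ φ R k)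
      (f := {x : E d | k ∉ R ∧ ‖x - θ₀‖ < r}.indicator (1 : E d → ℝ)) (hI k).1.1]
    exact (hI k).2
  have hQ2 (k : Fin K) :
      ∫ t : Fin K → E d, ‖t k - θ₀‖ ^ 2 ∂μ ≤ ∫ t, ‖t - θ₀‖ ^ 2 ∂φ := by
    rw [hμ, integral_comp_eval (μ := fun k => priorLaw θ₀ φ R k)
      (f := fun x : E d => ‖x - θ₀‖ ^ 2) (hQ k).1.1]
    exact (hQ k).2
  set v := d * σ ^ 2 / (N₀ + N * R.card) with hv
  have hv0 : 0 ≤ v := by positivity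
  set s := d * σ ^ 2 / N with hs
  set c := (N / N₀ : ℝ) ^ 2 * (8192 * ω ^ 2 + 336 * √p) with hc
  have hc0 : 0 ≤ c := mul_nonneg (sq_nonneg _) (by positivity)
  have i1 : Integrable (fun _ : Fin K → E d => 8 / 7 * v) μ := integrable_const _
  have i2 : Integrable (fun t : Fin K → E d => 128 / 105 * ((r ^ 2 + v)
      * ∑ k, {x : E d | k ∉ R ∧ ‖x - θ₀‖ < r}.indicator (1 : E d → ℝ) (t k))) μ :=
    ((integrable_finsetSum _ fun k _ => hI1 k).const_mul _).const_mul _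
  have i3 : Integrable (fun _ : Fin K → E d => v / 10) μ := integrable_const _
  have hQ3 (k : Fin K) : Integrable (fun t : Fin K → E d => ‖t k - θ₀‖ ^ 2 + s) μ :=
    (hQ1 k).add (integrable_const s)
  have i4 : Integrable (fun t : Fin K → E d => c * (K * ∑ k, (‖t k - θ₀‖ ^ 2 + s))) μ :=
    ((integrable_finsetSum _ fun k _ => hQ3 k).const_mul _).const_mul _
  have i12 := i1.add i2
  have i123 := i12.add i3
  have i1234 := i123.add i4
  have hle := fun t : Fin K → E d =>
    meanErrorBound_le (σ := σ) (θ₀ := θ₀) (R := R) (r := r) (ω := ω) (p := p) hN₀ hN t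
  refine (lintegral_mono fun t => ENNReal.ofReal_le_ofReal (hle t)).trans ?_
  rw [← ofReal_integral_eq_lintegral_ofReal (by exact i1234) ?_]
  · refine ENNReal.ofReal_le_ofReal ?_
    rw [integral_add (by exact i123) i4, integral_add (by exact i12) i3, integral_add i1 i2]
    simp only [integral_const_mul]
    rw [integral_finsetSum _ fun k _ => hI1 k,
      integral_finsetSum _ fun k _ => hQ3 k]
    simp only [integral_const, probReal_univ, one_smul]
    have h1 : ∑ k, ∫ t : Fin K → E d,
        {x : E d | k ∉ R ∧ ‖x - θ₀‖ < r}.indicator (1 : E d → ℝ) (t k) ∂μ ≤ K * α := by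
      refine (Finset.sum_le_sum fun k _ => hI2 k).trans (le_of_eq ?_)
      simp
    have h2 : ∑ k, ∫ t : Fin K → E d, (‖t k - θ₀‖ ^ 2 + s) ∂μ
        ≤ K * ((∫ t, ‖t - θ₀‖ ^ 2 ∂φ) + s) := by
      have h3 (k : Fin K) : ∫ t : Fin K → E d, (‖t k - θ₀‖ ^ 2 + s) ∂μ
          ≤ (∫ t, ‖t - θ₀‖ ^ 2 ∂φ) + s := by
        rw [integral_add (hQ1 k) (integrable_const s)]
        simpa using hQ2 k
      refine (Finset.sum_le_sum fun k _ => h3 k).trans (le_of_eq ?_)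
      rw [Finset.sum_const, Finset.card_univ, Fintype.card_fin, nsmul_eq_mul]
    have h4 := mul_le_mul_of_nonneg_left h1 (show 0 ≤ r ^ 2 + v by positivity)
    have h5 := mul_le_mul_of_nonneg_left h2 (show 0 ≤ c * K by positivity)
    have h6 := mul_le_mul_of_nonneg_right hKα hv0
    have h7 : 0 ≤ K * α * r ^ 2 := by positivity
    -- As Kα ≤ 1/2, the coefficient of v is at most 8/7 + 64/105 + 1/10 < 2, and that of Kαr² is
    -- 128/105 < 3.
    linarith
  · refine ae_of_all _ fun t => ?_
    have h1 : 0 ≤ ∑ k, {x : E d | k ∉ R ∧ ‖x - θ₀‖ < r}.indicator (1 : E d → ℝ) (t k) :=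
      Finset.sum_nonneg fun k _ => Set.indicator_nonneg (fun _ _ => zero_le_one) _
    have h2 : 0 ≤ ∑ k, (‖t k - θ₀‖ ^ 2 + s) := Finset.sum_nonneg fun k _ => by positivity
    change 0 ≤ 8 / 7 * v + 128 / 105 * ((r ^ 2 + v) * _) + v / 10 + c * (K * _)
    positivity

/-- The bound of the mean squared error in its final form. -/
theorem mean_error_le_final (hK : 0 < K) {D v B : ℝ} (hD : 0 ≤ D) :
    2 * v + 3 * K * α * r ^ 2 + ((N : ℝ) / N₀) ^ 2
        * (8192 * Real.exp (B - β * (N * Δ / 4)) ^ 2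
          + 336 * √(5 * K * Real.exp (-(N * Δ ^ 2 / (512 * V ^ 2))))) * (K ^ 2 * D)
      ≤ 2 * v + 3 * K * α * r ^ 2
        + 10000 * ((K : ℝ) ^ 2 * (N / N₀) ^ 2 * D * Real.exp (2 * B))
          * Real.exp (-(1 / 2) * β * N * Δ)
        + 10000 * ((K : ℝ) ^ (5 / 2 : ℝ) * (N / N₀) ^ 2 * D)
          * Real.exp (-(1 / 1024) * N * Δ ^ 2 / V ^ 2) := by
  have hK' : (0 : ℝ) < K := by exact_mod_cast hK
  have h1 : Real.exp (B - β * (N * Δ / 4)) ^ 2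
      = Real.exp (2 * B) * Real.exp (-(1 / 2) * β * N * Δ) := by
    rw [← Real.exp_add, ← Real.exp_nat_mul]
    congr 1
    push_cast
    ring
  have h2 : Real.exp (-(N * Δ ^ 2 / (512 * (V : ℝ) ^ 2)))
      = Real.exp (-(1 / 1024) * N * Δ ^ 2 / V ^ 2) ^ 2 := by
    rw [← Real.exp_nat_mul]
    congr 1
    push_cast
    ring
  -- The square root from Cauchy–Schwarz halves the exponent to 1/1024 and contributes the √K that
  -- makes K^(5/2).
  have h3 : √(5 * K * Real.exp (-(N * Δ ^ 2 / (512 * (V : ℝ) ^ 2))))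
      ≤ 3 * √K * Real.exp (-(1 / 1024) * N * Δ ^ 2 / V ^ 2) := by
    refine Real.sqrt_le_iff.2 ⟨by positivity, ?_⟩
    rw [h2, mul_pow, mul_pow, Real.sq_sqrt hK'.le]
    gcongr
    norm_num
  have h4 : (K : ℝ) ^ (5 / 2 : ℝ) = K ^ 2 * √K := by
    rw [Real.sqrt_eq_rpow, ← Real.rpow_natCast, ← Real.rpow_add hK']
    norm_num
  set e := Real.exp (-(1 / 1024) * N * Δ ^ 2 / (V : ℝ) ^ 2)
  set P := ((N : ℝ) / N₀) ^ 2 * (K ^ 2 * D) with hP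
  have hP0 : 0 ≤ P := by positivity
  have h5 := mul_le_mul_of_nonneg_right h3 hP0
  have h6 : 0 ≤ P * (Real.exp (2 * B) * Real.exp (-(1 / 2) * β * N * Δ)) := by positivity
  have h7 : 0 ≤ P * (√K * e) := by positivity
  rw [h1, h4]
  have h8 : ((N : ℝ) / N₀) ^ 2 * (8192 * (Real.exp (2 * B) * Real.exp (-(1 / 2) * β * N * Δ))
      + 336 * √(5 * K * Real.exp (-(N * Δ ^ 2 / (512 * (V : ℝ) ^ 2))))) * (K ^ 2 * D)
      = 8192 * (P * (Real.exp (2 * B) * Real.exp (-(1 / 2) * β * N * Δ)))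
        + 336 * (√(5 * K * Real.exp (-(N * Δ ^ 2 / (512 * (V : ℝ) ^ 2)))) * P) := by
    rw [hP]
    ring
  have h9 : 10000 * ((K : ℝ) ^ 2 * (N / N₀) ^ 2 * D * Real.exp (2 * B))
        * Real.exp (-(1 / 2) * β * N * Δ)
      = 10000 * (P * (Real.exp (2 * B) * Real.exp (-(1 / 2) * β * N * Δ))) := by
    rw [hP]
    ring
  have h10 : 10000 * ((K : ℝ) ^ 2 * √K * (N / N₀) ^ 2 * D) * e = 10000 * (P * (√K * e)) := by
    rw [hP]
    ring
  rw [h8, h9, h10]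
  linarith

end Average

/-! ### From the pointwise bound to the truncated second moment. -/

section FixedPoint

variable {d K N₀ N : ℕ} {σ β : ℝ} {φ : Measure (E d)} {θ₀ : E d}
  {R : Finset (Fin K)} {U : Set (E d)} {V L : ℝ≥0} {Δ r ρ α B : ℝ} {prob : Fin K → ℝ}
  {Ω : Type*} {mΩ : MeasurableSpace Ω} {P : Measure Ω}
  {ϑ : Fin K → Ω → E d} {x₀ : Fin N₀ → Ω → E d} {x : Fin K → Fin N → Ω → E d} {G : Set Ω}
  {θinf : Ω → E d}

theorem integrableOn_and_setIntegral_le {f : Ω → ℝ} (hf : Measurable f) (hf0 : ∀ ω, 0 ≤ f ω)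
    {c : ℝ} (hc : 0 ≤ c) (h : ∫⁻ ω in G, ENNReal.ofReal (f ω) ∂P ≤ ENNReal.ofReal c) :
    IntegrableOn f G P ∧ ∫ ω in G, f ω ∂P ≤ c := by
  refine ⟨⟨hf.aestronglyMeasurable, ?_⟩, ?_⟩
  · rw [hasFiniteIntegral_iff_ofReal (ae_of_all _ hf0)]
    exact h.trans_lt ENNReal.ofReal_lt_top
  · rw [integral_eq_lintegral_of_nonneg_ae (ae_of_all _ hf0) hf.aestronglyMeasurable]
    exact ENNReal.toReal_le_of_le_ofReal hc h

theorem ae_params [IsProbabilityMeasure φ] (hreg : Regular σ θ₀ φ R U V L)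
    (hmargin : HasMargin σ θ₀ φ R r Δ)
    (hsep : φ.real {t | ‖t - θ₀‖ < r} ≤ α) (hα : K * α ≤ 1 / 2) :
    ∀ᵐ t ∂(Measure.pi fun k => priorLaw θ₀ φ R k), (∀ k, RegularAt σ φ U V L (t k)) ∧
      (∀ k ∈ R, t k = θ₀) ∧ ∀ k, (k ∈ R → Δ ≤ expLogLR σ φ (t k) θ₀) ∧
        (k ∉ R → r ≤ ‖t k - θ₀‖ → expLogLR σ φ (t k) θ₀ ≤ -Δ) := by
  have h1 : ∀ k, ∀ᵐ t ∂(Measure.pi fun k => priorLaw θ₀ φ R k), RegularAt σ φ U V L (t k) :=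
    fun k => (Measure.quasiMeasurePreserving_eval (μ := fun k => priorLaw θ₀ φ R k) k).ae
      ((hreg k).mono fun t ht => ⟨ht.1, ht.2⟩)
  have h2 : ∀ k, ∀ᵐ t ∂(Measure.pi fun k => priorLaw θ₀ φ R k), k ∈ R → t k = θ₀ := by
    intro k
    refine (Measure.quasiMeasurePreserving_eval (μ := fun k => priorLaw θ₀ φ R k) k).ae
      (p := fun t => k ∈ R → t = θ₀) ?_
    by_cases hk : k ∈ R
    · rw [priorLaw, if_pos hk, ae_dirac_eq]
      simp
    · exact ae_of_all _ fun t h => absurd h hk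
  have h3 : ∀ k, ∀ᵐ t ∂(Measure.pi fun k => priorLaw θ₀ φ R k),
      (k ∈ R → Δ ≤ expLogLR σ φ (t k) θ₀) ∧
        (k ∉ R → r ≤ ‖t k - θ₀‖ → expLogLR σ φ (t k) θ₀ ≤ -Δ) := fun k =>
    (Measure.quasiMeasurePreserving_eval (μ := fun k => priorLaw θ₀ φ R k) k).ae
      (hmargin.source hsep hα k)
  filter_upwards [ae_all_iff.2 h1, ae_all_iff.2 h2, ae_all_iff.2 h3] with t ht1 ht2 ht3
  exact ⟨ht1, ht2, ht3⟩

/-- The truncated second moment of the error of a fixed point in the basin, when there is at least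
one source and the oracle error is small compared to the basin. -/
theorem lintegral_fixedPoint_le [IsProbabilityMeasure φ] (hd : 0 < d) (hK : 0 < K)
    (hN₀ : 0 < N₀) (hN : 0 < N) (hσ : 0 < σ) (hβ : 0 < β)
    (hD : Integrable (fun t => ‖t - θ₀‖ ^ 2) φ) (hV : 0 < V)
    (hΔ : 0 < Δ) (hρ : 0 < ρ) (hLρ : L * ρ = Δ / 10000)
    (hv : 2 * (d * σ ^ 2 / (N₀ + N * R.card)) ≤ ρ ^ 2)
    (hU : Metric.closedBall θ₀ ρ ⊆ U) (hreg : Regular σ θ₀ φ R U V L)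
    (hα : 0 ≤ α) (hsep : φ.real {t | ‖t - θ₀‖ < r} ≤ α) (hKα : K * α ≤ 1 / 2)
    (hmargin : HasMargin σ θ₀ φ R r Δ)
    (hlaw : HasLaw (fun ω => (fun i => x₀ i ω, fun k => (ϑ k ω, fun i => x k i ω)))
      (jointLaw N₀ N σ θ₀ φ R) P)
    (hB : ∀ k, |logOdds (prob k)| ≤ B) (hG : MeasurableSet G)
    (hfix : ∀ ω ∈ G, emStep σ β φ prob (fun i => x₀ i ω) (fun k i => x k i ω) (θinf ω) = θinf ω)
    (hball : ∀ ω ∈ G, ‖θinf ω - θ₀‖ ≤ ρ) :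
    ∫⁻ ω in G, ENNReal.ofReal (‖θinf ω - θ₀‖ ^ 2) ∂P
      ≤ ENNReal.ofReal (2 * (d * σ ^ 2 / (N₀ + N * R.card)) + 3 * K * α * r ^ 2
        + 10000 * ((K : ℝ) ^ 2 * (N / N₀) ^ 2 * ((∫ t, ‖t - θ₀‖ ^ 2 ∂φ) + d * σ ^ 2 / N)
            * Real.exp (2 * B)) * Real.exp (-(1 / 2) * β * N * Δ)
        + 10000 * ((K : ℝ) ^ (5 / 2 : ℝ) * (N / N₀) ^ 2
            * ((∫ t, ‖t - θ₀‖ ^ 2 ∂φ) + d * σ ^ 2 / N))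
          * Real.exp (-(1 / 1024) * N * Δ ^ 2 / V ^ 2)) := by
  have hdata := hasLaw_params_noise hlaw
  have hae := ae_params hreg hmargin hsep hKα
  set p := 5 * K * Real.exp (-(N * Δ ^ 2 / (512 * (V : ℝ) ^ 2))) with hp
  have hp0 : 0 < p := by
    have : (0 : ℝ) < K := by exact_mod_cast hK
    positivity
  have h0 : θ₀ ∈ U := hU (Metric.mem_closedBall_self hρ.le)
  set eb : (Fin K → E d) → (Fin N₀ → E d) × (Fin K → Fin N → E d) → ℝ :=
    errorBound σ φ θ₀ R Δ ρ r (Real.exp (B - β * (N * Δ / 4))) with heb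
  have hae' : ∀ᵐ ω ∂P, (∀ k, RegularAt σ φ U V L (ϑ k ω)) ∧
      (∀ k ∈ R, ϑ k ω = θ₀) ∧ ∀ k, (k ∈ R → Δ ≤ expLogLR σ φ (ϑ k ω) θ₀) ∧
        (k ∉ R → r ≤ ‖ϑ k ω - θ₀‖ → expLogLR σ φ (ϑ k ω) θ₀ ≤ -Δ) := by
    have h1 := (Measure.quasiMeasurePreserving_fst (μ := Measure.pi fun k => priorLaw θ₀ φ R k)
      (ν := noiseLaw d K N₀ N σ)).ae hae
    rw [← hdata.map_eq] at h1
    exact ae_of_ae_map hdata.aemeasurable h1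
  calc ∫⁻ ω in G, ENNReal.ofReal (‖θinf ω - θ₀‖ ^ 2) ∂P
      ≤ ∫⁻ ω in G, ENNReal.ofReal
          (eb (fun k => ϑ k ω) (fun i => x₀ i ω - θ₀, fun k i => x k i ω - ϑ k ω)) ∂P := by
        refine setLIntegral_mono_ae' hG ?_
        filter_upwards [hae'] with ω hω hωG
        refine ENNReal.ofReal_le_ofReal ?_
        obtain ⟨k⟩ : Nonempty (Fin K) := Fin.pos_iff_nonempty.1 hK
        exact fixedPoint_norm_sq_le hd hN₀ hN hσ hβ hΔ hρ hLρ
          ((hω.1 k).radius_le_lipschitz hσ hd hρ hU) hv hU hω.1 hω.2.1 hω.2.2 hB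
          (by simpa only [add_sub_cancel] using hfix ω hωG) (hball ω hωG)
    _ ≤ ∫⁻ ω, ENNReal.ofReal
          (eb (fun k => ϑ k ω) (fun i => x₀ i ω - θ₀, fun k i => x k i ω - ϑ k ω)) ∂P :=
        setLIntegral_le_lintegral _ _
    _ = ∫⁻ q, ENNReal.ofReal (eb q.1 q.2)
          ∂((Measure.pi fun k => priorLaw θ₀ φ R k).prod (noiseLaw d K N₀ N σ)) := by
        rw [← hdata.map_eq]
        exact (lintegral_map' measurable_errorBound.ennreal_ofReal.aemeasurable
          hdata.aemeasurable).symm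
    -- The noise is independent of the parameters, so the exceptional event can be estimated for
    -- each fixed t, uniformly over regular configurations.
    _ = ∫⁻ t, ∫⁻ z, ENNReal.ofReal (eb t z) ∂(noiseLaw d K N₀ N σ)
          ∂(Measure.pi fun k => priorLaw θ₀ φ R k) :=
        lintegral_prod _ measurable_errorBound.ennreal_ofReal.aemeasurable
    _ ≤ ∫⁻ t, ENNReal.ofReal (meanErrorBound σ θ₀ R N₀ N r
          (Real.exp (B - β * (N * Δ / 4))) p t) ∂(Measure.pi fun k => priorLaw θ₀ φ R k) := by
        refine lintegral_mono_ae ?_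
        filter_upwards [hae] with t ht
        obtain ⟨k⟩ : Nonempty (Fin K) := Fin.pos_iff_nonempty.1 hK
        exact integral_errorBound_le hN₀ hN hσ hK hp0
          (measureReal_exceptional_le hd hK hN hσ hΔ hρ hV
            ((ht.1 k).radius_le_subgaussian hσ hd hρ hU) h0 ht.1)
    _ ≤ _ := (lintegral_meanErrorBound_le hN₀ hN hα hD hsep hKα).trans
        (ENNReal.ofReal_le_ofReal (mean_error_le_final hK
          (add_nonneg (integral_nonneg fun t => sq_nonneg _) (by positivity))))

/-- Without sources, a fixed point of the EM iteration is the target estimate. -/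
theorem lintegral_fixedPoint_le_of_eq_zero [IsProbabilityMeasure φ] (hK : K = 0)
    (hN₀ : 0 < N₀) (hN : 0 < N) (hσ : 0 < σ)
    (hlaw : HasLaw (fun ω => (fun i => x₀ i ω, fun k => (ϑ k ω, fun i => x k i ω)))
      (jointLaw N₀ N σ θ₀ φ R) P) (hG : MeasurableSet G)
    (hfix : ∀ ω ∈ G,
      emStep σ β φ prob (fun i => x₀ i ω) (fun k i => x k i ω) (θinf ω) = θinf ω) :
    ∫⁻ ω in G, ENNReal.ofReal (‖θinf ω - θ₀‖ ^ 2) ∂P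
      ≤ ENNReal.ofReal (d * σ ^ 2 / (N₀ + N * R.card)) := by
  subst hK
  have hnoise : HasLaw (fun ω => (fun i => x₀ i ω - θ₀, fun k i => x k i ω - ϑ k ω))
      (noiseLaw d 0 N₀ N σ) P :=
    measurePreserving_snd.comp_hasLaw (hasLaw_params_noise hlaw)
  obtain ⟨h1, h2⟩ := integral_norm_sq_of_hasLaw (hasLaw_oracleError (d := d) hN₀ hN hσ R)
  have hsM : (σ / √(N₀ + N * R.card)) ^ 2 = σ ^ 2 / (N₀ + N * R.card) := by
    rw [div_pow, Real.sq_sqrt (by positivity)]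
  rw [hsM, ← mul_div_assoc] at h2
  calc ∫⁻ ω in G, ENNReal.ofReal (‖θinf ω - θ₀‖ ^ 2) ∂P
      ≤ ∫⁻ ω in G, ENNReal.ofReal
          (‖oracleError R (fun i => x₀ i ω - θ₀, fun k i => x k i ω - ϑ k ω)‖ ^ 2) ∂P := by
        refine setLIntegral_mono_ae' hG (ae_of_all _ fun ω hω => le_of_eq ?_)
        have h3 := fixedPoint_error_eq (σ := σ) (β := β) (φ := φ) (prob := prob) (θ₀ := θ₀)
          (θ := θinf ω) (t := fun k => ϑ k ω)
          (z := (fun i => x₀ i ω - θ₀, fun k i => x k i ω - ϑ k ω)) hN₀ hN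
          (by simpa only [add_sub_cancel] using hfix ω hω)
        have h4 := oracleError_eq (R := R) (θ₀ := θ₀) (t := fun k => ϑ k ω) hN₀
          (fun k => k.elim0) (fun i => x₀ i ω - θ₀, fun k i => x k i ω - ϑ k ω)
        have hR : R = ∅ := Finset.eq_empty_of_isEmpty R
        have hN₀' : (N₀ : ℝ) ≠ 0 := by positivity
        have h5 : (N₀ : ℝ) • (θinf ω - θ₀) = (N₀ : ℝ) • oracleError R
            (fun i => x₀ i ω - θ₀, fun k i => x k i ω - ϑ k ω) := by
          simp only [hR, Finset.univ_eq_empty, Finset.sum_empty, Finset.card_empty, mul_zero,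
            add_zero, smul_zero, Nat.cast_zero] at h3 h4 ⊢
          rw [h3, h4]
        rw [smul_right_injective (E d) hN₀' h5]
    _ ≤ ∫⁻ ω, ENNReal.ofReal
          (‖oracleError R (fun i => x₀ i ω - θ₀, fun k i => x k i ω - ϑ k ω)‖ ^ 2) ∂P :=
        setLIntegral_le_lintegral _ _
    _ = ∫⁻ z, ENNReal.ofReal (‖oracleError R z‖ ^ 2) ∂(noiseLaw d 0 N₀ N σ) := by
        rw [← hnoise.map_eq]
        exact (lintegral_map' (measurable_oracleError.norm.pow_const 2).ennreal_ofReal.aemeasurable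
          hnoise.aemeasurable).symm
    _ = _ := by
        rw [← ofReal_integral_eq_lintegral_ofReal h1 (ae_of_all _ fun z => sq_nonneg _), h2]

end FixedPoint

end ColdStart

/-! ### The mean squared error bound. -/

theorem mainTheorem6 :
    -- absolute constants; `C` is the implied constant of the two `O(·)` prefactors
    ∃ c₁ c₂ c₃ C : ℝ, 0 < c₁ ∧ 0 < c₂ ∧ 0 < c₃ ∧ 0 < C ∧
    ∀ (d K N₀ N : ℕ) (_ : 0 < N₀) (_ : 0 < N)
      (σ β : ℝ) (_ : 0 < σ) (_ : 0 < β)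
      (θ₀ : ColdStart.E d)
      -- relevant sources, prior relevance probabilities, null prior
      (R : Finset (Fin K)) (prob : Fin K → ℝ) (_ : ∀ k, prob k ∈ Set.Ioo (0 : ℝ) 1)
      (φ : Measure (ColdStart.E d)) [IsProbabilityMeasure φ]
      (_ : Integrable (fun t => ‖t - θ₀‖ ^ 2) φ)
      -- regularity on a neighbourhood of `θ₀` that contains the basin
      (V L : ℝ≥0) (_ : 0 < V) (_ : 0 < L)
      (Δ : ℝ) (_ : 0 < Δ)
      (U : Set (ColdStart.E d)) (_ : U ∈ 𝓝 θ₀)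
      (_ : Metric.closedBall θ₀ (c₁ * Δ / L) ⊆ U)
      (_ : ColdStart.Regular σ θ₀ φ R U V L)
      -- probabilistic separation and identifiability margin
      (r α : ℝ) (_ : 0 < r) (_ : α ∈ Set.Icc (0 : ℝ) 1)
      (_ : φ.real {t | ‖t - θ₀‖ < r} ≤ α) (_ : K * α ≤ 1 / 2)
      (_ : ColdStart.HasMargin σ θ₀ φ R r Δ)
      -- the random source parameters, target data and source data
      (Ω : Type*) [MeasurableSpace Ω] (P : Measure Ω) [IsProbabilityMeasure P]
      (ϑ : Fin K → Ω → ColdStart.E d)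
      (x₀ : Fin N₀ → Ω → ColdStart.E d) (x : Fin K → Fin N → Ω → ColdStart.E d)
      (_ : HasLaw (fun ω => (fun i => x₀ i ω, fun k => (ϑ k ω, fun i => x k i ω)))
        (ColdStart.jointLaw N₀ N σ θ₀ φ R) P)
      -- the EM iterates
      (iter : ℕ → Ω → ColdStart.E d)
      (_ : ∀ t ω, iter (t + 1) ω =
        ColdStart.emStep σ β φ prob (fun i => x₀ i ω) (fun k i => x k i ω) (iter t ω))
      -- on the event `G` the iterates enter and remain in the basin, and converge to `θinf`
      (G : Set Ω) (_ : MeasurableSet G)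
      (_ : ∀ ω ∈ G, ∃ t₀, ∀ t ≥ t₀, iter t ω ∈ Metric.closedBall θ₀ (c₁ * Δ / L))
      (θinf : Ω → ColdStart.E d) (_ : Measurable θinf)
      (_ : ∀ ω ∈ G, Tendsto (fun t => iter t ω) atTop (𝓝 (θinf ω))),
    IntegrableOn (fun ω => ‖θinf ω - θ₀‖ ^ 2) G P ∧
    ∫ ω in G, ‖θinf ω - θ₀‖ ^ 2 ∂P ≤
      2 * d * σ ^ 2 / (N₀ + N * R.card) + 3 * K * α * r ^ 2
      + C * ((K : ℝ) ^ 2 * (N / N₀) ^ 2 * ((∫ t, ‖t - θ₀‖ ^ 2 ∂φ) + d * σ ^ 2 / N)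
            * Real.exp (2 * ⨆ k, |ColdStart.logOdds (prob k)|))
          * Real.exp (-c₂ * β * N * Δ)
      + C * ((K : ℝ) ^ (5 / 2 : ℝ) * (N / N₀) ^ 2
            * ((∫ t, ‖t - θ₀‖ ^ 2 ∂φ) + d * σ ^ 2 / N))
          * Real.exp (-c₃ * N * Δ ^ 2 / V ^ 2) := by
  refine ⟨1 / 10000, 1 / 2, 1 / 1024, 10000, by norm_num, by norm_num, by norm_num, by norm_num, ?_⟩
  intro d K N₀ N hN₀ hN σ β hσ hβ θ₀ R prob hprob φ _ hD V L hV hL Δ hΔ U hUn hU hreg r α hr hα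
    hsep hKα hmargin Ω _ P _ ϑ x₀ x hlaw iter hiter G hG hbasin θinf hθinf hlim
  have hL' : (0 : ℝ) < L := by exact_mod_cast hL
  have hN₀' : (0 : ℝ) < N₀ := by exact_mod_cast hN₀
  set ρ : ℝ := 1 / 10000 * Δ / L with hρdef
  have hρ : 0 < ρ := by positivity
  have hLρ : L * ρ = Δ / 10000 := by
    rw [hρdef]
    field_simp
  have hfix : ∀ ω ∈ G, ColdStart.emStep σ β φ prob (fun i => x₀ i ω) (fun k i => x k i ω) (θinf ω)
      = θinf ω := fun ω hω =>
    ColdStart.emStep_eq_self_of_tendsto hσ hN₀ (fun t => hiter t ω) (hlim ω hω)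
  have hball : ∀ ω ∈ G, ‖θinf ω - θ₀‖ ≤ ρ := fun ω hω => by
    obtain ⟨t₀, ht₀⟩ := hbasin ω hω
    rw [← dist_eq_norm, ← Metric.mem_closedBall]
    exact Metric.isClosed_closedBall.mem_of_tendsto (hlim ω hω)
      (eventually_atTop.2 ⟨t₀, ht₀⟩)
  have hD0 : 0 ≤ (∫ t, ‖t - θ₀‖ ^ 2 ∂φ) + d * σ ^ 2 / N :=
    add_nonneg (integral_nonneg fun t => sq_nonneg _) (by positivity)
  have hα0 := hα.1
  set T₁ : ℝ := 10000 * ((K : ℝ) ^ 2 * (N / N₀) ^ 2 * ((∫ t, ‖t - θ₀‖ ^ 2 ∂φ) + d * σ ^ 2 / N)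
    * Real.exp (2 * ⨆ k, |ColdStart.logOdds (prob k)|)) * Real.exp (-(1 / 2) * β * N * Δ) with hT₁
  set T₂ : ℝ := 10000 * ((K : ℝ) ^ (5 / 2 : ℝ) * (N / N₀) ^ 2
    * ((∫ t, ‖t - θ₀‖ ^ 2 ∂φ) + d * σ ^ 2 / N)) * Real.exp (-(1 / 1024) * N * Δ ^ 2 / V ^ 2) with hT₂
  have hT₁0 : 0 ≤ T₁ := by positivity
  have hT₂0 : 0 ≤ T₂ := by positivity
  set v : ℝ := d * σ ^ 2 / (N₀ + N * R.card) with hv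
  have hv0 : 0 ≤ v := by positivity
  have h3 : 0 ≤ 3 * K * α * r ^ 2 := by positivity
  have hvv : 2 * d * σ ^ 2 / (N₀ + N * R.card) = 2 * v := by rw [hv]; ring
  rw [hvv]
  refine ColdStart.integrableOn_and_setIntegral_le ((hθinf.sub_const θ₀).norm.pow_const 2)
    (fun ω => sq_nonneg _) (by positivity) ?_
  -- Without sources regularity is vacuous and gives no bound on ρ, but then the fixed point is the
  -- target mean itself.
  rcases Nat.eq_zero_or_pos K with hK | hK
  · exact (ColdStart.lintegral_fixedPoint_le_of_eq_zero hK hN₀ hN hσ hlaw hG hfix).trans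
      (ENNReal.ofReal_le_ofReal (by linarith))
  have hcrude (c : ℝ) (h : ∀ ω ∈ G, ‖θinf ω - θ₀‖ ^ 2 ≤ c) :
      ∫⁻ ω in G, ENNReal.ofReal (‖θinf ω - θ₀‖ ^ 2) ∂P ≤ ENNReal.ofReal c := by
    refine (setLIntegral_mono_ae' hG
      (ae_of_all _ fun ω hω => ENNReal.ofReal_le_ofReal (h ω hω))).trans ?_
    rw [setLIntegral_const]
    exact mul_le_of_le_one_right' prob_le_one
  -- In dimension zero there is no vector of norm ρ to test regularity with, and the error vanishes.
  rcases Nat.eq_zero_or_pos d with hd | hd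
  · subst hd
    refine hcrude _ fun ω _ => ?_
    rw [Subsingleton.elim (θinf ω) θ₀]
    simpa using by positivity
  -- If the basin is small compared to the oracle error, membership in it gives squared error at
  -- most ρ² ≤ 2v. Otherwise the cluster estimate applies.
  rcases le_total (2 * v) (ρ ^ 2) with hvρ | hvρ
  · exact ColdStart.lintegral_fixedPoint_le hd hK hN₀ hN hσ hβ hD hV hΔ hρ hLρ hvρ hU hreg hα0 hsep
      hKα hmargin hlaw (fun k => le_ciSup (f := fun k => |ColdStart.logOdds (prob k)|)
        (Set.finite_range _).bddAbove k) hG hfix hball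
  · refine hcrude _ fun ω hω => ?_
    have := pow_le_pow_left₀ (norm_nonneg _) (hball ω hω) 2
    linarith
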